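/- **Soundness of Deduction.** *Types and domains.* Pure types are the closed types over the grammar $\tau ::= 1 \mid \tau\times\tau \mid \tau\to\tau \mid \alpha \mid \mathrm{rec}\,\alpha.\tau \mid \tau+\tau$. A cpo is a poset with a least element and suprema of directed sets; a Scott domain is a bounded-complete algebraic cpo. Each type expression with $n$ free type variables is interpreted as a functor $(\mathbf{Scott}^{ep})^n\to\mathbf{Scott}^{ep}$ on Scott domains and embedding-projection pairs: variables are projections; $[\![1]\!]=\{\bot<\top\}$; $\times$ is the Cartesian product with componentwise order; $\sigma\to\tau$ is the set of Scott-continuous functions $[\![\sigma]\!]\to[\![\tau]\!]$ with pointwise order; $[\![\sigma+\tau]\!]=([\![\sigma]\!]\amalg[\![\tau]\!])_\bot$, with injections $\mathrm{in}_1,\mathrm{in}_2$; and $[\![\mathrm{rec}\,\alpha.\tau]\!]$ is the colimit of the chain $\{\bot\}\to G(\{\bot\})\to G^2(\{\bot\})\to\cdots$ of embedding-projection pairs with $G=[\![\tau]\!](-)$, that is, the set of all $(x_n)_n\in\prod_n G^n(\{\bot\})$ compatible with the projections, ordered pointwise. It comes with the canonical isomorphism $\mathrm{unfold}:[\![\mathrm{rec}\,\alpha.\tau]\!]\to[\![\tau[\mathrm{rec}\,\alpha.\tau/\alpha]]\!]$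 given by the universal property of the colimit. *Formulae.* Iteration terms are $t::=k\mid 0\mid t+1$ ($k$ an iteration variable). A fixpoint context $\Gamma$ is a list of distinct typed fixpoint variables. For a polarity $s\in\{\pm,+,-\}$ (with $-\pm=\pm$, $-+=-$, $--=+$) the sets $L^s(\Gamma;\tau)$ of neutral, positive and negative formulae of type $\tau$ are generated as follows (up to renaming of bound variables). $L^s(\Gamma;\tau)$ contains $\mathrm{True}$, $\mathrm{False}$ and each $X$ with $(X:\tau)\in\Gamma$, and is closed under $\wedge,\vee$; $\langle\langle\rangle\rangle\in L^s(\Gamma;1)$; if $\varphi\in L^s(\Gamma;\tau_i)$ then $\langle\pi_i\rangle\varphi\in L^s(\Gamma;\tau_1\times\tau_2)$ and $\langle\mathrm{in}_i\rangle\varphi\in L^s(\Gamma;\tau_1+\tau_2)$; if $\varphi\in L^s(\Gamma;\tau[\mathrm{rec}\,\alpha.\tau/\alpha])$ then $\langle\mathrm{fold}\rangle\varphi\in L^s(\Gamma;\mathrm{rec}\,\alpha.\tau)$; if $\varphi\in L^s(\Gamma,X{:}\tau;\tau)$ then $(\mu^tX)\varphi,(\nu^tX)\varphi\in L^s(\Gamma;\tau)$;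 if $\varphi\in L^+(\Gamma;\tau)$ and $k\,\mathrm{Pos}\,\varphi$ then $(\exists k)\varphi\in L^+(\Gamma;\tau)$; if $\varphi\in L^-(\Gamma;\tau)$ and $k\,\mathrm{Neg}\,\varphi$ then $(\forall k)\varphi\in L^-(\Gamma;\tau)$; if $\psi\in L^{-s}(\,;\sigma)$ and $\varphi\in L^{s}(\,;\tau)$ (empty fixpoint context) then $\psi\Rrightarrow\varphi\in L^s(\Gamma;\sigma\to\tau)$. Here $\mathrm{Pos}$ and $\mathrm{Neg}$ are the least relations such that: $k\,\mathrm{Pos}\,\varphi$ and $k\,\mathrm{Neg}\,\varphi$ if $k$ is not free in $\varphi$; both are preserved by $\wedge$, $\vee$ and the modalities $\langle\triangle\rangle$, $\triangle\in\{\pi_1,\pi_2,\mathrm{in}_1,\mathrm{in}_2,\mathrm{fold}\}$; $k\,\mathrm{Neg}\,\psi$ and $k\,\mathrm{Pos}\,\varphi$ imply $k\,\mathrm{Pos}\,(\psi\Rrightarrow\varphi)$, and dually; $k\,\mathrm{Pos}\,\varphi$ implies $k\,\mathrm{Pos}\,(\exists l)\varphi$, $k\,\mathrm{Pos}\,(\mu^tX)\varphi$,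 and, if $k$ is not in $t$, $k\,\mathrm{Pos}\,(\nu^tX)\varphi$; $k\,\mathrm{Neg}\,\varphi$ implies $k\,\mathrm{Neg}\,(\forall l)\varphi$, $k\,\mathrm{Neg}\,(\nu^tX)\varphi$, and, if $k$ is not in $t$, $k\,\mathrm{Neg}\,(\mu^tX)\varphi$. $L^\wedge(\tau)$ is the set of formulae built from $\mathrm{True},\mathrm{False},\langle\langle\rangle\rangle$ with $\wedge$, the modalities and $\Rrightarrow$ only. *Semantics.* A valuation $\rho$ of $\Gamma$ maps each $(X:\tau)\in\Gamma$ to a subset of $[\![\tau]\!]$ and each iteration variable to a natural number. $[\![\varphi]\!]\rho\subseteq[\![\tau]\!]$ is given by: $\wedge,\vee,\mathrm{True},\mathrm{False}$ are $\cap,\cup,[\![\tau]\!],\emptyset$; $[\![X]\!]\rho=\rho(X)$; $[\![\langle\langle\rangle\rangle]\!]\rho=\{\top\}$; $\langle\pi_i\rangle$ and $\langle\mathrm{fold}\rangle$ are the inverse images under $\pi_i$ and $\mathrm{unfold}$; $\langle\mathrm{in}_i\rangle$ is the direct image under $\mathrm{in}_i$; $[\![\psi\Rrightarrow\varphi]\!]\rho=\{f\mid\forall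 x\in[\![\psi]\!]\rho,\ f(x)\in[\![\varphi]\!]\rho\}$; $[\![(\mu^tX)\varphi]\!]\rho$ and $[\![(\nu^tX)\varphi]\!]\rho$ are the $[\![t]\!]\rho$-fold iterates of $S\mapsto[\![\varphi]\!]\rho[S/X]$ applied to $\emptyset$ and to $[\![\tau]\!]$; $(\exists k)$ and $(\forall k)$ are the union and the intersection over all values $n\in\mathbb N$ of $k$. *Deduction.* A sequent $\psi\vdash\varphi$ consists of $\psi,\varphi\in L^s(\Gamma;\tau)$ for some $s$, $\Gamma$, $\tau$. The derivable sequents and the predicate $C(\delta)$ on $\delta\in L^\wedge(\tau)$ are defined by mutual induction by the following rules, each restricted to instances all of whose sequents are sequents in this sense ("$A/B$" means that $B$ follows from $A$). Propositional: $\varphi\vdash\varphi$; $\psi\vdash\theta,\ \theta\vdash\varphi\,/\,\psi\vdash\varphi$; $\psi\wedge(\varphi\vee\theta)\vdash(\psi\wedge\varphi)\vee(\psi\wedge\theta)$; $\psi\vdash\varphi_1,\ \psi\vdash\varphi_2\,/\,\psi\vdash\varphi_1\wedge\varphi_2$; $\psi_i\vdash\varphi\,/\,\psi_1\wedge\psi_2\vdash\varphi$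 ($i=1,2$); $\psi\vdash\mathrm{True}$; $\psi\vdash\varphi_i\,/\,\psi\vdash\varphi_1\vee\varphi_2$ ($i=1,2$); $\psi_1\vdash\varphi,\ \psi_2\vdash\varphi\,/\,\psi_1\vee\psi_2\vdash\varphi$; $\mathrm{False}\vdash\varphi$. Modal: $\langle\mathrm{in}_1\rangle\varphi\wedge\langle\mathrm{in}_2\rangle\psi\vdash\mathrm{False}$; $\psi\vdash\varphi\,/\,\langle\triangle\rangle\psi\vdash\langle\triangle\rangle\varphi$; $\psi'\vdash\psi,\ \varphi\vdash\varphi'\,/\,\psi\Rrightarrow\varphi\vdash\psi'\Rrightarrow\varphi'$; $\langle\triangle\rangle\varphi_1\wedge\langle\triangle\rangle\varphi_2\vdash\langle\triangle\rangle(\varphi_1\wedge\varphi_2)$; $\mathrm{True}\vdash\langle\triangle\rangle\mathrm{True}$ for $\triangle\ne\mathrm{in}_1,\mathrm{in}_2$; $(\forall k)\langle\triangle\rangle\varphi\vdash\langle\triangle\rangle(\forall k)\varphi$; $\langle\triangle\rangle(\varphi_1\vee\varphi_2)\vdash\langle\triangle\rangle\varphi_1\vee\langle\triangle\rangle\varphi_2$;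 $\langle\triangle\rangle\mathrm{False}\vdash\mathrm{False}$; $\langle\triangle\rangle(\exists k)\varphi\vdash(\exists k)\langle\triangle\rangle\varphi$. Quantifiers: $\psi\vdash\varphi[t/k]\,/\,\psi\vdash(\exists k)\varphi$; $\theta\wedge\varphi\vdash\psi\,/\,\theta\wedge(\exists k)\varphi\vdash\psi$ if $k\notin FV(\psi,\theta)$; $(\exists k)(\exists l)\varphi\vdash(\exists k)\varphi[k/l]$; $\varphi[t/k]\vdash\psi\,/\,(\forall k)\varphi\vdash\psi$; $\psi\vdash\varphi\vee\theta\,/\,\psi\vdash(\forall k)\varphi\vee\theta$ if $k\notin FV(\psi,\theta)$; $(\forall k)\varphi[k/l]\vdash(\forall k)(\forall l)\varphi$; and, for $\kappa\in\{\mu,\nu\}$ and $k\notin FV(t)$, $(\kappa^tX)(\exists k)\varphi\vdash(\exists k)(\kappa^tX)\varphi$ and $(\forall k)(\kappa^tX)\varphi\vdash(\kappa^tX)(\forall k)\varphi$. Bounded iteration: $(\mu^0X)\varphi\vdash\mathrm{False}$; $(\mu^tX)\varphi\vdash\psi\,/\,(\mu^{t+1}X)\varphi\vdash\varphi[\psi/X]$;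 $\varphi[(\mu^tX)\varphi/X]\vdash(\mu^{t+1}X)\varphi$; $\psi\vdash\varphi\,/\,(\mu^tX)\psi\vdash(\mu^tX)\varphi$; $\mathrm{True}\vdash(\nu^0X)\varphi$; $\psi\vdash(\nu^tX)\varphi\,/\,\varphi[\psi/X]\vdash(\nu^{t+1}X)\varphi$; $(\nu^{t+1}X)\varphi\vdash\varphi[(\nu^tX)\varphi/X]$; $\psi\vdash\varphi\,/\,(\nu^tX)\psi\vdash(\nu^tX)\varphi$. Realizability implication: (WF) $(\forall k)\psi\Rrightarrow\varphi\vdash(\exists k)(\psi\Rrightarrow\varphi)$ if $k\notin FV(\varphi)$; (CC) $\psi\Rrightarrow(\exists k)\varphi\vdash(\exists k)(\psi\Rrightarrow\varphi)$ if $\psi\in L^\pm$ and $k\notin FV(\psi)$; $(\forall k)(\psi\Rrightarrow\varphi)\vdash(\exists k)\psi\Rrightarrow\varphi$ if $k\notin FV(\varphi)$; $(\forall k)(\psi\Rrightarrow\varphi)\vdash\psi\Rrightarrow(\forall k)\varphi$ if $k\notin FV(\psi)$; $(\psi\Rrightarrow\varphi_1)\wedge(\psi\Rrightarrow\varphi_2)\vdash\psi\Rrightarrow(\varphi_1\wedge\varphi_2)$;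 $\mathrm{True}\vdash\psi\Rrightarrow\mathrm{True}$; $(\psi_1\Rrightarrow\varphi)\wedge(\psi_2\Rrightarrow\varphi)\vdash(\psi_1\vee\psi_2)\Rrightarrow\varphi$; $\mathrm{True}\vdash\mathrm{False}\Rrightarrow\varphi$; ($\Rrightarrow/\vee$) $\delta\Rrightarrow(\varphi_1\vee\varphi_2)\vdash(\delta\Rrightarrow\varphi_1)\vee(\delta\Rrightarrow\varphi_2)$ if $\delta\in L^\wedge$; (C) $(\delta\Rrightarrow\mathrm{False})\vdash\mathrm{False}$ if $\delta\in L^\wedge$ and $C(\delta)$. Consistency: $C(\langle\langle\rangle\rangle)$; $C(\mathrm{True})$; $C(\varphi)\,/\,C(\langle\triangle\rangle\varphi)$ for $\triangle\in\{\mathrm{fold},\mathrm{in}_1,\mathrm{in}_2\}$; $C(\varphi),C(\psi)\,/\,C(\langle\pi_1\rangle\varphi\wedge\langle\pi_2\rangle\psi)$; $C(\psi),\ \psi\vdash\varphi\,/\,C(\varphi)$ if $\varphi\in L^\wedge$; and $C(\bigwedge_{i\in I}(\psi_i\Rrightarrow\varphi_i))$ whenever $I$ is finite, $C(\psi_i)$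 and $C(\varphi_i)$ for all $i\in I$, and for every $J\subseteq I$ either $\bigwedge_{j\in J}\psi_j\vdash\mathrm{False}$ or $C(\bigwedge_{j\in J}\varphi_j)$. *Theorem.* 1. For every pure type $\tau$ and every $\delta\in L^\wedge(\tau)$, if $C(\delta)$ is derivable then $[\![\delta]\!]\neq\emptyset$. 2. For every polarity $s$, fixpoint context $\Gamma$, pure type $\tau$ and $\varphi,\psi\in L^s(\Gamma;\tau)$, if $\psi\vdash\varphi$ is derivable then $[\![\psi]\!]\rho\subseteq[\![\varphi]\!]\rho$ for every valuation $\rho$ of $\Gamma$. -/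

import Mathlib

open CategoryTheory

namespace RefLogic

/-! ### Cpos and Scott-continuous functions -/

/-- A cpo: a partial order with a least element and suprema of all (non-empty) directed subsets.
Scott domains are the bounded-complete algebraic cpos. They form a full subcategory of the category
of cpos and Scott-continuous functions, closed under the constructions below, so that the
interpretation of types can be computed among cpos. -/
structure Cpo : Type 1 where
  carrier : Type
  [po : PartialOrder carrier]
  exists_bot : ∃ b : carrier, ∀ x, b ≤ x
  exists_lub : ∀ d : Set carrier, d.Nonempty → DirectedOn (· ≤ ·) d → ∃ a, IsLUB d a

instance : CoeSort Cpo Type := ⟨Cpo.carrier⟩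

instance (X : Cpo) : PartialOrder X := X.po

/-- Scott-continuous functions, ordered pointwise. -/
structure ScottHom (X Y : Cpo) : Type where
  toFun : X → Y
  continuous : ScottContinuous toFun

namespace ScottHom

instance (X Y : Cpo) : CoeFun (ScottHom X Y) (fun _ => X → Y) := ⟨ScottHom.toFun⟩

theorem ext {X Y : Cpo} {f g : ScottHom X Y} (h : ∀ x, f x = g x) : f = g := by
  cases f; cases g
  congr
  exact funext h

instance (X Y : Cpo) : PartialOrder (ScottHom X Y) :=
  PartialOrder.lift ScottHom.toFun fun _ _ h => ext (congrFun h)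

theorem mono {X Y : Cpo} (f : ScottHom X Y) {x y : X} (h : x ≤ y) : f x ≤ f y :=
  f.2.monotone h

theorem apply_le {X Y : Cpo} {f g : ScottHom X Y} (h : f ≤ g) (x : X) : f x ≤ g x :=
  (show f.1 ≤ g.1 from h) x

def id (X : Cpo) : ScottHom X X := ⟨_root_.id, ScottContinuous.id⟩

def comp {X Y Z : Cpo} (g : ScottHom Y Z) (f : ScottHom X Y) : ScottHom X Z :=
  ⟨fun x => g (f x), ScottContinuous.comp f.2 g.2⟩

end ScottHom

theorem directedOn_image {α β : Type} [PartialOrder α] [PartialOrder β] {f : α → β}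
    (hf : Monotone f) {d : Set α} (hd : DirectedOn (· ≤ ·) d) : DirectedOn (· ≤ ·) (f '' d) := by
  rintro _ ⟨x, hx, rfl⟩ _ ⟨y, hy, rfl⟩
  obtain ⟨z, hz, hxz, hyz⟩ := hd x hx y hy
  exact ⟨f z, ⟨z, hz, rfl⟩, hf hxz, hf hyz⟩

theorem scottContinuous_of_apply {X Y : Cpo} {F : Set (ScottHom X Y)} {s : X → Y}
    (hs : ∀ x, IsLUB ((fun f : ScottHom X Y => f x) '' F) (s x)) : ScottContinuous s := by
  intro d hd hdir a ha
  constructor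
  · rintro _ ⟨x, hx, rfl⟩
    refine (hs x).2 ?_
    rintro _ ⟨f, hf, rfl⟩
    exact (f.mono (ha.1 hx)).trans ((hs a).1 ⟨f, hf, rfl⟩)
  · intro b hb
    refine (hs a).2 ?_
    rintro _ ⟨f, hf, rfl⟩
    refine (f.2 hd hdir ha).2 ?_
    rintro _ ⟨x, hx, rfl⟩
    exact ((hs x).1 ⟨f, hf, rfl⟩).trans (hb ⟨x, hx, rfl⟩)

theorem isLUB_of_apply {X Y : Cpo} {F : Set (ScottHom X Y)} {s : X → Y}
    (hs : ∀ x, IsLUB ((fun f : ScottHom X Y => f x) '' F) (s x)) :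
    IsLUB F (⟨s, scottContinuous_of_apply hs⟩ : ScottHom X Y) := by
  refine ⟨fun f hf x => (hs x).1 ⟨f, hf, rfl⟩, fun g hg x => (hs x).2 ?_⟩
  rintro _ ⟨f, hf, rfl⟩
  exact ScottHom.apply_le (hg hf) x

theorem directedOn_apply {X Y : Cpo} {F : Set (ScottHom X Y)} (hF : DirectedOn (· ≤ ·) F) (x : X) :
    DirectedOn (· ≤ ·) ((fun f : ScottHom X Y => f x) '' F) :=
  directedOn_image (fun (f g : ScottHom X Y) (h : f ≤ g) => ScottHom.apply_le h x) hF

theorem exists_lub_apply {X Y : Cpo} {F : Set (ScottHom X Y)} (hn : F.Nonempty)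
    (hF : DirectedOn (· ≤ ·) F) :
    ∃ s : X → Y, ∀ x, IsLUB ((fun f : ScottHom X Y => f x) '' F) (s x) := by
  choose s hs using fun x => Y.exists_lub _ (hn.image _) (directedOn_apply hF x)
  exact ⟨s, hs⟩

/-- Directed suprema of Scott-continuous functions are pointwise. -/
theorem isLUB_fn {X Y : Cpo} {F : Set (ScottHom X Y)} (hn : F.Nonempty)
    (hF : DirectedOn (· ≤ ·) F) {a : ScottHom X Y} (ha : IsLUB F a) (x : X) :
    IsLUB ((fun f : ScottHom X Y => f x) '' F) (a x) := by
  obtain ⟨s, hs⟩ := exists_lub_apply hn hF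
  rw [ha.unique (isLUB_of_apply hs)]
  exact hs x

namespace Cpo

/-- The one-point cpo. -/
def one : Cpo where
  carrier := Unit
  exists_bot := ⟨(), fun _ => le_rfl⟩
  exists_lub := fun _ _ _ => ⟨(), fun _ _ => le_rfl, fun _ _ => le_rfl⟩

/-- The two-point cpo `{⊥ < ⊤}`, with `⊥ = false` and `⊤ = true`. -/
def two : Cpo where
  carrier := Bool
  exists_bot := ⟨false, fun _ => Bool.false_le _⟩
  exists_lub := fun d _ _ => ⟨sSup d, isLUB_sSup d⟩

/-- Cartesian product with the component-wise order. -/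
def prod (X Y : Cpo) : Cpo where
  carrier := X × Y
  exists_bot := by
    obtain ⟨a, ha⟩ := X.exists_bot
    obtain ⟨b, hb⟩ := Y.exists_bot
    exact ⟨(a, b), fun x => ⟨ha _, hb _⟩⟩
  exists_lub := by
    intro d hn hd
    obtain ⟨a, ha⟩ := X.exists_lub _ (hn.image _) (directedOn_image monotone_fst hd)
    obtain ⟨b, hb⟩ := Y.exists_lub _ (hn.image _) (directedOn_image monotone_snd hd)
    exact ⟨(a, b), isLUB_prod.2 ⟨ha, hb⟩⟩

/-- The function space, with the pointwise order. -/
def fn (X Y : Cpo) : Cpo where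
  carrier := ScottHom X Y
  exists_bot := by
    obtain ⟨b, hb⟩ := Y.exists_bot
    exact ⟨⟨Function.const X b, ScottContinuous.const b⟩, fun f x => hb _⟩
  exists_lub := by
    intro d hn hd
    obtain ⟨s, hs⟩ := exists_lub_apply hn hd
    exact ⟨_, isLUB_of_apply hs⟩

end Cpo

/-- Directed sets meeting an order-embedded, upward closed part of a partial order. -/
theorem preimage_directed {Z S : Type} [PartialOrder Z] [PartialOrder S] {i : Z → S}
    (hi : ∀ a b, i a ≤ i b ↔ a ≤ b) (hup : ∀ a s, i a ≤ s → ∃ b, s = i b) {d : Set S}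
    (hd : DirectedOn (· ≤ ·) d) {z : Z} (hz : i z ∈ d) :
    DirectedOn (· ≤ ·) (i ⁻¹' d) ∧ ∀ w ∈ d, ∃ x, i x ∈ d ∧ w ≤ i x := by
  have key : ∀ w ∈ d, ∃ x, i x ∈ d ∧ w ≤ i x := by
    intro w hw
    obtain ⟨v, hv, h1, h2⟩ := hd _ hz _ hw
    obtain ⟨b, rfl⟩ := hup _ _ h1
    exact ⟨b, hv, h2⟩
  refine ⟨?_, key⟩
  intro a ha b hb
  obtain ⟨v, hv, h1, h2⟩ := hd _ ha _ hb
  obtain ⟨c, hc, h3⟩ := key v hv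
  exact ⟨c, hc, (hi _ _).1 (h1.trans h3), (hi _ _).1 (h2.trans h3)⟩

theorem isLUB_preimage {Z S : Type} [PartialOrder Z] [PartialOrder S] {i : Z → S}
    (hi : ∀ a b, i a ≤ i b ↔ a ≤ b) (hup : ∀ a s, i a ≤ s → ∃ b, s = i b) {d : Set S}
    (hd : DirectedOn (· ≤ ·) d) {z : Z} (hz : i z ∈ d) {a : Z} :
    IsLUB d (i a) ↔ IsLUB (i ⁻¹' d) a := by
  obtain ⟨-, key⟩ := preimage_directed hi hup hd hz
  constructor
  · intro h
    refine ⟨fun x hx => (hi _ _).1 (h.1 hx), fun b hb => (hi _ _).1 (h.2 fun w hw => ?_)⟩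
    obtain ⟨x, hx, hwx⟩ := key w hw
    exact hwx.trans ((hi _ _).2 (hb hx))
  · intro h
    refine ⟨fun w hw => ?_, fun s hs => ?_⟩
    · obtain ⟨x, hx, hwx⟩ := key w hw
      exact hwx.trans ((hi _ _).2 (h.1 hx))
    · obtain ⟨b, rfl⟩ := hup _ _ (hs hz)
      exact (hi _ _).2 (h.2 fun x hx => (hi _ _).1 (hs hx))

section Sum

variable {X Y : Type} [PartialOrder X] [PartialOrder Y]

/-- The injections into the weak coproduct `(X ⨿ Y)_⊥`. -/
def inl (x : X) : WithBot (X ⊕ Y) := ((Sum.inl x : X ⊕ Y) : WithBot (X ⊕ Y))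

def inr (y : Y) : WithBot (X ⊕ Y) := ((Sum.inr y : X ⊕ Y) : WithBot (X ⊕ Y))

theorem inl_le (a b : X) : (inl a : WithBot (X ⊕ Y)) ≤ inl b ↔ a ≤ b := by simp [inl]

theorem inr_le (a b : Y) : (inr a : WithBot (X ⊕ Y)) ≤ inr b ↔ a ≤ b := by simp [inr]

theorem inl_up (a : X) (s : WithBot (X ⊕ Y)) (h : inl a ≤ s) : ∃ b, s = inl b := by
  rcases s with _ | (b | b)
  · exact absurd h (WithBot.not_coe_le_bot _)
  · exact ⟨b, rfl⟩
  · exact absurd (WithBot.coe_le_coe.1 h) Sum.not_inl_le_inr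

theorem inr_up (a : Y) (s : WithBot (X ⊕ Y)) (h : inr a ≤ s) : ∃ b, s = inr b := by
  rcases s with _ | (b | b)
  · exact absurd h (WithBot.not_coe_le_bot _)
  · exact absurd (WithBot.coe_le_coe.1 h) Sum.not_inr_le_inl
  · exact ⟨b, rfl⟩

theorem sum_cases {X Y : Type} (d : Set (WithBot (X ⊕ Y))) :
    (∃ x, inl x ∈ d) ∨ (∃ y, inr y ∈ d) ∨ ∀ w ∈ d, w = ⊥ := by
  by_contra! h
  obtain ⟨h1, h2, w, hw, hne⟩ := h
  rcases w with _ | (b | b)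
  · exact hne rfl
  · exact h1 b hw
  · exact h2 b hw

theorem isLUB_image_of_cofinal {Z S T : Type} [PartialOrder Z] [PartialOrder S] [PartialOrder T]
    {i : Z → S} (hi : ∀ a b, i a ≤ i b ↔ a ≤ b) (hup : ∀ a s, i a ≤ s → ∃ b, s = i b) {h : S → T}
    (hm : Monotone h) (hc : ScottContinuous (fun z => h (i z))) {d : Set S}
    (hd : DirectedOn (· ≤ ·) d) {z : Z} (hz : i z ∈ d) {s : S} (hs : IsLUB d s) :
    IsLUB (h '' d) (h s) := by
  obtain ⟨a, rfl⟩ := hup _ _ (hs.1 hz)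
  refine ⟨?_, fun b hb => ?_⟩
  · rintro _ ⟨w, hw, rfl⟩
    exact hm (hs.1 hw)
  · refine (hc ⟨z, hz⟩ (preimage_directed hi hup hd hz).1
      ((isLUB_preimage hi hup hd hz).1 hs)).2 ?_
    rintro _ ⟨x, hx, rfl⟩
    exact hb ⟨i x, hx, rfl⟩

end Sum

namespace Cpo

/-- The weak coproduct `(X ⨿ Y)_⊥`: the disjoint union with a new least element. -/
def sum (X Y : Cpo) : Cpo where
  carrier := WithBot (X ⊕ Y)
  exists_bot := ⟨⊥, fun _ => bot_le⟩
  exists_lub := by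
    intro d hn hd
    rcases sum_cases d with ⟨x, hx⟩ | ⟨y, hy⟩ | h
    · obtain ⟨a, ha⟩ := X.exists_lub _ ⟨x, hx⟩ (preimage_directed inl_le inl_up hd hx).1
      exact ⟨inl a, (isLUB_preimage inl_le inl_up hd hx).2 ha⟩
    · obtain ⟨a, ha⟩ := Y.exists_lub _ ⟨y, hy⟩ (preimage_directed inr_le inr_up hd hy).1
      exact ⟨inr a, (isLUB_preimage inr_le inr_up hd hy).2 ha⟩
    · exact ⟨⊥, fun w hw => (h w hw).le, fun _ _ => bot_le⟩

end Cpo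

namespace ScottHom

variable {X X' Y Y' : Cpo}

/-- The map `f + g` between weak coproducts. -/
def sumFun (f : X → X') (g : Y → Y') : WithBot (X ⊕ Y) → WithBot (X' ⊕ Y') :=
  WithBot.map (Sum.map f g)

theorem sumFun_mono {f : X → X'} {g : Y → Y'} (hf : Monotone f) (hg : Monotone g) :
    Monotone (sumFun f g) :=
  WithBot.monotone_map_iff.2 (by
    rintro (a | a) (b | b) h
    · exact Sum.inl_le_inl_iff.2 (hf (Sum.inl_le_inl_iff.1 h))
    · exact absurd h Sum.not_inl_le_inr
    · exact absurd h Sum.not_inr_le_inl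
    · exact Sum.inr_le_inr_iff.2 (hg (Sum.inr_le_inr_iff.1 h)))

theorem inl_continuous : ScottContinuous (inl : X → WithBot (X ⊕ Y)) := by
  intro d hd hdir a ha
  refine ⟨?_, fun s hs => ?_⟩
  · rintro _ ⟨x, hx, rfl⟩
    exact (inl_le _ _).2 (ha.1 hx)
  · obtain ⟨x, hx⟩ := hd
    obtain ⟨b, rfl⟩ := inl_up _ _ (hs ⟨x, hx, rfl⟩)
    exact (inl_le _ _).2 (ha.2 fun y hy => (inl_le _ _).1 (hs ⟨y, hy, rfl⟩))

theorem inr_continuous : ScottContinuous (inr : Y → WithBot (X ⊕ Y)) := by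
  intro d hd hdir a ha
  refine ⟨?_, fun s hs => ?_⟩
  · rintro _ ⟨x, hx, rfl⟩
    exact (inr_le _ _).2 (ha.1 hx)
  · obtain ⟨x, hx⟩ := hd
    obtain ⟨b, rfl⟩ := inr_up _ _ (hs ⟨x, hx, rfl⟩)
    exact (inr_le _ _).2 (ha.2 fun y hy => (inr_le _ _).1 (hs ⟨y, hy, rfl⟩))

def sumMap (f : ScottHom X X') (g : ScottHom Y Y') : ScottHom (X.sum Y) (X'.sum Y') :=
  ⟨sumFun f.1 g.1, by
    have hm : Monotone (sumFun f.1 g.1) := sumFun_mono f.2.monotone g.2.monotone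
    intro d hd hdir a ha
    rcases sum_cases d with ⟨x, hx⟩ | ⟨y, hy⟩ | h
    · exact isLUB_image_of_cofinal inl_le inl_up hm (f.2.comp inl_continuous) hdir hx ha
    · exact isLUB_image_of_cofinal inr_le inr_up hm (g.2.comp inr_continuous) hdir hy ha
    · have ha' : a = (⊥ : WithBot (X ⊕ Y)) := 
        le_antisymm (ha.2 fun w hw => (h w hw).le) (bot_le (α := WithBot (X ⊕ Y)))
      subst ha'
      refine ⟨?_, fun u _ => bot_le (α := WithBot (X' ⊕ Y'))⟩
      rintro _ ⟨w, hw, rfl⟩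
      exact hm (h w hw).le⟩

def prodMap (f : ScottHom X X') (g : ScottHom Y Y') : ScottHom (X.prod Y) (X'.prod Y') :=
  ⟨fun p => (f p.1, g p.2),
    ScottContinuous.prodMk (ScottContinuous.comp ScottContinuous.fst f.2)
      (ScottContinuous.comp ScottContinuous.snd g.2)⟩

/-- The map `h ↦ g ∘ h ∘ f` between function spaces. -/
def fnMap (f : ScottHom X' X) (g : ScottHom Y Y') : ScottHom (X.fn Y) (X'.fn Y') :=
  ⟨fun h => g.comp (ScottHom.comp h f), by
    intro d hd hdir a ha
    have ptw := isLUB_fn hd hdir ha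
    refine ⟨?_, fun u hu x => ?_⟩
    · rintro _ ⟨h, hh, rfl⟩
      exact fun x => g.mono (ScottHom.apply_le (ha.1 hh) (f x))
    · refine (g.2 (hd.image _) (directedOn_apply hdir _) (ptw (f x))).2 ?_
      rintro _ ⟨_, ⟨h, hh, rfl⟩, rfl⟩
      exact ScottHom.apply_le (hu ⟨h, hh, rfl⟩) x⟩

end ScottHom

/-! ### Embedding-projection pairs -/

/-- An embedding-projection pair from `X` to `Y`. -/
structure EP (X Y : Cpo) where
  L : ScottHom X Y
  R : ScottHom Y X
  RL : ∀ x, R (L x) = x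
  LR : ∀ y, L (R y) ≤ y

/-- The embedding is determined by the projection. -/
theorem EP.ext {X Y : Cpo} {e f : EP X Y} (h : ∀ y, e.R y = f.R y) : e = f := by
  have hL : ∀ (e f : EP X Y), (∀ y, e.R y = f.R y) → ∀ x, e.L x ≤ f.L x := by
    intro e f h x
    have := e.LR (f.L x)
    rwa [h, f.RL] at this
  have h1 : e.L = f.L := ScottHom.ext fun x =>
    le_antisymm (hL e f h x) (hL f e (fun y => (h y).symm) x)
  have h2 : e.R = f.R := ScottHom.ext h
  cases e; cases f
  simp only at h1 h2
  subst h1; subst h2; rfl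

/-- The category of cpos and embedding-projection pairs. -/
instance : Category.{0} Cpo where
  Hom := EP
  id X := ⟨ScottHom.id X, ScottHom.id X, fun _ => rfl, fun _ => le_rfl⟩
  comp e f := ⟨f.L.comp e.L, e.R.comp f.R,
    fun x => (congrArg e.R (f.RL (e.L x))).trans (e.RL x),
    fun y => (f.L.mono (e.LR (f.R y))).trans (f.LR y)⟩
  id_comp _ := rfl
  comp_id _ := rfl
  assoc _ _ _ := rfl

namespace EP

variable {X Y Z X' Y' : Cpo}

theorem hom_ext {e f : X ⟶ Y} (h : ∀ y, e.R y = f.R y) : e = f := EP.ext h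

theorem comp_R (e : X ⟶ Y) (f : Y ⟶ Z) (z : Z) : (e ≫ f).R z = e.R (f.R z) := rfl

theorem comp_L (e : X ⟶ Y) (f : Y ⟶ Z) (x : X) : (e ≫ f).L x = f.L (e.L x) := rfl

theorem id_R (x : X) : EP.R (𝟙 X) x = x := rfl

theorem id_L (x : X) : EP.L (𝟙 X) x = x := rfl

/-- The one-point cpo is initial for embedding-projection pairs. -/
noncomputable def init (X : Cpo) : Cpo.one ⟶ X :=
  EP.mk (X := Cpo.one) (Y := X)
    ⟨Function.const _ X.exists_bot.choose, ScottContinuous.const _⟩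
    ⟨Function.const _ (), ScottContinuous.const _⟩ (fun _ => rfl)
    (fun y => X.exists_bot.choose_spec y)

theorem init_comp (e : X ⟶ Y) : init X ≫ e = init Y := hom_ext fun _ => rfl

def prod (e : X ⟶ X') (f : Y ⟶ Y') : X.prod Y ⟶ X'.prod Y' :=
  EP.mk (X := X.prod Y) (Y := X'.prod Y') (e.L.prodMap f.L) (e.R.prodMap f.R)
    (fun _ => Prod.ext (e.RL _) (f.RL _)) (fun _ => ⟨e.LR _, f.LR _⟩)

def sum (e : X ⟶ X') (f : Y ⟶ Y') : X.sum Y ⟶ X'.sum Y' :=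
  EP.mk (X := X.sum Y) (Y := X'.sum Y') (e.L.sumMap f.L) (e.R.sumMap f.R)
    (by
      rintro (_ | (x | y))
      · rfl
      · exact congrArg inl (e.RL x)
      · exact congrArg inr (f.RL y))
    (by
      rintro (_ | (x | y))
      · exact le_rfl
      · exact (inl_le _ _).2 (e.LR x)
      · exact (inr_le _ _).2 (f.LR y))

def fn (e : X ⟶ X') (f : Y ⟶ Y') : X.fn Y ⟶ X'.fn Y' :=
  EP.mk (X := X.fn Y) (Y := X'.fn Y') (ScottHom.fnMap e.R f.L) (ScottHom.fnMap e.L f.R)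
    (fun h => ScottHom.ext fun x => by
      change f.R (f.L (ScottHom.comp h (ScottHom.comp e.R e.L) x)) = _
      rw [f.RL]
      exact congrArg h.1 (e.RL x))
    (fun h x => (f.LR _).trans (ScottHom.mono h (e.LR x)))

end EP

section Functors

variable {E : Type 1} [Category.{0} E]

def prodF (F G : E ⥤ Cpo) : E ⥤ Cpo where
  obj B := (F.obj B).prod (G.obj B)
  map f := EP.prod (F.map f) (G.map f)
  map_id B := by rw [F.map_id, G.map_id]; rfl
  map_comp f g := by rw [F.map_comp, G.map_comp]; rfl

def sumF (F G : E ⥤ Cpo) : E ⥤ Cpo where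
  obj B := (F.obj B).sum (G.obj B)
  map f := EP.sum (F.map f) (G.map f)
  map_id B := by
    rw [F.map_id, G.map_id]
    refine EP.hom_ext ?_
    rintro (_ | (x | y)) <;> rfl
  map_comp f g := by
    rw [F.map_comp, G.map_comp]
    refine EP.hom_ext ?_
    rintro (_ | (x | y)) <;> rfl

def fnF (F G : E ⥤ Cpo) : E ⥤ Cpo where
  obj B := (F.obj B).fn (G.obj B)
  map f := EP.fn (F.map f) (G.map f)
  map_id B := by rw [F.map_id, G.map_id]; rfl
  map_comp f g := by rw [F.map_comp, G.map_comp]; rfl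

end Functors

/-! ### Colimits of `ω`-chains of embedding-projection pairs -/

section Lim

variable (K : ℕ ⥤ Cpo)

/-- Threads of a chain of projections, ordered pointwise. -/
structure Thread : Type where
  seq : ∀ n, K.obj n
  compat : ∀ n m (h : n ≤ m), (K.map (homOfLE h)).R (seq m) = seq n

variable {K}

theorem Thread.ext {x y : Thread K} (h : ∀ n, x.seq n = y.seq n) : x = y := by
  cases x; cases y
  congr
  exact funext h

instance : PartialOrder (Thread K) :=
  PartialOrder.lift Thread.seq fun _ _ h => Thread.ext (congrFun h)

theorem Thread.isLUB {d : Set (Thread K)} (hn : d.Nonempty) (hd : DirectedOn (· ≤ ·) d) :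
    ∃ a : Thread K, IsLUB d a ∧ ∀ n, IsLUB ((fun x : Thread K => x.1 n) '' d) (a.1 n) := by
  have hdn : ∀ n, DirectedOn (· ≤ ·) ((fun x : Thread K => x.1 n) '' d) := fun n =>
    directedOn_image (fun (x y : Thread K) (h : x ≤ y) => (show x.1 ≤ y.1 from h) n) hd
  choose a ha using fun n => (K.obj n).exists_lub _ (hn.image fun x : Thread K => x.1 n) (hdn n)
  refine ⟨⟨a, fun n m h => ?_⟩, ⟨fun x hx n => (ha n).1 ⟨x, hx, rfl⟩, fun y hy n => ?_⟩, ha⟩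
  · have h1 := (K.map (homOfLE h)).R.2 (hn.image _) (hdn m) (ha m)
    rw [Set.image_image] at h1
    refine h1.unique ?_
    convert ha n using 1
    exact Set.image_congr fun x _ => x.2 n m h
  · refine (ha n).2 ?_
    rintro _ ⟨x, hx, rfl⟩
    exact (show x.1 ≤ y.1 from hy hx) n

theorem Thread.isLUB_apply {d : Set (Thread K)} (hn : d.Nonempty) (hd : DirectedOn (· ≤ ·) d)
    {a : Thread K} (ha : IsLUB d a) (n : ℕ) :
    IsLUB ((fun x : Thread K => x.1 n) '' d) (a.1 n) := by
  obtain ⟨b, hb, h⟩ := Thread.isLUB hn hd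
  rw [ha.unique hb]
  exact h n

variable (K)

/-- The limit of the projections of a chain of embedding-projection pairs. -/
def Lim : Cpo where
  carrier := Thread K
  exists_bot := by
    choose b hb using fun n => (K.obj n).exists_bot
    refine ⟨⟨b, fun n m h => le_antisymm ?_ (hb _ _)⟩, fun _ n => hb n _⟩
    calc (K.map (homOfLE h)).R (b m) ≤ (K.map (homOfLE h)).R ((K.map (homOfLE h)).L (b n)) :=
          ScottHom.mono _ (hb _ _)
      _ = b n := EP.RL _ _
  exists_lub := fun d hn hd => (Thread.isLUB hn hd).imp fun _ h => h.1

variable {K}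

theorem map_R_map_R {n m l : ℕ} (h : n ≤ m) (h' : m ≤ l) (x : K.obj l) :
    (K.map (homOfLE h)).R ((K.map (homOfLE h')).R x) = (K.map (homOfLE (h.trans h'))).R x := by
  rw [← EP.comp_R, ← K.map_comp]; rfl

theorem map_L_map_L {n m l : ℕ} (h : n ≤ m) (h' : m ≤ l) (x : K.obj n) :
    (K.map (homOfLE h')).L ((K.map (homOfLE h)).L x) = (K.map (homOfLE (h.trans h'))).L x := by
  rw [← EP.comp_L, ← K.map_comp]; rfl

theorem map_RL_indep {n m a b : ℕ} (hna : n ≤ a) (hma : m ≤ a) (hab : a ≤ b) (x : K.obj n) :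
    (K.map (homOfLE (hma.trans hab))).R ((K.map (homOfLE (hna.trans hab))).L x) =
      (K.map (homOfLE hma)).R ((K.map (homOfLE hna)).L x) := by
  rw [← map_R_map_R hma hab, ← map_L_map_L hna hab, EP.RL]

variable (K)

/-- The components of the colimiting cocone: the projections are the set-theoretic ones. -/
def cocone (n : ℕ) : K.obj n ⟶ Lim K :=
  EP.mk (X := K.obj n) (Y := Lim K)
    ⟨fun x => ⟨fun m => (K.map (homOfLE (le_max_right n m))).R
        ((K.map (homOfLE (le_max_left n m))).L x), fun m l h =>
          (map_R_map_R h (le_max_right n l) _).trans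
            (map_RL_indep (le_max_left n m) (le_max_right n m) (max_le_max_left n h) x)⟩,
      by
        intro d hd hdir a ha
        refine ⟨?_, fun y hy m => ?_⟩
        · rintro _ ⟨x, hx, rfl⟩
          exact fun m => ScottHom.mono _ (ScottHom.mono _ (ha.1 hx))
        · refine ((ScottHom.comp _ _).2 hd hdir ha :
            IsLUB _ (((K.map (homOfLE (le_max_right n m))).R.comp
              (K.map (homOfLE (le_max_left n m))).L) a)).2 ?_
          rintro _ ⟨x, hx, rfl⟩
          exact (show _ ≤ y.1 from hy ⟨x, hx, rfl⟩) m⟩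
    ⟨fun x => x.1 n, fun _ hd hdir _ ha => Thread.isLUB_apply hd hdir ha n⟩
    (fun x => by
      have h := map_RL_indep (K := K) (le_refl n) (le_refl n) (le_max_left n n) x
      exact h.trans (EP.RL _ _))
    (fun y m => by
      change (K.map (homOfLE (le_max_right n m))).R
        ((K.map (homOfLE (le_max_left n m))).L (y.1 n)) ≤ y.1 m
      rw [← y.2 n _ (le_max_left n m), ← y.2 m _ (le_max_right n m)]
      exact ScottHom.mono _ (EP.LR _ _))

theorem cocone_w {n m : ℕ} (h : n ≤ m) : K.map (homOfLE h) ≫ cocone K m = cocone K n :=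
  EP.hom_ext fun y => y.2 n m h

variable {K}

theorem cocone_of_succ {Y : Cpo} (c : ∀ n, K.obj n ⟶ Y)
    (hc : ∀ n, K.map (homOfLE (Nat.le_add_right n 1)) ≫ c (n + 1) = c n) (n m : ℕ) (h : n ≤ m) :
    K.map (homOfLE h) ≫ c m = c n := by
  induction m, h using Nat.le_induction with
  | base => exact (congrArg (· ≫ c n) (K.map_id n)).trans (Category.id_comp _)
  | succ m h ih =>
    rw [← ih, ← hc m, ← Category.assoc, ← Functor.map_comp]
    rfl

theorem desc_mono {Y : Cpo} (c : ∀ n, K.obj n ⟶ Y)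
    (hc : ∀ n m (h : n ≤ m), K.map (homOfLE h) ≫ c m = c n) (x : Thread K) :
    Monotone fun n => (c n).L (x.1 n) := by
  intro n m h
  change (c n).L (x.1 n) ≤ (c m).L (x.1 m)
  rw [← hc n m h, EP.comp_L, ← x.2 n m h]
  exact ScottHom.mono _ (EP.LR _ _)

theorem exists_desc {Y : Cpo} (c : ∀ n, K.obj n ⟶ Y)
    (hc : ∀ n m (h : n ≤ m), K.map (homOfLE h) ≫ c m = c n) (x : Thread K) :
    ∃ y, IsLUB (Set.range fun n => (c n).L (x.1 n)) y :=
  Y.exists_lub _ (Set.range_nonempty _)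
    (directedOn_range.2 (desc_mono c hc x).directed_le)

/-- The mediating morphism out of the colimit of a chain: the embedding takes a thread `x` to the
supremum of the `(c n).L (x n)`, and the projection takes `y` to the thread of the `(c n).R y`. -/
noncomputable def desc {Y : Cpo} (c : ∀ n, K.obj n ⟶ Y)
    (hc : ∀ n m (h : n ≤ m), K.map (homOfLE h) ≫ c m = c n) : Lim K ⟶ Y :=
  EP.mk (X := Lim K) (Y := Y)
    ⟨fun x => (exists_desc c hc x).choose, by
      intro d hd hdir a ha
      have hs := fun x : Thread K => (exists_desc c hc x).choose_spec
      refine ⟨?_, fun y hy => ?_⟩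
      · rintro _ ⟨x, hx, rfl⟩
        refine (hs x).2 ?_
        rintro _ ⟨n, rfl⟩
        exact (ScottHom.mono _ ((show x.1 ≤ a.1 from ha.1 hx) n)).trans ((hs a).1 ⟨n, rfl⟩)
      · refine (hs a).2 ?_
        rintro _ ⟨n, rfl⟩
        refine ((c n).L.2 (hd.image _) (directedOn_image
          (fun (x y : Thread K) (h : x ≤ y) => (show x.1 ≤ y.1 from h) n) hdir)
          (Thread.isLUB_apply hd hdir ha n)).2 ?_
        rintro _ ⟨_, ⟨x, hx, rfl⟩, rfl⟩
        exact ((hs x).1 ⟨n, rfl⟩).trans (hy ⟨x, hx, rfl⟩)⟩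
    ⟨fun y => ⟨fun n => (c n).R y, fun n m h => by rw [← hc n m h, EP.comp_R]⟩, by
      intro d hd hdir a ha
      refine ⟨?_, fun y hy n => ?_⟩
      · rintro _ ⟨x, hx, rfl⟩
        exact fun n => ScottHom.mono _ (ha.1 hx)
      · refine ((c n).R.2 hd hdir ha).2 ?_
        rintro _ ⟨x, hx, rfl⟩
        exact (show _ ≤ y.1 from hy ⟨x, hx, rfl⟩) n⟩
    (fun x => by
      refine Thread.ext fun n => ?_
      have hs := (exists_desc c hc x).choose_spec
      refine ((c n).R.2 (Set.range_nonempty _)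
        (directedOn_range.2 (desc_mono c hc x).directed_le) hs).unique ⟨?_, fun b hb => ?_⟩
      · rintro _ ⟨_, ⟨m, rfl⟩, rfl⟩
        refine (ScottHom.mono _ (desc_mono c hc x (le_max_right n m))).trans (le_of_eq ?_)
        change (c n).R ((c (max n m)).L (x.1 (max n m))) = x.1 n
        rw [← hc n _ (le_max_left n m), EP.comp_R, EP.RL, x.2]
      · have := hb ⟨_, ⟨n, rfl⟩, rfl⟩
        rwa [EP.RL] at this)
    (fun y => (exists_desc c hc _).choose_spec.2 (by
      rintro _ ⟨n, rfl⟩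
      exact EP.LR _ _))

end Lim

/-! ### Solutions of domain equations -/

section Fix

/-- The objects `G^n(1)`. -/
def chainObj (G : Cpo ⥤ Cpo) : ℕ → Cpo
  | 0 => Cpo.one
  | n + 1 => G.obj (chainObj G n)

noncomputable def chainMap (G : Cpo ⥤ Cpo) : ∀ n, chainObj G n ⟶ chainObj G (n + 1)
  | 0 => EP.init _
  | n + 1 => G.map (chainMap G n)

/-- The chain `1 ⟶ G(1) ⟶ G²(1) ⟶ ⋯`. -/
noncomputable def chain (G : Cpo ⥤ Cpo) : ℕ ⥤ Cpo := Functor.ofSequence (chainMap G)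

theorem chain_map_succ (G : Cpo ⥤ Cpo) (n : ℕ) :
    (chain G).map (homOfLE (Nat.le_add_right n 1)) = chainMap G n :=
  Functor.ofSequence_map_homOfLE_succ (chainMap G) n

def chainTransApp {G H : Cpo ⥤ Cpo} (α : G ⟶ H) : ∀ n, chainObj G n ⟶ chainObj H n
  | 0 => 𝟙 _
  | n + 1 => α.app _ ≫ H.map (chainTransApp α n)

theorem chainTransApp_w {G H : Cpo ⥤ Cpo} (α : G ⟶ H) : ∀ n,
    chainMap G n ≫ chainTransApp α (n + 1) = chainTransApp α n ≫ chainMap H n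
  | 0 => EP.hom_ext fun _ => rfl
  | n + 1 => by
    change G.map (chainMap G n) ≫ α.app _ ≫ H.map (chainTransApp α (n + 1)) =
      (α.app _ ≫ H.map (chainTransApp α n)) ≫ H.map (chainMap H n)
    rw [← Category.assoc, α.naturality, Category.assoc, Category.assoc, ← H.map_comp,
      chainTransApp_w α n, H.map_comp]

theorem chainTransApp_comp {G H J : Cpo ⥤ Cpo} (α : G ⟶ H) (β : H ⟶ J) (n : ℕ) :
    chainTransApp (α ≫ β) n = chainTransApp α n ≫ chainTransApp β n := by
  have key : ∀ {A B C : Cpo} (f : A ⟶ B) (g : B ⟶ C), (α ≫ β).app A ≫ J.map (f ≫ g) =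
      (α.app A ≫ H.map f) ≫ β.app B ≫ J.map g := by
    intro A B C f g
    simp
  induction n with
  | zero => rfl
  | succ n ih => exact (congrArg (fun e => (α ≫ β).app _ ≫ J.map e) ih).trans (key _ _)

noncomputable def chainTrans {G H : Cpo ⥤ Cpo} (α : G ⟶ H) : chain G ⟶ chain H :=
  NatTrans.ofSequence (F := chain G) (G := chain H) (chainTransApp α) (fun n =>
    ((congrArg (· ≫ chainTransApp α (n + 1)) (chain_map_succ G n)).trans
      (chainTransApp_w α n)).trans (congrArg (chainTransApp α n ≫ ·) (chain_map_succ H n).symm))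

variable {E : Type 1} [Category.{0} E]

/-- `Fix G` takes `B` to the colimit of the chain `1 ⟶ G_B(1) ⟶ G_B²(1) ⟶ ⋯`. -/
noncomputable def Fix (G : E ⥤ Cpo ⥤ Cpo) : E ⥤ Cpo where
  obj B := Lim (chain (G.obj B))
  map f := desc (fun n => (chainTrans (G.map f)).app n ≫ cocone _ n) (fun n m h => by
    rw [← Category.assoc, NatTrans.naturality, Category.assoc, cocone_w])
  map_id B := by
    have h : ∀ n, chainTransApp (𝟙 (G.obj B)) n = 𝟙 _ := by
      intro n
      induction n with
      | zero => rfl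
      | succ n ih => simp only [chainTransApp, ih]; simp; rfl
    refine EP.hom_ext fun y => Thread.ext fun n => ?_
    change (chainTransApp (G.map (𝟙 B)) n).R (y.1 n) = y.1 n
    rw [G.map_id, h]
    rfl
  map_comp {B B' B''} f g := by
    refine EP.hom_ext fun y => Thread.ext fun n => ?_
    change (chainTransApp (G.map (f ≫ g)) n).R (y.1 n) =
      (chainTransApp (G.map f) n).R ((chainTransApp (G.map g) n).R (y.1 n))
    rw [G.map_comp, chainTransApp_comp]
    rfl

/-- The cocone `1 ⟶ G(Fix G)`, `G(γ_n) : G^{n+1}(1) ⟶ G(Fix G)`. -/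
noncomputable def unfoldCocone (G : Cpo ⥤ Cpo) : ∀ n, (chain G).obj n ⟶ G.obj (Lim (chain G))
  | 0 => EP.init _
  | n + 1 => G.map (cocone (chain G) n)

theorem unfoldCocone_w (G : Cpo ⥤ Cpo) : ∀ n m (h : n ≤ m),
    (chain G).map (homOfLE h) ≫ unfoldCocone G m = unfoldCocone G n :=
  cocone_of_succ _ fun n => by
    refine (congrArg (· ≫ unfoldCocone G (n + 1)) (chain_map_succ G n)).trans ?_
    cases n with
    | zero => exact EP.hom_ext fun _ => rfl
    | succ n =>
      exact (G.map_comp (chainMap G n) (cocone (chain G) (n + 1))).symm.trans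
        (congrArg G.map ((congrArg (· ≫ cocone (chain G) (n + 1)) (chain_map_succ G n).symm).trans
          (cocone_w (chain G) (Nat.le_add_right n 1))))

/-- The canonical morphism `Fix G ⟶ G(Fix G)`, from the universal property of the colimit. -/
noncomputable def unfoldEP (G : Cpo ⥤ Cpo) : Lim (chain G) ⟶ G.obj (Lim (chain G)) :=
  desc (unfoldCocone G) (unfoldCocone_w G)

end Fix

/-! ### Pure types -/

/-- Type expressions with free type variables among `0, …, n - 1` (de Bruijn indices). -/
inductive Ty : ℕ → Type
  | var {n : ℕ} (i : Fin n) : Ty n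
  | unit {n : ℕ} : Ty n
  | prod {n : ℕ} (σ τ : Ty n) : Ty n
  | sum {n : ℕ} (σ τ : Ty n) : Ty n
  | arr {n : ℕ} (σ τ : Ty n) : Ty n
  | recT {n : ℕ} (τ : Ty (n + 1)) : Ty n

namespace Ty

def rename : {n m : ℕ} → (Fin n → Fin m) → Ty n → Ty m
  | _, _, r, var i => var (r i)
  | _, _, _, unit => unit
  | _, _, r, prod σ τ => prod (rename r σ) (rename r τ)
  | _, _, r, sum σ τ => sum (rename r σ) (rename r τ)
  | _, _, r, arr σ τ => arr (rename r σ) (rename r τ)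
  | _, _, r, recT τ => recT (rename (Fin.cons 0 fun i => (r i).succ) τ)

def subst : {n m : ℕ} → (Fin n → Ty m) → Ty n → Ty m
  | _, _, s, var i => s i
  | _, _, _, unit => unit
  | _, _, s, prod σ τ => prod (subst s σ) (subst s τ)
  | _, _, s, sum σ τ => sum (subst s σ) (subst s τ)
  | _, _, s, arr σ τ => arr (subst s σ) (subst s τ)
  | _, _, s, recT τ => recT (subst (Fin.cons (var 0) fun i => rename Fin.succ (s i)) τ)

/-- `τ[recT τ / 0]`. -/
def unroll {n : ℕ} (τ : Ty (n + 1)) : Ty n := subst (Fin.cons (recT τ) var) τ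

/-- The interpretation of a type expression as a functor, given functors for its free variables;
`recT` is interpreted by `Fix`. -/
noncomputable def interp : {n : ℕ} → Ty n → {E : Type 1} → [Category.{0} E] →
    (Fin n → (E ⥤ Cpo)) → (E ⥤ Cpo)
  | _, var i, _, _, ρ => ρ i
  | _, unit, E, _, _ => (Functor.const E).obj Cpo.two
  | _, prod σ τ, _, _, ρ => prodF (interp σ ρ) (interp τ ρ)
  | _, sum σ τ, _, _, ρ => sumF (interp σ ρ) (interp τ ρ)
  | _, arr σ τ, _, _, ρ => fnF (interp σ ρ) (interp τ ρ)
  | _, recT τ, E, _, ρ => Fix (Functor.curry.obj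
      (interp τ (E := E × Cpo) (Fin.cons (CategoryTheory.Prod.snd E Cpo) fun i => CategoryTheory.Prod.fst E Cpo ⋙ ρ i)))

theorem curry_prod {E E' : Type 1} [Category.{0} E] [Category.{0} E'] (H : E ⥤ E')
    (F : E' × Cpo ⥤ Cpo) :
    Functor.curry.obj (H.prod (𝟭 Cpo) ⋙ F) = H ⋙ Functor.curry.obj F := by
  refine CategoryTheory.Functor.ext (fun B => ?_) (fun B B' f => ?_)
  · refine CategoryTheory.Functor.ext (fun X => rfl) (fun X Y g => ?_)
    simp
  · ext X : 2
    simp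

theorem interp_comp : ∀ {n : ℕ} (τ : Ty n) {E E' : Type 1} [Category.{0} E] [Category.{0} E']
    (H : E ⥤ E') (ρ : Fin n → (E' ⥤ Cpo)), interp τ (fun i => H ⋙ ρ i) = H ⋙ interp τ ρ
  | _, var _, _, _, _, _, _, _ => rfl
  | _, unit, _, _, _, _, _, _ => rfl
  | _, prod σ τ, _, _, _, _, H, ρ => by
    simp only [interp, interp_comp σ H ρ, interp_comp τ H ρ]; rfl
  | _, sum σ τ, _, _, _, _, H, ρ => by
    simp only [interp, interp_comp σ H ρ, interp_comp τ H ρ]; rfl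
  | _, arr σ τ, _, _, _, _, H, ρ => by
    simp only [interp, interp_comp σ H ρ, interp_comp τ H ρ]; rfl
  | n, recT τ, E, E', _, _, H, ρ => by
    have h := interp_comp τ (H.prod (𝟭 Cpo))
      (Fin.cons (CategoryTheory.Prod.snd E' Cpo) fun i => CategoryTheory.Prod.fst E' Cpo ⋙ ρ i)
    have h' : (Fin.cons (CategoryTheory.Prod.snd E Cpo) fun i => CategoryTheory.Prod.fst E Cpo ⋙ H ⋙ ρ i :
        Fin (n + 1) → (E × Cpo ⥤ Cpo)) = fun i => H.prod (𝟭 Cpo) ⋙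
          (Fin.cons (CategoryTheory.Prod.snd E' Cpo) fun i => CategoryTheory.Prod.fst E' Cpo ⋙ ρ i :
            Fin (n + 1) → (E' × Cpo ⥤ Cpo)) i := by
      funext i
      refine Fin.cases ?_ (fun j => ?_) i <;> rfl
    simp only [interp]
    rw [h', h, curry_prod]
    rfl

theorem interp_rename : ∀ {n m : ℕ} (τ : Ty n) (r : Fin n → Fin m) {E : Type 1} [Category.{0} E]
    (ρ : Fin m → (E ⥤ Cpo)), interp (rename r τ) ρ = interp τ (fun i => ρ (r i))
  | _, _, var _, _, _, _, _ => rfl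
  | _, _, unit, _, _, _, _ => rfl
  | _, _, prod σ τ, r, _, _, ρ => by
    simp only [interp, rename, interp_rename σ r ρ, interp_rename τ r ρ]
  | _, _, sum σ τ, r, _, _, ρ => by
    simp only [interp, rename, interp_rename σ r ρ, interp_rename τ r ρ]
  | _, _, arr σ τ, r, _, _, ρ => by
    simp only [interp, rename, interp_rename σ r ρ, interp_rename τ r ρ]
  | n, _, recT τ, r, E, _, ρ => by
    simp only [interp, rename]
    rw [interp_rename τ]
    congr 3
    funext i
    refine Fin.cases ?_ (fun j => ?_) i <;> rfl

theorem interp_subst : ∀ {n m : ℕ} (τ : Ty n) (s : Fin n → Ty m) {E : Type 1} [Category.{0} E]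
    (ρ : Fin m → (E ⥤ Cpo)), interp (subst s τ) ρ = interp τ (fun i => interp (s i) ρ)
  | _, _, var _, _, _, _, _ => rfl
  | _, _, unit, _, _, _, _ => rfl
  | _, _, prod σ τ, s, _, _, ρ => by
    simp only [interp, subst, interp_subst σ s ρ, interp_subst τ s ρ]
  | _, _, sum σ τ, s, _, _, ρ => by
    simp only [interp, subst, interp_subst σ s ρ, interp_subst τ s ρ]
  | _, _, arr σ τ, s, _, _, ρ => by
    simp only [interp, subst, interp_subst σ s ρ, interp_subst τ s ρ]
  | n, _, recT τ, s, E, _, ρ => by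
    simp only [interp, subst]
    rw [interp_subst τ]
    congr 3
    funext i
    refine Fin.cases rfl (fun j => ?_) i
    exact (interp_rename (s j) Fin.succ _).trans (interp_comp (s j) (CategoryTheory.Prod.fst E Cpo) ρ)

/-- The category `(Cpo^ep)^0` of parameters of closed types. -/
abbrev NoParams : Type 1 := Fin 0 → Cpo

/-- The functor `X ↦ ⟦τ⟧(X)` of a type expression with one free variable. -/
noncomputable def bodyFunctor (τ : Ty 1) : Cpo ⥤ Cpo :=
  (Functor.curry.obj (interp τ (E := NoParams × Cpo)
    (Fin.cons (CategoryTheory.Prod.snd _ Cpo) fun i => CategoryTheory.Prod.fst _ Cpo ⋙ Fin.elim0 i))).obj (Fin.elim0 : NoParams)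

/-- The interpretation `⟦τ⟧` of a closed type. -/
noncomputable def dom (τ : Ty 0) : Cpo :=
  (interp τ (E := NoParams) Fin.elim0).obj (Fin.elim0 : NoParams)

theorem bodyFunctor_rec (τ : Ty 1) : (bodyFunctor τ).obj (dom (recT τ)) = dom (unroll τ) := by
  have h := interp_comp τ (E := NoParams)
    (Functor.prod' (𝟭 _) (interp (recT τ) (E := NoParams) Fin.elim0))
    (Fin.cons (CategoryTheory.Prod.snd _ Cpo) fun i => CategoryTheory.Prod.fst _ Cpo ⋙ Fin.elim0 i)
  have h2 := interp_subst τ (Fin.cons (recT τ) var) (E := NoParams) Fin.elim0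
  have h3 : (fun i => interp ((Fin.cons (recT τ) var : Fin 1 → Ty 0) i) (E := NoParams)
      Fin.elim0) = fun i => (Functor.prod' (𝟭 _)
        (interp (recT τ) (E := NoParams) Fin.elim0)) ⋙
        (Fin.cons (CategoryTheory.Prod.snd (NoParams) Cpo) fun i => CategoryTheory.Prod.fst _ Cpo ⋙ Fin.elim0 i :
          Fin 1 → (NoParams × Cpo ⥤ Cpo)) i := by
    funext i
    refine Fin.cases rfl (fun j => j.elim0) i
  rw [h3, h] at h2
  exact (congrArg (fun F => F.obj (Fin.elim0 : NoParams)) h2).symm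

/-- The canonical isomorphism `⟦unfold⟧ : ⟦recT τ⟧ → ⟦τ[recT τ]⟧`. -/
noncomputable def unfold (τ : Ty 1) : ScottHom (dom (recT τ)) (dom (unroll τ)) :=
  EP.L (X := dom (recT τ)) (unfoldEP (bodyFunctor τ) ≫ eqToHom (bodyFunctor_rec τ))

end Ty

/-! ### Formulae -/

/-- Iteration terms, with iteration variables as de Bruijn indices. -/
inductive ITerm : Type
  | var (k : ℕ) : ITerm
  | zero : ITerm
  | succ (t : ITerm) : ITerm

namespace ITerm

def subst (s : ℕ → ITerm) : ITerm → ITerm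
  | var k => s k
  | zero => zero
  | succ t => succ (subst s t)

def shift (t : ITerm) : ITerm := t.subst fun k => var (k + 1)

/-- `k` occurs in the term. -/
def Free (k : ℕ) : ITerm → Prop
  | var l => k = l
  | zero => False
  | succ t => t.Free k

def eval (ν : ℕ → ℕ) : ITerm → ℕ
  | var k => ν k
  | zero => 0
  | succ t => t.eval ν + 1

/-- The substitution replacing the variable `0` by `t` and lowering the other variables. -/
def inst (t : ITerm) : ℕ → ITerm
  | 0 => t
  | k + 1 => var k

/-- A substitution carried under a binder. -/
def lift (s : ℕ → ITerm) : ℕ → ITerm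
  | 0 => var 0
  | k + 1 => (s k).shift

end ITerm

/-- Fixpoint contexts: the list of the types of the fixpoint variables. -/
abbrev Ctx : Type := List (Ty 0)

/-- `Var Γ τ` is the type of fixpoint variables of type `τ` in `Γ`. -/
inductive Var : Ctx → Ty 0 → Type
  | here {Γ : Ctx} {τ : Ty 0} : Var (τ :: Γ) τ
  | there {Γ : Ctx} {σ τ : Ty 0} (x : Var Γ τ) : Var (σ :: Γ) τ

/-- The modalities; a `Modality σ τ` takes formulae of type `σ` to formulae of type `τ`. -/
inductive Modality : Ty 0 → Ty 0 → Type
  | pi1 {σ τ : Ty 0} : Modality σ (σ.prod τ)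
  | pi2 {σ τ : Ty 0} : Modality τ (σ.prod τ)
  | inj1 {σ τ : Ty 0} : Modality σ (σ.sum τ)
  | inj2 {σ τ : Ty 0} : Modality τ (σ.sum τ)
  | fold {τ : Ty 1} : Modality τ.unroll τ.recT

/-- The modality is neither `inj1` nor `inj2`. -/
def Modality.NotInj : {σ τ : Ty 0} → Modality σ τ → Prop
  | _, _, pi1 => True
  | _, _, pi2 => True
  | _, _, inj1 => False
  | _, _, inj2 => False
  | _, _, fold => True

/-- Formulae of a given type in a fixpoint context, before polarities are taken into account.
`mu t φ` and `nu t φ` bind a fixpoint variable (the head of the context), `ex φ` and `all φ` bind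
the iteration variable `0`. Realizability implications have no free fixpoint variables. -/
inductive Form : Ctx → Ty 0 → Type
  | tru {Γ : Ctx} {τ : Ty 0} : Form Γ τ
  | fls {Γ : Ctx} {τ : Ty 0} : Form Γ τ
  | and {Γ : Ctx} {τ : Ty 0} (φ ψ : Form Γ τ) : Form Γ τ
  | or {Γ : Ctx} {τ : Ty 0} (φ ψ : Form Γ τ) : Form Γ τ
  | unit {Γ : Ctx} : Form Γ Ty.unit
  | mod {Γ : Ctx} {σ τ : Ty 0} (m : Modality σ τ) (φ : Form Γ σ) : Form Γ τ
  | var {Γ : Ctx} {τ : Ty 0} (x : Var Γ τ) : Form Γ τ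
  | mu {Γ : Ctx} {τ : Ty 0} (t : ITerm) (φ : Form (τ :: Γ) τ) : Form Γ τ
  | nu {Γ : Ctx} {τ : Ty 0} (t : ITerm) (φ : Form (τ :: Γ) τ) : Form Γ τ
  | ex {Γ : Ctx} {τ : Ty 0} (φ : Form Γ τ) : Form Γ τ
  | all {Γ : Ctx} {τ : Ty 0} (φ : Form Γ τ) : Form Γ τ
  | imp {Γ : Ctx} {σ τ : Ty 0} (ψ : Form [] σ) (φ : Form [] τ) : Form Γ (σ.arr τ)

namespace Form

/-- The iteration variable `k` is free in the formula. -/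
def Free : {Γ : Ctx} → {τ : Ty 0} → ℕ → Form Γ τ → Prop
  | _, _, _, tru => False
  | _, _, _, fls => False
  | _, _, k, and φ ψ => Free k φ ∨ Free k ψ
  | _, _, k, or φ ψ => Free k φ ∨ Free k ψ
  | _, _, _, unit => False
  | _, _, k, mod _ φ => Free k φ
  | _, _, _, var _ => False
  | _, _, k, mu t φ => t.Free k ∨ Free k φ
  | _, _, k, nu t φ => t.Free k ∨ Free k φ
  | _, _, k, ex φ => Free (k + 1) φ
  | _, _, k, all φ => Free (k + 1) φ
  | _, _, k, imp ψ φ => Free k ψ ∨ Free k φ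

/-- Substitution of iteration terms for iteration variables. -/
def isubst : {Γ : Ctx} → {τ : Ty 0} → (ℕ → ITerm) → Form Γ τ → Form Γ τ
  | _, _, _, tru => tru
  | _, _, _, fls => fls
  | _, _, s, and φ ψ => and (isubst s φ) (isubst s ψ)
  | _, _, s, or φ ψ => or (isubst s φ) (isubst s ψ)
  | _, _, _, unit => unit
  | _, _, s, mod m φ => mod m (isubst s φ)
  | _, _, _, var x => var x
  | _, _, s, mu t φ => mu (t.subst s) (isubst s φ)
  | _, _, s, nu t φ => nu (t.subst s) (isubst s φ)
  | _, _, s, ex φ => ex (isubst (ITerm.lift s) φ)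
  | _, _, s, all φ => all (isubst (ITerm.lift s) φ)
  | _, _, s, imp ψ φ => imp (isubst s ψ) (isubst s φ)

/-- Weakening by a new iteration variable `0`; a formula in which a bound iteration variable does
not occur is one of the form `φ.shift`. -/
def shift {Γ : Ctx} {τ : Ty 0} (φ : Form Γ τ) : Form Γ τ := φ.isubst fun k => ITerm.var (k + 1)

/-- `φ[t / k]`, for `k` the iteration variable `0` bound by a quantifier on `φ`. -/
def inst {Γ : Ctx} {τ : Ty 0} (φ : Form Γ τ) (t : ITerm) : Form Γ τ := φ.isubst t.inst

/-- A renaming of fixpoint variables carried under a binder. -/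
def liftRen {Γ Δ : Ctx} (r : ∀ τ, Var Γ τ → Var Δ τ) (σ : Ty 0) :
    ∀ τ, Var (σ :: Γ) τ → Var (σ :: Δ) τ
  | _, Var.here => Var.here
  | _, Var.there x => Var.there (r _ x)

/-- Renaming of fixpoint variables. -/
def frename : {Γ Δ : Ctx} → {τ : Ty 0} → (∀ σ, Var Γ σ → Var Δ σ) → Form Γ τ → Form Δ τ
  | _, _, _, _, tru => tru
  | _, _, _, _, fls => fls
  | _, _, _, r, and φ ψ => and (frename r φ) (frename r ψ)
  | _, _, _, r, or φ ψ => or (frename r φ) (frename r ψ)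
  | _, _, _, _, unit => unit
  | _, _, _, r, mod m φ => mod m (frename r φ)
  | _, _, _, r, var x => var (r _ x)
  | _, _, _, r, mu t φ => mu t (frename (liftRen r _) φ)
  | _, _, _, r, nu t φ => nu t (frename (liftRen r _) φ)
  | _, _, _, r, ex φ => ex (frename r φ)
  | _, _, _, r, all φ => all (frename r φ)
  | _, _, _, _, imp ψ φ => imp ψ φ

/-- A substitution for fixpoint variables carried under a fixpoint binder. -/
def liftSub {Γ Δ : Ctx} (s : ∀ τ, Var Γ τ → Form Δ τ) (σ : Ty 0) :
    ∀ τ, Var (σ :: Γ) τ → Form (σ :: Δ) τ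
  | _, Var.here => var Var.here
  | _, Var.there x => (s _ x).frename fun _ => Var.there

/-- (Capture-avoiding) substitution of formulae for fixpoint variables. -/
def fsubst : {Γ Δ : Ctx} → {τ : Ty 0} → (∀ σ, Var Γ σ → Form Δ σ) → Form Γ τ → Form Δ τ
  | _, _, _, _, tru => tru
  | _, _, _, _, fls => fls
  | _, _, _, s, and φ ψ => and (fsubst s φ) (fsubst s ψ)
  | _, _, _, s, or φ ψ => or (fsubst s φ) (fsubst s ψ)
  | _, _, _, _, unit => unit
  | _, _, _, s, mod m φ => mod m (fsubst s φ)
  | _, _, _, s, var x => s _ x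
  | _, _, _, s, mu t φ => mu t (fsubst (liftSub s _) φ)
  | _, _, _, s, nu t φ => nu t (fsubst (liftSub s _) φ)
  | _, _, _, s, ex φ => ex (fsubst (fun σ x => (s σ x).shift) φ)
  | _, _, _, s, all φ => all (fsubst (fun σ x => (s σ x).shift) φ)
  | _, _, _, _, imp ψ φ => imp ψ φ

/-- The substitution replacing the head fixpoint variable by `ψ`. -/
def instSub {Γ : Ctx} {σ : Ty 0} (ψ : Form Γ σ) : ∀ τ, Var (σ :: Γ) τ → Form Γ τ
  | _, Var.here => ψ
  | _, Var.there x => var x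

/-- `φ[ψ / X]`, for `X` the head fixpoint variable of the context of `φ`. -/
def finst {Γ : Ctx} {σ τ : Ty 0} (φ : Form (σ :: Γ) τ) (ψ : Form Γ σ) : Form Γ τ :=
  φ.fsubst (instSub ψ)

/-- Finite conjunctions. -/
def bigAnd {Γ : Ctx} {τ : Ty 0} : List (Form Γ τ) → Form Γ τ
  | [] => tru
  | φ :: l => and φ (bigAnd l)

end Form

mutual

/-- `Pos k φ`: the iteration variable `k` occurs only positively in `φ`. -/
inductive Pos : {Γ : Ctx} → {τ : Ty 0} → ℕ → Form Γ τ → Prop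
  | notFree {Γ : Ctx} {τ : Ty 0} {k : ℕ} {φ : Form Γ τ} : ¬ φ.Free k → Pos k φ
  | and {Γ : Ctx} {τ : Ty 0} {k : ℕ} {φ ψ : Form Γ τ} : Pos k φ → Pos k ψ → Pos k (φ.and ψ)
  | or {Γ : Ctx} {τ : Ty 0} {k : ℕ} {φ ψ : Form Γ τ} : Pos k φ → Pos k ψ → Pos k (φ.or ψ)
  | mod {Γ : Ctx} {σ τ : Ty 0} {k : ℕ} {m : Modality σ τ} {φ : Form Γ σ} :
      Pos k φ → Pos k (φ.mod m)
  | imp {Γ : Ctx} {σ τ : Ty 0} {k : ℕ} {ψ : Form [] σ} {φ : Form [] τ} :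
      Neg k ψ → Pos k φ → Pos k (Form.imp (Γ := Γ) ψ φ)
  | ex {Γ : Ctx} {τ : Ty 0} {k : ℕ} {φ : Form Γ τ} : Pos (k + 1) φ → Pos k φ.ex
  | mu {Γ : Ctx} {τ : Ty 0} {k : ℕ} {t : ITerm} {φ : Form (τ :: Γ) τ} :
      Pos k φ → Pos k (Form.mu t φ)
  | nu {Γ : Ctx} {τ : Ty 0} {k : ℕ} {t : ITerm} {φ : Form (τ :: Γ) τ} :
      Pos k φ → ¬ t.Free k → Pos k (Form.nu t φ)

/-- `Neg k φ`: the iteration variable `k` occurs only negatively in `φ`. -/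
inductive Neg : {Γ : Ctx} → {τ : Ty 0} → ℕ → Form Γ τ → Prop
  | notFree {Γ : Ctx} {τ : Ty 0} {k : ℕ} {φ : Form Γ τ} : ¬ φ.Free k → Neg k φ
  | and {Γ : Ctx} {τ : Ty 0} {k : ℕ} {φ ψ : Form Γ τ} : Neg k φ → Neg k ψ → Neg k (φ.and ψ)
  | or {Γ : Ctx} {τ : Ty 0} {k : ℕ} {φ ψ : Form Γ τ} : Neg k φ → Neg k ψ → Neg k (φ.or ψ)
  | mod {Γ : Ctx} {σ τ : Ty 0} {k : ℕ} {m : Modality σ τ} {φ : Form Γ σ} :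
      Neg k φ → Neg k (φ.mod m)
  | imp {Γ : Ctx} {σ τ : Ty 0} {k : ℕ} {ψ : Form [] σ} {φ : Form [] τ} :
      Pos k ψ → Neg k φ → Neg k (Form.imp (Γ := Γ) ψ φ)
  | all {Γ : Ctx} {τ : Ty 0} {k : ℕ} {φ : Form Γ τ} : Neg (k + 1) φ → Neg k φ.all
  | nu {Γ : Ctx} {τ : Ty 0} {k : ℕ} {t : ITerm} {φ : Form (τ :: Γ) τ} :
      Neg k φ → Neg k (Form.nu t φ)
  | mu {Γ : Ctx} {τ : Ty 0} {k : ℕ} {t : ITerm} {φ : Form (τ :: Γ) τ} :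
      Neg k φ → ¬ t.Free k → Neg k (Form.mu t φ)

end

/-- Polarities: neutral, positive, negative. -/
inductive Sign : Type
  | neutral
  | pos
  | neg

def Sign.opp : Sign → Sign
  | neutral => neutral
  | pos => neg
  | neg => pos

/-- `Lang s φ`: the formula `φ` belongs to the language `L^s`. -/
inductive Lang : {Γ : Ctx} → {τ : Ty 0} → Sign → Form Γ τ → Prop
  | tru {Γ : Ctx} {τ : Ty 0} {s : Sign} : Lang s (Form.tru (Γ := Γ) (τ := τ))
  | fls {Γ : Ctx} {τ : Ty 0} {s : Sign} : Lang s (Form.fls (Γ := Γ) (τ := τ))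
  | and {Γ : Ctx} {τ : Ty 0} {s : Sign} {φ ψ : Form Γ τ} :
      Lang s φ → Lang s ψ → Lang s (φ.and ψ)
  | or {Γ : Ctx} {τ : Ty 0} {s : Sign} {φ ψ : Form Γ τ} :
      Lang s φ → Lang s ψ → Lang s (φ.or ψ)
  | unit {Γ : Ctx} {s : Sign} : Lang s (Form.unit (Γ := Γ))
  | mod {Γ : Ctx} {σ τ : Ty 0} {s : Sign} {m : Modality σ τ} {φ : Form Γ σ} :
      Lang s φ → Lang s (φ.mod m)
  | var {Γ : Ctx} {τ : Ty 0} {s : Sign} {x : Var Γ τ} : Lang s (Form.var x)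
  | mu {Γ : Ctx} {τ : Ty 0} {s : Sign} {t : ITerm} {φ : Form (τ :: Γ) τ} :
      Lang s φ → Lang s (Form.mu t φ)
  | nu {Γ : Ctx} {τ : Ty 0} {s : Sign} {t : ITerm} {φ : Form (τ :: Γ) τ} :
      Lang s φ → Lang s (Form.nu t φ)
  | ex {Γ : Ctx} {τ : Ty 0} {φ : Form Γ τ} : Lang Sign.pos φ → Pos 0 φ → Lang Sign.pos φ.ex
  | all {Γ : Ctx} {τ : Ty 0} {φ : Form Γ τ} : Lang Sign.neg φ → Neg 0 φ → Lang Sign.neg φ.all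
  | imp {Γ : Ctx} {σ τ : Ty 0} {s : Sign} {ψ : Form [] σ} {φ : Form [] τ} :
      Lang s.opp ψ → Lang s φ → Lang s (Form.imp (Γ := Γ) ψ φ)

/-- `LangAnd φ`: the formula `φ` belongs to the language `L^∧` (no disjunctions, fixpoint
variables, bounded iterations or quantifiers). -/
inductive LangAnd : {τ : Ty 0} → Form [] τ → Prop
  | tru {τ : Ty 0} : LangAnd (Form.tru (τ := τ))
  | fls {τ : Ty 0} : LangAnd (Form.fls (τ := τ))
  | and {τ : Ty 0} {φ ψ : Form [] τ} : LangAnd φ → LangAnd ψ → LangAnd (φ.and ψ)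
  | unit : LangAnd Form.unit
  | mod {σ τ : Ty 0} {m : Modality σ τ} {φ : Form [] σ} : LangAnd φ → LangAnd (φ.mod m)
  | imp {σ τ : Ty 0} {ψ : Form [] σ} {φ : Form [] τ} :
      LangAnd ψ → LangAnd φ → LangAnd (Form.imp ψ φ)

/-! ### Semantics of formulae -/

/-- Semantic modalities. -/
def Modality.sem : {σ τ : Ty 0} → Modality σ τ → Set σ.dom → Set τ.dom
  | _, _, pi1 (σ := σ) (τ := τ), S => {x : σ.dom × τ.dom | x.1 ∈ S}
  | _, _, pi2 (σ := σ) (τ := τ), S => {x : σ.dom × τ.dom | x.2 ∈ S}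
  | _, _, inj1 (σ := σ) (τ := τ), S => (inl : σ.dom → WithBot (σ.dom ⊕ τ.dom)) '' S
  | _, _, inj2 (σ := σ) (τ := τ), S => (inr : τ.dom → WithBot (σ.dom ⊕ τ.dom)) '' S
  | _, _, fold (τ := τ), S => {x | Ty.unfold τ x ∈ S}

/-- Valuations of the fixpoint variables of a context. -/
abbrev FVal (Γ : Ctx) : Type := ∀ τ : Ty 0, Var Γ τ → Set τ.dom

/-- `ρ[S / X]`, for a new head variable `X`. -/
def FVal.cons {Γ : Ctx} {σ : Ty 0} (S : Set σ.dom) (ρ : FVal Γ) : FVal (σ :: Γ)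
  | _, Var.here => S
  | _, Var.there x => ρ _ x

def FVal.nil : FVal [] := fun _ x => nomatch x

/-- `ν[n / k]`, for a new iteration variable `k = 0`. -/
def iCons (n : ℕ) (ν : ℕ → ℕ) : ℕ → ℕ
  | 0 => n
  | k + 1 => ν k

/-- The interpretation of formulae, under a valuation `ρ` of fixpoint variables and a valuation `ν`
of iteration variables. The bounded iterations `mu t φ` and `nu t φ` are the iterates, `⟦t⟧` times,
of `S ↦ ⟦φ⟧[S / X]`, from the empty set and the whole space respectively. -/
def Form.sem : {Γ : Ctx} → {τ : Ty 0} → Form Γ τ → FVal Γ → (ℕ → ℕ) → Set τ.dom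
  | _, _, tru, _, _ => Set.univ
  | _, _, fls, _, _ => ∅
  | _, _, and φ ψ, ρ, ν => φ.sem ρ ν ∩ ψ.sem ρ ν
  | _, _, or φ ψ, ρ, ν => φ.sem ρ ν ∪ ψ.sem ρ ν
  | _, _, unit, _, _ => ({true} : Set Bool)
  | _, _, mod m φ, ρ, ν => m.sem (φ.sem ρ ν)
  | _, _, var x, ρ, _ => ρ _ x
  | _, _, mu t φ, ρ, ν => (fun S => φ.sem (FVal.cons S ρ) ν)^[t.eval ν] ∅
  | _, _, nu t φ, ρ, ν => (fun S => φ.sem (FVal.cons S ρ) ν)^[t.eval ν] Set.univ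
  | _, _, ex φ, ρ, ν => ⋃ n : ℕ, φ.sem ρ (iCons n ν)
  | _, _, all φ, ρ, ν => ⋂ n : ℕ, φ.sem ρ (iCons n ν)
  | _, _, imp (σ := σ) (τ := τ) ψ φ, _, ν =>
    {f : ScottHom σ.dom τ.dom | ∀ x ∈ ψ.sem FVal.nil ν, f x ∈ φ.sem FVal.nil ν}

/-! ### Deduction -/

/-- `ψ ⊢ φ` is a sequent: both formulae belong to `L^s` for some polarity `s`. -/
def IsSequent {Γ : Ctx} {τ : Ty 0} (ψ φ : Form Γ τ) : Prop := ∃ s, Lang s ψ ∧ Lang s φ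

mutual

/-- `Ded ψ φ`: the sequent `ψ ⊢ φ` is derivable. All formulae are in the same fixpoint context and
of the same type, and the conclusion of each rule is required to be a sequent. -/
inductive Ded : {Γ : Ctx} → {τ : Ty 0} → Form Γ τ → Form Γ τ → Prop
  -- propositional rules
  | refl {Γ : Ctx} {τ : Ty 0} {φ : Form Γ τ} : IsSequent φ φ → Ded φ φ
  | cut {Γ : Ctx} {τ : Ty 0} {ψ θ φ : Form Γ τ} : IsSequent ψ φ → Ded ψ θ → Ded θ φ → Ded ψ φ
  | distr {Γ : Ctx} {τ : Ty 0} {ψ φ θ : Form Γ τ} :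
      IsSequent (ψ.and (φ.or θ)) ((ψ.and φ).or (ψ.and θ)) →
      Ded (ψ.and (φ.or θ)) ((ψ.and φ).or (ψ.and θ))
  | andR {Γ : Ctx} {τ : Ty 0} {ψ φ₁ φ₂ : Form Γ τ} : IsSequent ψ (φ₁.and φ₂) →
      Ded ψ φ₁ → Ded ψ φ₂ → Ded ψ (φ₁.and φ₂)
  | andL₁ {Γ : Ctx} {τ : Ty 0} {ψ₁ ψ₂ φ : Form Γ τ} : IsSequent (ψ₁.and ψ₂) φ →
      Ded ψ₁ φ → Ded (ψ₁.and ψ₂) φ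
  | andL₂ {Γ : Ctx} {τ : Ty 0} {ψ₁ ψ₂ φ : Form Γ τ} : IsSequent (ψ₁.and ψ₂) φ →
      Ded ψ₂ φ → Ded (ψ₁.and ψ₂) φ
  | truR {Γ : Ctx} {τ : Ty 0} {ψ : Form Γ τ} : IsSequent ψ .tru → Ded ψ .tru
  | orR₁ {Γ : Ctx} {τ : Ty 0} {ψ φ₁ φ₂ : Form Γ τ} : IsSequent ψ (φ₁.or φ₂) →
      Ded ψ φ₁ → Ded ψ (φ₁.or φ₂)
  | orR₂ {Γ : Ctx} {τ : Ty 0} {ψ φ₁ φ₂ : Form Γ τ} : IsSequent ψ (φ₁.or φ₂) →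
      Ded ψ φ₂ → Ded ψ (φ₁.or φ₂)
  | orL {Γ : Ctx} {τ : Ty 0} {ψ₁ ψ₂ φ : Form Γ τ} : IsSequent (ψ₁.or ψ₂) φ →
      Ded ψ₁ φ → Ded ψ₂ φ → Ded (ψ₁.or ψ₂) φ
  | flsL {Γ : Ctx} {τ : Ty 0} {φ : Form Γ τ} : IsSequent .fls φ → Ded .fls φ
  -- modal rules
  | injDisj {Γ : Ctx} {σ τ : Ty 0} {φ : Form Γ σ} {ψ : Form Γ τ} :
      IsSequent ((φ.mod (.inj1 (σ := σ) (τ := τ))).and (ψ.mod .inj2)) .fls →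
      Ded ((φ.mod (.inj1 (σ := σ) (τ := τ))).and (ψ.mod .inj2)) .fls
  | modMono {Γ : Ctx} {σ τ : Ty 0} {m : Modality σ τ} {ψ φ : Form Γ σ} :
      IsSequent (ψ.mod m) (φ.mod m) → Ded ψ φ → Ded (ψ.mod m) (φ.mod m)
  | impMono {Γ : Ctx} {σ τ : Ty 0} {ψ ψ' : Form [] σ} {φ φ' : Form [] τ} :
      IsSequent (Form.imp (Γ := Γ) ψ φ) (Form.imp ψ' φ') → Ded ψ' ψ → Ded φ φ' →
      Ded (Form.imp (Γ := Γ) ψ φ) (Form.imp ψ' φ')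
  | modAnd {Γ : Ctx} {σ τ : Ty 0} {m : Modality σ τ} {φ₁ φ₂ : Form Γ σ} :
      IsSequent ((φ₁.mod m).and (φ₂.mod m)) ((φ₁.and φ₂).mod m) →
      Ded ((φ₁.mod m).and (φ₂.mod m)) ((φ₁.and φ₂).mod m)
  | modTru {Γ : Ctx} {σ τ : Ty 0} {m : Modality σ τ} : m.NotInj →
      IsSequent (Γ := Γ) .tru (Form.tru.mod m) → Ded (Γ := Γ) .tru (Form.tru.mod m)
  | modAll {Γ : Ctx} {σ τ : Ty 0} {m : Modality σ τ} {φ : Form Γ σ} :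
      IsSequent (φ.mod m).all (φ.all.mod m) → Ded (φ.mod m).all (φ.all.mod m)
  | modOr {Γ : Ctx} {σ τ : Ty 0} {m : Modality σ τ} {φ₁ φ₂ : Form Γ σ} :
      IsSequent ((φ₁.or φ₂).mod m) ((φ₁.mod m).or (φ₂.mod m)) →
      Ded ((φ₁.or φ₂).mod m) ((φ₁.mod m).or (φ₂.mod m))
  | modFls {Γ : Ctx} {σ τ : Ty 0} {m : Modality σ τ} :
      IsSequent (Γ := Γ) (Form.fls.mod m) .fls → Ded (Γ := Γ) (Form.fls.mod m) .fls
  | modEx {Γ : Ctx} {σ τ : Ty 0} {m : Modality σ τ} {φ : Form Γ σ} :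
      IsSequent (φ.ex.mod m) (φ.mod m).ex → Ded (φ.ex.mod m) (φ.mod m).ex
  -- quantifier rules
  | exR {Γ : Ctx} {τ : Ty 0} {ψ φ : Form Γ τ} {t : ITerm} : IsSequent ψ φ.ex →
      Ded ψ (φ.inst t) → Ded ψ φ.ex
  | exL {Γ : Ctx} {τ : Ty 0} {θ φ ψ : Form Γ τ} : IsSequent (θ.and φ.ex) ψ →
      Ded (θ.shift.and φ) ψ.shift → Ded (θ.and φ.ex) ψ
  | exM {Γ : Ctx} {τ : Ty 0} {φ : Form Γ τ} :
      IsSequent φ.ex.ex (φ.inst (.var 0)).ex → Ded φ.ex.ex (φ.inst (.var 0)).ex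
  | allL {Γ : Ctx} {τ : Ty 0} {φ ψ : Form Γ τ} {t : ITerm} : IsSequent φ.all ψ →
      Ded (φ.inst t) ψ → Ded φ.all ψ
  | allR {Γ : Ctx} {τ : Ty 0} {ψ φ θ : Form Γ τ} : IsSequent ψ (φ.all.or θ) →
      Ded ψ.shift (φ.or θ.shift) → Ded ψ (φ.all.or θ)
  | allM {Γ : Ctx} {τ : Ty 0} {φ : Form Γ τ} :
      IsSequent (φ.inst (.var 0)).all φ.all.all → Ded (φ.inst (.var 0)).all φ.all.all
  | muEx {Γ : Ctx} {τ : Ty 0} {t : ITerm} {φ : Form (τ :: Γ) τ} :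
      IsSequent (Form.mu t φ.ex) (Form.mu t.shift φ).ex →
      Ded (Form.mu t φ.ex) (Form.mu t.shift φ).ex
  | nuEx {Γ : Ctx} {τ : Ty 0} {t : ITerm} {φ : Form (τ :: Γ) τ} :
      IsSequent (Form.nu t φ.ex) (Form.nu t.shift φ).ex →
      Ded (Form.nu t φ.ex) (Form.nu t.shift φ).ex
  | allMu {Γ : Ctx} {τ : Ty 0} {t : ITerm} {φ : Form (τ :: Γ) τ} :
      IsSequent (Form.mu t.shift φ).all (Form.mu t φ.all) →
      Ded (Form.mu t.shift φ).all (Form.mu t φ.all)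
  | allNu {Γ : Ctx} {τ : Ty 0} {t : ITerm} {φ : Form (τ :: Γ) τ} :
      IsSequent (Form.nu t.shift φ).all (Form.nu t φ.all) →
      Ded (Form.nu t.shift φ).all (Form.nu t φ.all)
  -- bounded iteration
  | muZero {Γ : Ctx} {τ : Ty 0} {φ : Form (τ :: Γ) τ} :
      IsSequent (Form.mu .zero φ) .fls → Ded (Form.mu .zero φ) .fls
  | muSuccL {Γ : Ctx} {τ : Ty 0} {t : ITerm} {φ : Form (τ :: Γ) τ} {ψ : Form Γ τ} :
      IsSequent (Form.mu t.succ φ) (φ.finst ψ) → Ded (Form.mu t φ) ψ →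
      Ded (Form.mu t.succ φ) (φ.finst ψ)
  | muSuccR {Γ : Ctx} {τ : Ty 0} {t : ITerm} {φ : Form (τ :: Γ) τ} :
      IsSequent (φ.finst (Form.mu t φ)) (Form.mu t.succ φ) →
      Ded (φ.finst (Form.mu t φ)) (Form.mu t.succ φ)
  | muMono {Γ : Ctx} {τ : Ty 0} {t : ITerm} {ψ φ : Form (τ :: Γ) τ} :
      IsSequent (Form.mu t ψ) (Form.mu t φ) → Ded ψ φ → Ded (Form.mu t ψ) (Form.mu t φ)
  | nuZero {Γ : Ctx} {τ : Ty 0} {φ : Form (τ :: Γ) τ} :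
      IsSequent .tru (Form.nu .zero φ) → Ded .tru (Form.nu .zero φ)
  | nuSuccR {Γ : Ctx} {τ : Ty 0} {t : ITerm} {φ : Form (τ :: Γ) τ} {ψ : Form Γ τ} :
      IsSequent (φ.finst ψ) (Form.nu t.succ φ) → Ded ψ (Form.nu t φ) →
      Ded (φ.finst ψ) (Form.nu t.succ φ)
  | nuSuccL {Γ : Ctx} {τ : Ty 0} {t : ITerm} {φ : Form (τ :: Γ) τ} :
      IsSequent (Form.nu t.succ φ) (φ.finst (Form.nu t φ)) →
      Ded (Form.nu t.succ φ) (φ.finst (Form.nu t φ))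
  | nuMono {Γ : Ctx} {τ : Ty 0} {t : ITerm} {ψ φ : Form (τ :: Γ) τ} :
      IsSequent (Form.nu t ψ) (Form.nu t φ) → Ded ψ φ → Ded (Form.nu t ψ) (Form.nu t φ)
  -- realizability implication
  | wf {Γ : Ctx} {σ τ : Ty 0} {ψ : Form [] σ} {φ : Form [] τ} :
      IsSequent (Form.imp (Γ := Γ) ψ.all φ) (Form.imp ψ φ.shift).ex →
      Ded (Form.imp (Γ := Γ) ψ.all φ) (Form.imp ψ φ.shift).ex
  | cc {Γ : Ctx} {σ τ : Ty 0} {ψ : Form [] σ} {φ : Form [] τ} : Lang .neutral ψ →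
      IsSequent (Form.imp (Γ := Γ) ψ φ.ex) (Form.imp ψ.shift φ).ex →
      Ded (Form.imp (Γ := Γ) ψ φ.ex) (Form.imp ψ.shift φ).ex
  | exImp {Γ : Ctx} {σ τ : Ty 0} {ψ : Form [] σ} {φ : Form [] τ} :
      IsSequent (Form.imp (Γ := Γ) ψ φ.shift).all (Form.imp ψ.ex φ) →
      Ded (Form.imp (Γ := Γ) ψ φ.shift).all (Form.imp ψ.ex φ)
  | impAll {Γ : Ctx} {σ τ : Ty 0} {ψ : Form [] σ} {φ : Form [] τ} :
      IsSequent (Form.imp (Γ := Γ) ψ.shift φ).all (Form.imp ψ φ.all) →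
      Ded (Form.imp (Γ := Γ) ψ.shift φ).all (Form.imp ψ φ.all)
  | impAnd {Γ : Ctx} {σ τ : Ty 0} {ψ : Form [] σ} {φ₁ φ₂ : Form [] τ} :
      IsSequent ((Form.imp (Γ := Γ) ψ φ₁).and (Form.imp ψ φ₂)) (Form.imp ψ (φ₁.and φ₂)) →
      Ded ((Form.imp (Γ := Γ) ψ φ₁).and (Form.imp ψ φ₂)) (Form.imp ψ (φ₁.and φ₂))
  | impTru {Γ : Ctx} {σ τ : Ty 0} {ψ : Form [] σ} :
      IsSequent (Γ := Γ) .tru (Form.imp ψ (Form.tru (τ := τ))) →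
      Ded (Γ := Γ) .tru (Form.imp ψ (Form.tru (τ := τ)))
  | orImp {Γ : Ctx} {σ τ : Ty 0} {ψ₁ ψ₂ : Form [] σ} {φ : Form [] τ} :
      IsSequent ((Form.imp (Γ := Γ) ψ₁ φ).and (Form.imp ψ₂ φ)) (Form.imp (ψ₁.or ψ₂) φ) →
      Ded ((Form.imp (Γ := Γ) ψ₁ φ).and (Form.imp ψ₂ φ)) (Form.imp (ψ₁.or ψ₂) φ)
  | flsImp {Γ : Ctx} {σ τ : Ty 0} {φ : Form [] τ} :
      IsSequent (Γ := Γ) .tru (Form.imp (Form.fls (τ := σ)) φ) →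
      Ded (Γ := Γ) .tru (Form.imp (Form.fls (τ := σ)) φ)
  | impOr {Γ : Ctx} {σ τ : Ty 0} {δ : Form [] σ} {φ₁ φ₂ : Form [] τ} : LangAnd δ →
      IsSequent (Form.imp (Γ := Γ) δ (φ₁.or φ₂)) ((Form.imp δ φ₁).or (Form.imp δ φ₂)) →
      Ded (Form.imp (Γ := Γ) δ (φ₁.or φ₂)) ((Form.imp δ φ₁).or (Form.imp δ φ₂))
  | impFls {Γ : Ctx} {σ τ : Ty 0} {δ : Form [] σ} : Cons δ → LangAnd δ →
      IsSequent (Γ := Γ) (Form.imp δ (Form.fls (τ := τ))) .fls →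
      Ded (Γ := Γ) (Form.imp δ (Form.fls (τ := τ))) .fls

/-- The consistency predicate `C(δ)`. -/
inductive Cons : {τ : Ty 0} → Form [] τ → Prop
  | unit : Cons Form.unit
  | fold {τ : Ty 1} {φ : Form [] τ.unroll} : Cons φ → Cons (φ.mod .fold)
  | pair {σ τ : Ty 0} {φ : Form [] σ} {ψ : Form [] τ} : Cons φ → Cons ψ →
      Cons ((φ.mod (.pi1 (σ := σ) (τ := τ))).and (ψ.mod .pi2))
  | inj1 {σ τ : Ty 0} {φ : Form [] σ} : Cons φ → Cons (φ.mod (.inj1 (σ := σ) (τ := τ)))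
  | inj2 {σ τ : Ty 0} {φ : Form [] τ} : Cons φ → Cons (φ.mod (.inj2 (σ := σ) (τ := τ)))
  | tru {τ : Ty 0} : Cons (Form.tru (τ := τ))
  | up {τ : Ty 0} {ψ φ : Form [] τ} : Cons ψ → Ded ψ φ → LangAnd φ → Cons φ
  /-- A finite family of pairs `(ψ_i, φ_i)` is given as a list `l`, its subfamilies as the sublists
  of `l`; the alternative `⋀ ψ_j ⊢ False` or `C(⋀ φ_j)` is made according to membership in `A`. -/
  | imp {σ τ : Ty 0} (l : List (Form [] σ × Form [] τ)) (A : Set (List (Form [] σ × Form [] τ))) :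
      (∀ p ∈ l, Cons p.1) → (∀ p ∈ l, Cons p.2) →
      (∀ l', List.Sublist l' l → l' ∈ A → Ded (Form.bigAnd (l'.map Prod.fst)) .fls) →
      (∀ l', List.Sublist l' l → l' ∉ A → Cons (Form.bigAnd (l'.map Prod.snd))) →
      Cons (Form.bigAnd (l.map fun p => Form.imp p.1 p.2))

end

end RefLogic

/-!
Every type denotes a Scott domain, which is compact and Hausdorff in its Lawson topology; the upper
sets that are Lawson open are the Scott open ones, and those that are Lawson closed are the Scott
compact ones. By induction, closed positive formulae denote open upper sets, closed negative ones
closed upper sets and closed neutral ones clopen upper sets. Since iteration variables occur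
monotonically under `∃` and antitonically under `∀`, compactness finds a single index in the rules
(WF) and (CC). Formulae in `L^∧` denote the empty set or the principal filter of a compact element,
so a function in `δ ⇛ (φ₁ ∨ φ₂)` is decided at the generator of `δ`, and consistent finite families
of conditions `ψᵢ ⇛ φᵢ` are realised by a supremum of step functions. For recursive types, the
idempotents of the colimit cocone increase to the identity; every type constructor preserves this,
which yields both algebraicity of the colimit and bijectivity of `unfold`.
-/

namespace RefLogic

open Set Topology

/-! ### Scott domains -/

/-- A Scott domain: directed and bounded subsets have least upper bounds, and an element is
determined by the compact elements below it. The least element is the supremum of the empty set. -/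
class IsScottDomain (α : Type*) [PartialOrder α] : Prop where
  exists_isLUB_of_directedOn :
    ∀ s : Set α, s.Nonempty → DirectedOn (· ≤ ·) s → ∃ a, IsLUB s a
  exists_isLUB_of_bddAbove : ∀ s : Set α, BddAbove s → ∃ a, IsLUB s a
  le_of_forall_isCompactElement :
    ∀ x y : α, (∀ d, IsCompactElement d → d ≤ x → d ≤ y) → x ≤ y

open IsScottDomain

section ScottDomain

variable {α β : Type*} [PartialOrder α] [PartialOrder β]

theorem isCompactElement_of_isBot {a : α} (ha : IsBot a) : IsCompactElement a :=
  fun _ _ hs _ _ _ => hs.imp fun x hx => ⟨hx, ha x⟩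

theorem isCompactElement_of_isLUB_pair {a b c : α} (ha : IsCompactElement a)
    (hb : IsCompactElement b) (hc : IsLUB {a, b} c) : IsCompactElement c := by
  intro s u hs hdir hu hcu
  obtain ⟨x, hx, hax⟩ := ha s u hs hdir hu ((hc.1 (by simp)).trans hcu)
  obtain ⟨y, hy, hby⟩ := hb s u hs hdir hu ((hc.1 (by simp)).trans hcu)
  obtain ⟨z, hz, hxz, hyz⟩ := hdir x hx y hy
  refine ⟨z, hz, hc.2 ?_⟩
  rintro _ (rfl | rfl)
  exacts [hax.trans hxz, hby.trans hyz]

section GaloisConnection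

variable {l : α → β} {u : β → α}

theorem isCompactElement_of_galoisConnection (hlu : GaloisConnection l u) (hu : ScottContinuous u)
    {c : α} (hc : IsCompactElement c) : IsCompactElement (l c) := by
  intro s x hs hdir hx hcx
  obtain ⟨_, ⟨y, hy, rfl⟩, hcy⟩ := hc (u '' s) (u x) (hs.image u) (hdir.mono_comp hu.monotone)
    (hu hs hdir hx) (hlu.le_u hcx)
  exact ⟨y, hy, hlu.l_le hcy⟩

theorem le_of_galoisConnection [IsScottDomain α] (hlu : GaloisConnection l u)
    (hu : ScottContinuous u) {x y : β} (h : ∀ d, IsCompactElement d → d ≤ x → d ≤ y) :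
    u x ≤ u y :=
  le_of_forall_isCompactElement _ _ fun c hc hcx => hlu.le_u
    (h (l c) (isCompactElement_of_galoisConnection hlu hu hc) (hlu.l_le hcx))

end GaloisConnection

variable [IsScottDomain α]

theorem exists_isBot (x : α) : ∃ b : α, IsBot b := by
  obtain ⟨b, hb⟩ := exists_isLUB_of_bddAbove (∅ : Set α) ⟨x, by simp⟩
  exact ⟨b, fun y => hb.2 (by simp)⟩

theorem nonempty_compact_le (x : α) : {d | IsCompactElement d ∧ d ≤ x}.Nonempty := by
  obtain ⟨b, hb⟩ := exists_isBot x
  exact ⟨b, isCompactElement_of_isBot hb, hb x⟩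

theorem directedOn_compact_le (x : α) :
    DirectedOn (· ≤ ·) {d | IsCompactElement d ∧ d ≤ x} := by
  rintro a ⟨ha, hax⟩ b ⟨hb, hbx⟩
  have hx : x ∈ upperBounds {a, b} := by rintro _ (rfl | rfl) <;> assumption
  obtain ⟨c, hc⟩ := exists_isLUB_of_bddAbove {a, b} ⟨x, hx⟩
  exact ⟨c, ⟨isCompactElement_of_isLUB_pair ha hb hc, hc.2 hx⟩, hc.1 (by simp), hc.1 (by simp)⟩

theorem isLUB_compact_le (x : α) : IsLUB {d | IsCompactElement d ∧ d ≤ x} x :=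
  ⟨fun _ hd => hd.2, fun _ hy =>
    le_of_forall_isCompactElement _ _ fun _ hd hdx => hy ⟨hd, hdx⟩⟩

theorem exists_isCompactElement_le_mem {U : Set α} (hU : DirSupInacc U) {x : α} (hx : x ∈ U) :
    ∃ d ∈ U, IsCompactElement d ∧ d ≤ x := by
  obtain ⟨d, hd, hdU⟩ :=
    hU (nonempty_compact_le x) (directedOn_compact_le x) (isLUB_compact_le x) hx
  exact ⟨d, hdU, hd⟩

end ScottDomain

/-! ### The Lawson topology -/

section Lawson

theorem isOpen_scott_iff {α : Type*} [Preorder α] {U : Set α} :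
    IsOpen[scott α univ] U ↔ IsUpperSet U ∧ DirSupInacc U := by
  rw [← dirSupInaccOn_univ]
  exact @IsScott.isOpen_iff_isUpperSet_and_dirSupInaccOn α univ _ (scott α univ) U
    (@IsScott.mk α univ _ (scott α univ) rfl)

variable {α β : Type*} [PartialOrder α] [TopologicalSpace α] [IsLawson α] [PartialOrder β]
  [TopologicalSpace β] [IsLawson β]

theorem isOpen_iff_dirSupInacc_of_isUpperSet {U : Set α} (hU : IsUpperSet U) :
    IsOpen U ↔ DirSupInacc U := by
  rw [IsLawson.topology_eq_lawson (α := α)]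
  exact (lawsonOpen_iff_scottOpen_of_isUpperSet hU).trans
    (isOpen_scott_iff.trans (and_iff_right hU))

theorem isClosed_Ici_of_isLawson (a : α) : IsClosed (Ici a) := by
  rw [IsLawson.topology_eq_lawson (α := α)]
  have hlower : IsOpen[lower α] (Ici a)ᶜ :=
    TopologicalSpace.isOpen_generateFrom_of_mem ⟨a, rfl⟩
  exact (@isOpen_compl_iff _ _ (lower α)).1 hlower |>.mono lawson_le_lower

theorem isLawson_eq_generateFrom : ‹TopologicalSpace α› =
    .generateFrom ({U | IsUpperSet U ∧ IsOpen U} ∪ {t | ∃ a, (Ici a)ᶜ = t}) := by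
  apply le_antisymm
  · refine le_generateFrom ?_
    rintro _ (⟨-, hU⟩ | ⟨a, rfl⟩)
    exacts [hU, (isClosed_Ici_of_isLawson a).isOpen_compl]
  · conv_rhs => rw [IsLawson.topology_eq_lawson (α := α)]
    refine le_inf (TopologicalSpace.generateFrom_anti subset_union_right) fun U hU => ?_
    obtain ⟨hup, hinacc⟩ := isOpen_scott_iff.1 hU
    exact .basic U (.inl ⟨hup, (isOpen_iff_dirSupInacc_of_isUpperSet hup).2 hinacc⟩)

theorem le_nhds_of_isLawson {f : Filter α} {x : α}
    (hU : ∀ U, IsUpperSet U → IsOpen U → x ∈ U → U ∈ f) (hL : ∀ a, ¬ a ≤ x → (Ici a)ᶜ ∈ f) :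
    f ≤ 𝓝 x := by
  rw [isLawson_eq_generateFrom (α := α), ← Filter.tendsto_id',
    TopologicalSpace.tendsto_nhds_generateFrom_iff]
  rintro _ (⟨hup, hopen⟩ | ⟨a, rfl⟩) hx
  exacts [hU _ hup hopen hx, hL a hx]

theorem isOpen_preimage_of_scottContinuous {f : α → β} (hf : ScottContinuous f) {U : Set β}
    (hup : IsUpperSet U) (hU : IsOpen U) : IsOpen (f ⁻¹' U) := by
  rw [isOpen_iff_dirSupInacc_of_isUpperSet hup] at hU
  rw [isOpen_iff_dirSupInacc_of_isUpperSet (hup.preimage hf.monotone)]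
  intro d hd hdir a ha hfa
  obtain ⟨_, ⟨x, hx, rfl⟩, hfx⟩ := hU (hd.image f) (hdir.mono_comp hf.monotone) (hf hd hdir ha) hfa
  exact ⟨x, hx, hfx⟩

theorem continuous_of_scottContinuous {f : α → β} (hf : ScottContinuous f)
    (hIci : ∀ b, IsClosed (f ⁻¹' Ici b)) : Continuous f := by
  rw [isLawson_eq_generateFrom (α := β), continuous_generateFrom_iff]
  rintro _ (⟨hup, hopen⟩ | ⟨b, rfl⟩)
  exacts [isOpen_preimage_of_scottContinuous hf hup hopen, (hIci b).isOpen_compl]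

theorem continuous_of_galoisConnection {l : β → α} {u : α → β} (hlu : GaloisConnection l u)
    (hu : ScottContinuous u) : Continuous u := by
  refine continuous_of_scottContinuous hu fun b => ?_
  have hpre : u ⁻¹' Ici b = Ici (l b) := ext fun a => (hlu b a).symm
  exact hpre ▸ isClosed_Ici_of_isLawson _

theorem isClopen_Ici_of_isCompactElement {d : α} (hd : IsCompactElement d) :
    IsClopen (Ici d) :=
  ⟨isClosed_Ici_of_isLawson d, (isOpen_iff_dirSupInacc_of_isUpperSet (isUpperSet_Ici d)).2
    fun s hs hdir a ha hda => hd s a hs hdir ha hda⟩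

variable [IsScottDomain α]

theorem exists_isCompactElement_Ici_subset {U : Set α} (hup : IsUpperSet U) (hU : IsOpen U)
    {x : α} (hx : x ∈ U) : ∃ d, IsCompactElement d ∧ d ≤ x ∧ Ici d ⊆ U := by
  obtain ⟨d, hdU, hd, hdx⟩ :=
    exists_isCompactElement_le_mem ((isOpen_iff_dirSupInacc_of_isUpperSet hup).1 hU) hx
  exact ⟨d, hd, hdx, hup.Ici_subset hdU⟩

instance : TotallySeparatedSpace α := by
  rw [totallySeparatedSpace_iff_exists_isClopen]
  intro x y hxy
  by_cases h : ∀ d, IsCompactElement d → d ≤ x → d ≤ y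
  · have hyx : ¬ y ≤ x := fun hyx => hxy ((le_of_forall_isCompactElement x y h).antisymm hyx)
    obtain ⟨d, hd, hdy, hdx⟩ : ∃ d, IsCompactElement d ∧ d ≤ y ∧ ¬ d ≤ x := by
      by_contra! h
      exact hyx (le_of_forall_isCompactElement y x h)
    exact ⟨(Ici d)ᶜ, (isClopen_Ici_of_isCompactElement hd).compl, hdx, not_not.2 hdy⟩
  · push Not at h
    obtain ⟨d, hd, hdx, hdy⟩ := h
    exact ⟨Ici d, isClopen_Ici_of_isCompactElement hd, hdx, hdy⟩

/- An ultrafilter converges to the supremum of the compact elements `d` whose principal filter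
`Ici d` belongs to it. -/
instance : CompactSpace α := by
  refine ⟨isCompact_iff_ultrafilter_le_nhds.2 fun F _ => ?_⟩
  set D : Set α := {d | IsCompactElement d ∧ Ici d ∈ F}
  obtain ⟨x₀⟩ := F.nonempty_of_mem Filter.univ_mem
  obtain ⟨b, hb⟩ := exists_isBot x₀
  have hne : D.Nonempty :=
    ⟨b, isCompactElement_of_isBot hb, Filter.mem_of_superset Filter.univ_mem fun x _ => hb x⟩
  have hdir : DirectedOn (· ≤ ·) D := by
    rintro c ⟨hc, hcF⟩ d ⟨hd, hdF⟩
    obtain ⟨y, hcy, hdy⟩ := F.nonempty_of_mem (Filter.inter_mem hcF hdF)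
    obtain ⟨e, he⟩ := exists_isLUB_of_bddAbove {c, d} ⟨y, by simp_all [upperBounds]⟩
    refine ⟨e, ⟨isCompactElement_of_isLUB_pair hc hd he, ?_⟩, he.1 (by simp), he.1 (by simp)⟩
    filter_upwards [hcF, hdF] with z hcz hdz
    exact he.2 (by rintro _ (rfl | rfl) <;> assumption)
  obtain ⟨x, hx⟩ := exists_isLUB_of_directedOn D hne hdir
  refine ⟨x, mem_univ x, le_nhds_of_isLawson (fun U hup hU hxU => ?_) fun a ha => ?_⟩
  · obtain ⟨d, ⟨-, hdF⟩, hdU⟩ :=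
      (isOpen_iff_dirSupInacc_of_isUpperSet hup).1 hU hne hdir hx hxU
    exact Filter.mem_of_superset hdF (hup.Ici_subset hdU)
  · rw [Ultrafilter.mem_coe, Ultrafilter.compl_mem_iff_notMem]
    refine fun haF => ha (le_of_forall_isCompactElement _ _ fun d hd hda => hx.1 ⟨hd, ?_⟩)
    exact Filter.mem_of_superset haF (Ici_subset_Ici.2 hda)

end Lawson

instance (X : Cpo) : TopologicalSpace X := lawson X

instance (X : Cpo) : IsLawson X := ⟨rfl⟩

/-! ### Products, sums and function spaces of Scott domains -/

instance {α : Type*} [CompleteLattice α] [IsCompactlyGenerated α] : IsScottDomain α where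
  exists_isLUB_of_directedOn s _ _ := ⟨sSup s, isLUB_sSup s⟩
  exists_isLUB_of_bddAbove s _ := ⟨sSup s, isLUB_sSup s⟩
  le_of_forall_isCompactElement _ _ h := le_iff_compact_le_imp.2 fun d => h d

instance : IsScottDomain Cpo.one :=
  have : IsCompactlyGenerated Unit := CompleteLattice.isCompactlyGenerated_of_wellFoundedGT
  inferInstanceAs (IsScottDomain Unit)

instance : IsScottDomain Cpo.two :=
  have : IsCompactlyGenerated Bool := CompleteLattice.isCompactlyGenerated_of_wellFoundedGT
  inferInstanceAs (IsScottDomain Bool)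

section Prod

variable {α β : Type*} [PartialOrder α] [PartialOrder β]

theorem galoisConnection_prodMk_fst {b : β} (hb : IsBot b) :
    GaloisConnection (fun a : α => (a, b)) Prod.fst :=
  fun _ p => and_iff_left (hb p.2)

theorem galoisConnection_prodMk_snd {a : α} (ha : IsBot a) :
    GaloisConnection (fun b : β => (a, b)) Prod.snd :=
  fun _ p => and_iff_right (ha p.1)

instance [IsScottDomain α] [IsScottDomain β] : IsScottDomain (α × β) where
  exists_isLUB_of_directedOn s hs hdir := by
    obtain ⟨a, ha⟩ := exists_isLUB_of_directedOn _ (hs.image _) (hdir.mono_comp monotone_fst)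
    obtain ⟨b, hb⟩ := exists_isLUB_of_directedOn _ (hs.image _) (hdir.mono_comp monotone_snd)
    exact ⟨(a, b), isLUB_prod.2 ⟨ha, hb⟩⟩
  exists_isLUB_of_bddAbove s hs := by
    obtain ⟨a, ha⟩ := exists_isLUB_of_bddAbove _ (monotone_fst.map_bddAbove hs)
    obtain ⟨b, hb⟩ := exists_isLUB_of_bddAbove _ (monotone_snd.map_bddAbove hs)
    exact ⟨(a, b), isLUB_prod.2 ⟨ha, hb⟩⟩
  le_of_forall_isCompactElement x y h := by
    obtain ⟨a, ha⟩ := exists_isBot x.1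
    obtain ⟨b, hb⟩ := exists_isBot x.2
    exact ⟨le_of_galoisConnection (galoisConnection_prodMk_fst hb) .fst h,
      le_of_galoisConnection (galoisConnection_prodMk_snd ha) .snd h⟩

end Prod

instance (X Y : Cpo) [IsScottDomain X] [IsScottDomain Y] : IsScottDomain (X.prod Y) :=
  inferInstanceAs (IsScottDomain (X × Y))

/-- An order embedding onto an upper set, below which there is nothing but a least element: the
common abstraction of the two injections into a weak coproduct. -/
structure IsSummand {α β : Type} [PartialOrder α] [PartialOrder β] (i : α → β) : Prop where
  le_iff_le : ∀ a b, i a ≤ i b ↔ a ≤ b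
  exists_eq_of_le : ∀ a w, i a ≤ w → ∃ b, w = i b
  isBot_or_exists_eq : ∀ a w, w ≤ i a → IsBot w ∨ ∃ b, w = i b

namespace IsSummand

variable {α β : Type} [PartialOrder α] [PartialOrder β] {i : α → β}

theorem injective (hi : IsSummand i) : Function.Injective i := fun a b h =>
  le_antisymm ((hi.le_iff_le a b).1 h.le) ((hi.le_iff_le b a).1 h.ge)

theorem image_Ici (hi : IsSummand i) (a : α) : i '' Ici a = Ici (i a) := by
  ext w
  constructor
  · rintro ⟨b, hab, rfl⟩
    exact (hi.le_iff_le a b).2 hab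
  · intro haw
    obtain ⟨b, rfl⟩ := hi.exists_eq_of_le a w haw
    exact ⟨b, (hi.le_iff_le a b).1 haw, rfl⟩

theorem isUpperSet_image (hi : IsSummand i) {S : Set α} (hS : IsUpperSet S) :
    IsUpperSet (i '' S) := by
  rintro _ w haw ⟨a, ha, rfl⟩
  obtain ⟨b, rfl⟩ := hi.exists_eq_of_le a w haw
  exact ⟨b, hS ((hi.le_iff_le a b).1 haw) ha, rfl⟩

theorem isLUB_image (hi : IsSummand i) {s : Set α} (hs : s.Nonempty) {a : α} (ha : IsLUB s a) :
    IsLUB (i '' s) (i a) := by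
  refine ⟨?_, fun w hw => ?_⟩
  · rintro _ ⟨x, hx, rfl⟩
    exact (hi.le_iff_le x a).2 (ha.1 hx)
  · obtain ⟨x, hx⟩ := hs
    obtain ⟨b, rfl⟩ := hi.exists_eq_of_le x w (hw ⟨x, hx, rfl⟩)
    exact (hi.le_iff_le a b).2 (ha.2 fun y hy => (hi.le_iff_le y b).1 (hw ⟨y, hy, rfl⟩))

theorem isCompactElement (hi : IsSummand i) {c : α} (hc : IsCompactElement c) :
    IsCompactElement (i c) := by
  intro s u hs hdir hu hcu
  obtain ⟨a, rfl⟩ := hi.exists_eq_of_le c u hcu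
  by_cases hmeets : ∃ x, i x ∈ s
  · obtain ⟨x, hx⟩ := hmeets
    obtain ⟨y, hy, hcy⟩ := hc (i ⁻¹' s) a ⟨x, hx⟩
      (preimage_directed hi.le_iff_le hi.exists_eq_of_le hdir hx).1
      ((isLUB_preimage hi.le_iff_le hi.exists_eq_of_le hdir hx).1 hu) ((hi.le_iff_le c a).1 hcu)
    exact ⟨i y, hy, (hi.le_iff_le c y).2 hcy⟩
  · have hbot : ∀ w ∈ s, IsBot w := fun w hw =>
      (hi.isBot_or_exists_eq a w (hu.1 hw)).resolve_right fun ⟨b, hb⟩ => hmeets ⟨b, hb ▸ hw⟩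
    obtain ⟨w, hw⟩ := hs
    exact ⟨w, hw, hcu.trans (hu.2 fun v hv => hbot v hv w)⟩

theorem exists_isLUB [IsScottDomain α] (hi : IsSummand i) {s : Set β} (hs : BddAbove s) {x : α}
    (hx : i x ∈ s) : ∃ w, IsLUB s w := by
  obtain ⟨w, hw⟩ := hs
  obtain ⟨b, rfl⟩ := hi.exists_eq_of_le x w (hw hx)
  obtain ⟨a, ha⟩ :=
    exists_isLUB_of_bddAbove (i ⁻¹' s) ⟨b, fun y hy => (hi.le_iff_le y b).1 (hw hy)⟩
  have himage := hi.isLUB_image ⟨x, hx⟩ ha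
  refine ⟨i a, fun v hv => ?_,
    fun v hv => himage.2 (upperBounds_mono_set (image_preimage_subset i s) hv)⟩
  obtain hbot | ⟨y, rfl⟩ := hi.isBot_or_exists_eq b v (hw hv)
  exacts [hbot _, himage.1 ⟨y, hv, rfl⟩]

theorem le_of_forall_isCompactElement [IsScottDomain α] (hi : IsSummand i) {a : α} {w : β}
    (h : ∀ d, IsCompactElement d → d ≤ i a → d ≤ w) : i a ≤ w := by
  have hlub := hi.isLUB_image (nonempty_compact_le a) (isLUB_compact_le a)
  refine hlub.2 ?_
  rintro _ ⟨d, ⟨hd, hda⟩, rfl⟩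
  exact h _ (hi.isCompactElement hd) ((hi.le_iff_le d a).2 hda)

variable [TopologicalSpace α] [IsLawson α] [TopologicalSpace β] [IsLawson β]

theorem continuous (hi : IsSummand i) : Continuous i := by
  refine continuous_of_scottContinuous (fun s hs _ a ha => hi.isLUB_image hs ha) fun w => ?_
  by_cases hw : ∃ b, i b ∈ Ici w
  · obtain ⟨b, hwb⟩ := hw
    obtain hbot | ⟨a, rfl⟩ := hi.isBot_or_exists_eq b w hwb
    · rw [show i ⁻¹' Ici w = univ from eq_univ_of_forall fun x => hbot (i x)]
      exact isClosed_univ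
    · rw [show i ⁻¹' Ici (i a) = Ici a from ext fun x => hi.le_iff_le a x]
      exact isClosed_Ici_of_isLawson a
  · rw [show i ⁻¹' Ici w = ∅ from eq_empty_of_forall_notMem fun x hx => hw ⟨x, hx⟩]
    exact isClosed_empty

theorem isClosed_image [IsScottDomain α] [IsScottDomain β] (hi : IsSummand i) {S : Set α}
    (hS : IsClosed S) : IsClosed (i '' S) :=
  (hS.isCompact.image hi.continuous).isClosed

theorem isOpen_image [IsScottDomain α] (hi : IsSummand i) {U : Set α} (hup : IsUpperSet U)
    (hU : IsOpen U) : IsOpen (i '' U) := by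
  refine isOpen_iff_forall_mem_open.2 ?_
  rintro _ ⟨x, hx, rfl⟩
  obtain ⟨d, hd, hdx, hdU⟩ := exists_isCompactElement_Ici_subset hup hU hx
  refine ⟨i '' Ici d, image_mono hdU, ?_, x, hdx, rfl⟩
  rw [hi.image_Ici]
  exact (isClopen_Ici_of_isCompactElement (hi.isCompactElement hd)).isOpen

end IsSummand

section Sum

theorem isSummand_inl {α β : Type} [PartialOrder α] [PartialOrder β] :
    IsSummand (inl : α → WithBot (α ⊕ β)) where
  le_iff_le := inl_le
  exists_eq_of_le := inl_up
  isBot_or_exists_eq a w haw := by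
    rcases w with _ | b | b
    · exact .inl isBot_bot
    · exact .inr ⟨b, rfl⟩
    · exact absurd (WithBot.coe_le_coe.1 haw) Sum.not_inr_le_inl

theorem isSummand_inr {α β : Type} [PartialOrder α] [PartialOrder β] :
    IsSummand (inr : β → WithBot (α ⊕ β)) where
  le_iff_le := inr_le
  exists_eq_of_le := inr_up
  isBot_or_exists_eq a w haw := by
    rcases w with _ | b | b
    · exact .inl isBot_bot
    · exact absurd (WithBot.coe_le_coe.1 haw) Sum.not_inl_le_inr
    · exact .inr ⟨b, rfl⟩

instance (X Y : Cpo) [IsScottDomain X] [IsScottDomain Y] : IsScottDomain (X.sum Y) where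
  exists_isLUB_of_directedOn := (X.sum Y).exists_lub
  exists_isLUB_of_bddAbove s hs := by
    rcases sum_cases s with ⟨x, hx⟩ | ⟨y, hy⟩ | hbot
    · exact isSummand_inl.exists_isLUB hs hx
    · exact isSummand_inr.exists_isLUB hs hy
    · exact ⟨(⊥ : WithBot (X ⊕ Y)), fun w hw => (hbot w hw).le,
        fun w _ => bot_le (α := WithBot (X ⊕ Y))⟩
  le_of_forall_isCompactElement v w h := by
    rcases v with _ | x | y
    · exact bot_le (α := WithBot (X ⊕ Y))
    · exact isSummand_inl.le_of_forall_isCompactElement h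
    · exact isSummand_inr.le_of_forall_isCompactElement h

end Sum

section Fn

variable {X Y : Cpo}

theorem exists_forall_le_iff_of_bddAbove [IsScottDomain Y] {ι : Type*} {d : ι → X} {e : ι → Y}
    (hd : ∀ i, IsCompactElement (d i)) (hbdd : ∀ x, BddAbove (e '' {i | d i ≤ x})) :
    ∃ f : ScottHom X Y, ∀ g : ScottHom X Y, f ≤ g ↔ ∀ i, e i ≤ g (d i) := by
  choose f hf using fun x => exists_isLUB_of_bddAbove _ (hbdd x)
  have hle {i x} (hx : d i ≤ x) : e i ≤ f x := (hf x).1 ⟨i, hx, rfl⟩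
  have hmono : Monotone f := fun x y hxy => (hf x).2 <| by
    rintro _ ⟨i, hi, rfl⟩
    exact hle (le_trans hi hxy)
  have hcont : ScottContinuous f := by
    refine fun s hs hdir a ha => ⟨hmono.mem_upperBounds_image ha.1, fun b hb => (hf a).2 ?_⟩
    rintro _ ⟨i, hia, rfl⟩
    obtain ⟨x, hx, hix⟩ := hd i s a hs hdir ha hia
    exact (hle hix).trans (hb ⟨x, hx, rfl⟩)
  refine ⟨⟨f, hcont⟩, fun g => ⟨fun hfg i => (hle le_rfl).trans (ScottHom.apply_le hfg (d i)),
    fun hg x => (hf x).2 ?_⟩⟩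
  rintro _ ⟨i, hix, rfl⟩
  exact (hg i).trans (g.mono hix)

theorem exists_galoisConnection_apply [IsScottDomain Y] {d : X} (hd : IsCompactElement d) :
    ∃ step : Y → ScottHom X Y, GaloisConnection step fun f => f d := by
  choose step hstep using fun e : Y =>
    exists_forall_le_iff_of_bddAbove (ι := Unit) (d := fun _ => d) (e := fun _ => e)
      (fun _ => hd) fun _ => ⟨e, by rintro _ ⟨-, -, rfl⟩; exact le_rfl⟩
  exact ⟨step, fun e f => (hstep e f).trans ⟨fun h => h (), fun h _ => h⟩⟩

theorem scottContinuous_apply (x : X) : ScottContinuous fun f : ScottHom X Y => f x :=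
  fun _ hs hdir _ ha => isLUB_fn hs hdir ha x

instance [IsScottDomain X] [IsScottDomain Y] : IsScottDomain (X.fn Y) where
  exists_isLUB_of_directedOn := (X.fn Y).exists_lub
  exists_isLUB_of_bddAbove F hF := by
    choose s hs using fun x => exists_isLUB_of_bddAbove ((fun f : ScottHom X Y => f x) '' F)
      ((scottContinuous_apply x).monotone.map_bddAbove hF)
    exact ⟨_, isLUB_of_apply hs⟩
  le_of_forall_isCompactElement f g h x := by
    refine (f.continuous (nonempty_compact_le x) (directedOn_compact_le x)
      (isLUB_compact_le x)).2 ?_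
    rintro _ ⟨d, ⟨hd, hdx⟩, rfl⟩
    obtain ⟨step, hstep⟩ := exists_galoisConnection_apply (Y := Y) hd
    exact (le_of_galoisConnection hstep (scottContinuous_apply d) h).trans (g.mono hdx)

end Fn

/-! ### Exhausting families of embedding-projection pairs -/

theorem galoisConnection_LR {X Y : Cpo} (e : EP X Y) : GaloisConnection e.L.toFun e.R.toFun :=
  GaloisConnection.monotone_intro e.R.continuous.monotone e.L.continuous.monotone
    (fun x => (e.RL x).ge) e.LR

/-- A sequence of embedding-projection pairs `e n : X n ⟶ Y` whose idempotents `L ∘ R` increase to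
the identity of `Y`. Colimit cocones are of this form, and the functors interpreting type
expressions preserve such sequences; this is how they are locally continuous. -/
structure Exhausts {X : ℕ → Cpo} {Y : Cpo} (e : ∀ n, X n ⟶ Y) : Prop where
  mono : ∀ y, Monotone fun n => (e n).L ((e n).R y)
  le : ∀ {y z}, (∀ n, (e n).L ((e n).R y) ≤ z) → y ≤ z

namespace Exhausts

variable {X X' : ℕ → Cpo} {Y Y' : Cpo} {e : ∀ n, X n ⟶ Y} {f : ∀ n, X' n ⟶ Y'}

theorem map_le (he : Exhausts e) (g : ScottHom Y Y') {y : Y} {z : Y'}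
    (h : ∀ n, g ((e n).L ((e n).R y)) ≤ z) : g y ≤ z := by
  have hlub : IsLUB (range fun n => (e n).L ((e n).R y)) y :=
    ⟨forall_mem_range.2 fun n => (e n).LR y, fun z hz => he.le fun n => hz ⟨n, rfl⟩⟩
  refine (g.continuous (range_nonempty _) (directedOn_range.2 (he.mono y).directed_le) hlub).2 ?_
  rw [← range_comp]
  exact forall_mem_range.2 h

theorem id (Y : Cpo) : Exhausts fun _ : ℕ => 𝟙 Y :=
  ⟨fun _ _ _ _ => le_rfl, fun h => h 0⟩

theorem cocone (K : ℕ ⥤ Cpo) : Exhausts (cocone K) where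
  mono x := desc_mono (RefLogic.cocone K) (fun _ _ h => cocone_w K h) x
  le {x y} h n := (((RefLogic.cocone K n).RL _).symm.trans_le
    ((RefLogic.cocone K n).R.mono (h n)) : (RefLogic.cocone K n).R x ≤ (RefLogic.cocone K n).R y)

theorem prod (he : Exhausts e) (hf : Exhausts f) : Exhausts fun n => EP.prod (e n) (f n) where
  mono _ _ _ h := ⟨he.mono _ h, hf.mono _ h⟩
  le h := ⟨he.le fun n => (h n).1, hf.le fun n => (h n).2⟩

theorem sum (he : Exhausts e) (hf : Exhausts f) : Exhausts fun n => EP.sum (e n) (f n) := by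
  constructor
  · rintro (_ | y | y) n m h
    exacts [le_rfl, (inl_le _ _).2 (he.mono y h), (inr_le _ _).2 (hf.mono y h)]
  · rintro (_ | y | y) z h
    · exact bot_le (α := WithBot (Y ⊕ Y'))
    · obtain ⟨z, rfl⟩ := inl_up _ _ (h 0)
      exact (inl_le _ _).2 (he.le fun n => (inl_le _ _).1 (h n))
    · obtain ⟨z, rfl⟩ := inr_up _ _ (h 0)
      exact (inr_le _ _).2 (hf.le fun n => (inr_le _ _).1 (h n))

theorem fn (he : Exhausts e) (hf : Exhausts f) : Exhausts fun n => EP.fn (e n) (f n) := by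
  have mono₂ (g : ScottHom Y Y') {n m k : ℕ} (hn : n ≤ k) (hm : m ≤ k) (y : Y) :
      (f m).L ((f m).R (g ((e n).L ((e n).R y)))) ≤ (f k).L ((f k).R (g ((e k).L ((e k).R y)))) :=
    (hf.mono _ hm).trans (ScottHom.mono _ (ScottHom.mono _ (g.mono (he.mono y hn))))
  refine ⟨fun g n m h y => mono₂ g h h y, fun {g z} h y => he.map_le g fun n => hf.le fun m => ?_⟩
  exact (mono₂ g (le_max_left n m) (le_max_right n m) y).trans (h (max n m) y)

theorem exists_isLUB_of_bddAbove (he : Exhausts e) (hX : ∀ n, IsScottDomain (X n)) {s : Set Y}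
    (hs : BddAbove s) : ∃ a, IsLUB s a := by
  have isLUB_LR (n : ℕ) : ∃ b, IsLUB ((fun y => (e n).L ((e n).R y)) '' s) b := by
    obtain ⟨t, ht⟩ := (hX n).exists_isLUB_of_bddAbove _
      ((e n).R.continuous.monotone.map_bddAbove hs)
    exact ⟨_, image_image (e n).L.toFun _ _ ▸ (galoisConnection_LR (e n)).isLUB_l_image ht⟩
  choose b hb using isLUB_LR
  have hmono : Monotone b := fun n m h =>
    (hb n).2 (forall_mem_image.2 fun y hy => (he.mono y h).trans ((hb m).1 ⟨y, hy, rfl⟩))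
  obtain ⟨a, ha⟩ := Y.exists_lub _ (range_nonempty b) (directedOn_range.2 hmono.directed_le)
  refine ⟨a, fun y hy => he.le fun n => ((hb n).1 ⟨y, hy, rfl⟩).trans (ha.1 ⟨n, rfl⟩),
    fun u hu => ha.2 (forall_mem_range.2 fun n => (hb n).2 (forall_mem_image.2 fun y hy => ?_))⟩
  exact ((e n).LR y).trans (hu hy)

theorem isScottDomain (he : Exhausts e) (hX : ∀ n, IsScottDomain (X n)) : IsScottDomain Y where
  exists_isLUB_of_directedOn := Y.exists_lub
  exists_isLUB_of_bddAbove _ := he.exists_isLUB_of_bddAbove hX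
  le_of_forall_isCompactElement _ _ h := he.le fun n => (galoisConnection_LR (e n)).l_le
    (have := hX n; le_of_galoisConnection (galoisConnection_LR (e n)) (e n).R.continuous h)

end Exhausts

theorem isLUB_desc {K : ℕ ⥤ Cpo} {Y : Cpo} (c : ∀ n, K.obj n ⟶ Y)
    (hc : ∀ n m (h : n ≤ m), K.map (homOfLE h) ≫ c m = c n) (x : Lim K) :
    IsLUB (range fun n => (c n).L ((cocone K n).R x)) ((desc c hc).L x) :=
  (exists_desc c hc x).choose_spec

section Fix

variable {E : Type 1} [Category.{0} E] {A : ℕ → E} {B : E} {f : ∀ n, A n ⟶ B}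

theorem Exhausts.chainTransApp {F : E × Cpo ⥤ Cpo}
    (hF : ∀ {X : ℕ → Cpo} {Y : Cpo} {g : ∀ n, X n ⟶ Y}, Exhausts g →
      Exhausts fun n => F.map (X := (A n, X n)) (Y := (B, Y)) (f n, g n)) :
    ∀ m, Exhausts fun n => chainTransApp ((Functor.curry.obj F).map (f n)) m
  | 0 => Exhausts.id _
  | m + 1 => by
    have map_eq (n : ℕ) := F.map_comp (Prod.mkHom (f n) (𝟙 _))
      (Prod.mkHom (𝟙 B) (RefLogic.chainTransApp ((Functor.curry.obj F).map (f n)) m))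
    simp only [prod_comp, Category.comp_id, Category.id_comp] at map_eq
    exact funext map_eq ▸ hF (Exhausts.chainTransApp hF m)

theorem Exhausts.fix_map {G : E ⥤ Cpo ⥤ Cpo}
    (h : ∀ m, Exhausts fun n => RefLogic.chainTransApp (G.map (f n)) m) :
    Exhausts fun n => (Fix G).map (f n) := by
  have isLUB_map (n : ℕ) (y : Lim (chain (G.obj B))) :
      IsLUB (range fun m => (RefLogic.cocone (chain (G.obj B)) m).L
        ((RefLogic.chainTransApp (G.map (f n)) m).L
          ((RefLogic.chainTransApp (G.map (f n)) m).R (y.1 m))))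
        (((Fix G).map (f n)).L (((Fix G).map (f n)).R y)) :=
    isLUB_desc (K := chain (G.obj (A n)))
      (fun m => (chainTrans (G.map (f n))).app m ≫ RefLogic.cocone (chain (G.obj B)) m)
      (fun k m h => by rw [← Category.assoc, NatTrans.naturality, Category.assoc, cocone_w])
      (((Fix G).map (f n)).R y)
  refine ⟨fun y n n' hn => (isLUB_map n y).2 (forall_mem_range.2 fun m => ?_), fun {y z} hz => ?_⟩
  · exact (ScottHom.mono _ ((h m).mono _ hn)).trans ((isLUB_map n' y).1 ⟨m, rfl⟩)
  · refine (Exhausts.cocone _).le fun m =>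
      (h m).map_le (y := y.1 m) (RefLogic.cocone (chain (G.obj B)) m).L fun n => ?_
    exact ((isLUB_map n y).1 ⟨m, rfl⟩).trans (hz n)

end Fix

theorem isScottDomain_chainObj {G : Cpo ⥤ Cpo}
    (hG : ∀ X : Cpo, IsScottDomain X → IsScottDomain (G.obj X)) : ∀ n, IsScottDomain (chainObj G n)
  | 0 => inferInstanceAs (IsScottDomain Cpo.one)
  | n + 1 => hG _ (isScottDomain_chainObj hG n)

namespace Ty

theorem isScottDomain_interp : ∀ {n : ℕ} (τ : Ty n) {E : Type 1} [Category.{0} E]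
    (ρ : Fin n → E ⥤ Cpo) (B : E), (∀ i, IsScottDomain ((ρ i).obj B)) →
      IsScottDomain ((interp τ ρ).obj B)
  | _, var i, _, _, _, _, h => h i
  | _, unit, _, _, _, _, _ => inferInstanceAs (IsScottDomain Cpo.two)
  | _, prod σ τ, _, _, ρ, B, h =>
    have := isScottDomain_interp σ ρ B h
    have := isScottDomain_interp τ ρ B h
    inferInstanceAs (IsScottDomain (((interp σ ρ).obj B).prod ((interp τ ρ).obj B)))
  | _, sum σ τ, _, _, ρ, B, h =>
    have := isScottDomain_interp σ ρ B h
    have := isScottDomain_interp τ ρ B h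
    inferInstanceAs (IsScottDomain (((interp σ ρ).obj B).sum ((interp τ ρ).obj B)))
  | _, arr σ τ, _, _, ρ, B, h =>
    have := isScottDomain_interp σ ρ B h
    have := isScottDomain_interp τ ρ B h
    inferInstanceAs (IsScottDomain (((interp σ ρ).obj B).fn ((interp τ ρ).obj B)))
  | _, recT τ, _, _, _, B, h =>
    (Exhausts.cocone _).isScottDomain
      (isScottDomain_chainObj fun X hX => isScottDomain_interp τ _ (B, X) (Fin.cases hX h))

instance (τ : Ty 0) : IsScottDomain τ.dom :=
  isScottDomain_interp τ _ _ fun i => i.elim0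

theorem exhausts_interp : ∀ {n : ℕ} (τ : Ty n) {E : Type 1} [Category.{0} E]
    (ρ : Fin n → E ⥤ Cpo) {A : ℕ → E} {B : E} (f : ∀ n, A n ⟶ B),
    (∀ i, Exhausts fun n => (ρ i).map (f n)) → Exhausts fun n => (interp τ ρ).map (f n)
  | _, var i, _, _, _, _, _, _, h => h i
  | _, unit, _, _, _, _, _, _, _ => Exhausts.id _
  | _, prod σ τ, _, _, ρ, _, _, f, h => (exhausts_interp σ ρ f h).prod (exhausts_interp τ ρ f h)
  | _, sum σ τ, _, _, ρ, _, _, f, h => (exhausts_interp σ ρ f h).sum (exhausts_interp τ ρ f h)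
  | _, arr σ τ, _, _, ρ, _, _, f, h => (exhausts_interp σ ρ f h).fn (exhausts_interp τ ρ f h)
  | _, recT τ, _, _, _, A, B, f, h =>
    Exhausts.fix_map <| Exhausts.chainTransApp fun {X Y} {g} hg =>
      exhausts_interp τ _ (A := fun n => (A n, X n)) (B := (B, Y)) (fun n => (f n, g n))
        (Fin.cases hg h)

theorem exhausts_bodyFunctor (τ : Ty 1) {X : ℕ → Cpo} {Y : Cpo} {e : ∀ n, X n ⟶ Y}
    (he : Exhausts e) : Exhausts fun n => (bodyFunctor τ).map (e n) :=
  exhausts_interp τ _ (A := fun n => ((Fin.elim0 : NoParams), X n))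
    (B := ((Fin.elim0 : NoParams), Y)) (fun n => (𝟙 _, e n)) (Fin.cases he fun i => i.elim0)

end Ty

theorem unfoldEP_LR {G : Cpo ⥤ Cpo} (hG : Exhausts fun n => G.map (cocone (chain G) n))
    (y : G.obj (Lim (chain G))) : (unfoldEP G).L ((unfoldEP G).R y) = y :=
  le_antisymm ((unfoldEP G).LR y) <| hG.le fun n =>
    (isLUB_desc (unfoldCocone G) (unfoldCocone_w G) ((unfoldEP G).R y)).1 ⟨n + 1, rfl⟩

theorem eqToHom_LR {X Y : Cpo} (h : X = Y) (y : Y) : (eqToHom h).L ((eqToHom h).R y) = y := by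
  subst h
  rfl

theorem Ty.exists_orderIso_eq_unfold (τ : Ty 1) :
    ∃ i : (recT τ).dom ≃o (unroll τ).dom, ⇑i = unfold τ := by
  let e : (recT τ).dom ⟶ (unroll τ).dom := unfoldEP (bodyFunctor τ) ≫ eqToHom (bodyFunctor_rec τ)
  have hLR (y : (unroll τ).dom) : e.L (e.R y) = y :=
    (congrArg (eqToHom (bodyFunctor_rec τ)).L
      (unfoldEP_LR (exhausts_bodyFunctor τ (Exhausts.cocone _)) _)).trans (eqToHom_LR _ _)
  exact ⟨⟨⟨e.L, e.R, e.RL, hLR⟩, fun {x y} =>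
    ⟨fun h => (e.RL x).symm.trans_le ((e.R.mono h).trans_eq (e.RL y)), fun h => e.L.mono h⟩⟩, rfl⟩

/-! ### Realizability implication on sets -/

/-- The semantics of `⇛`: the Scott-continuous functions that map `A` into `B`. -/
def impSet {X Y : Cpo} (A : Set X) (B : Set Y) : Set (X.fn Y) :=
  {f : ScottHom X Y | ∀ x ∈ A, f x ∈ B}

section impSet

variable {X Y : Cpo} {A A' : Set X} {B B' : Set Y}

theorem impSet_mono (hA : A' ⊆ A) (hB : B ⊆ B') : impSet A B ⊆ impSet A' B' :=
  fun _ hf x hx => hB (hf x (hA hx))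

theorem isUpperSet_impSet (hB : IsUpperSet B) : IsUpperSet (impSet A B) :=
  fun _ _ hfg hf x hx => hB (hfg x) (hf x hx)

theorem impSet_Ici (d : X) (hB : IsUpperSet B) :
    impSet (Ici d) B = (fun f : ScottHom X Y => f d) ⁻¹' B :=
  ext fun f => ⟨fun hf => hf d self_mem_Ici, fun hfd _ hx => hB (f.mono hx) hfd⟩

theorem impSet_Ici_union_subset (d : X) (hB : IsUpperSet B) (hB' : IsUpperSet B') :
    impSet (Ici d) (B ∪ B') ⊆ impSet (Ici d) B ∪ impSet (Ici d) B' := by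
  rw [impSet_Ici d hB, impSet_Ici d hB', impSet_Ici d (hB.union hB'), preimage_union]
  exact Subset.rfl

variable [IsScottDomain X]

theorem isOpen_impSet (hA : IsClosed A) (hup : IsUpperSet B) (hB : IsOpen B) :
    IsOpen (impSet A B) := by
  rw [isOpen_iff_dirSupInacc_of_isUpperSet (isUpperSet_impSet hup)]
  intro F hF hdir f hlub hf
  have := hF.to_subtype
  have hcover : A ⊆ ⋃ g : F, g.1.toFun ⁻¹' B := fun x hx => by
    have hinacc := (isOpen_iff_dirSupInacc_of_isUpperSet hup).1 hB
    obtain ⟨_, ⟨g, hg, rfl⟩, hgx⟩ := hinacc (hF.image fun g : ScottHom X Y => g x)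
      (directedOn_apply hdir x) (isLUB_fn hF hdir hlub x) (hf x hx)
    exact mem_iUnion.2 ⟨⟨g, hg⟩, hgx⟩
  have hdirected : Directed (· ⊆ ·) fun g : F => g.1.toFun ⁻¹' B := fun g h => by
    obtain ⟨k, hk, hgk, hhk⟩ := hdir g g.2 h h.2
    exact ⟨⟨k, hk⟩, fun x hx => hup (hgk x) hx, fun x hx => hup (hhk x) hx⟩
  obtain ⟨g, hg⟩ := hA.isCompact.elim_directed_cover _
    (fun g : F => isOpen_preimage_of_scottContinuous g.1.continuous hup hB) hcover hdirected
  exact ⟨g, g.2, hg⟩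

theorem isClosed_impSet [IsScottDomain Y] (hAup : IsUpperSet A) (hA : IsOpen A)
    (hBup : IsUpperSet B) (hB : IsClosed B) : IsClosed (impSet A B) := by
  have eq_biInter : impSet A B = ⋂ d ∈ {d | IsCompactElement d ∧ d ∈ A},
      (fun f : ScottHom X Y => f d) ⁻¹' B := by
    ext f
    refine ⟨fun hf => mem_iInter₂.2 fun d hd => hf d hd.2, fun hf x hx => ?_⟩
    obtain ⟨d, hd, hdx, hdA⟩ := exists_isCompactElement_Ici_subset hAup hA hx
    exact hBup (f.mono hdx) (mem_iInter₂.1 hf d ⟨hd, hdA self_mem_Ici⟩)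
  rw [eq_biInter]
  refine isClosed_biInter fun d hd => hB.preimage ?_
  obtain ⟨step, hstep⟩ := exists_galoisConnection_apply (Y := Y) hd.1
  exact continuous_of_galoisConnection (α := X.fn Y) hstep (scottContinuous_apply d)

theorem impSet_iInter_subset {A : ℕ → Set X} (hanti : Antitone A) (hA : ∀ n, IsClosed (A n))
    (hup : IsUpperSet B) (hB : IsOpen B) : impSet (⋂ n, A n) B ⊆ ⋃ n, impSet (A n) B := by
  intro f hf
  have hopen : IsOpen (f.toFun ⁻¹' B) := isOpen_preimage_of_scottContinuous f.continuous hup hB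
  obtain ⟨n, hn⟩ := exists_subset_nhds_of_compactSpace hanti.directed_ge hA
    fun x hx => hopen.mem_nhds (hf x hx)
  exact mem_iUnion.2 ⟨n, hn⟩

theorem impSet_iUnion_subset {B : ℕ → Set Y} (hA : IsClosed A) (hmono : Monotone B)
    (hup : ∀ n, IsUpperSet (B n)) (hB : ∀ n, IsOpen (B n)) :
    impSet A (⋃ n, B n) ⊆ ⋃ n, impSet A (B n) := by
  intro f hf
  obtain ⟨n, hn⟩ := hA.isCompact.elim_directed_cover (fun n => f.toFun ⁻¹' B n)
    (fun n => isOpen_preimage_of_scottContinuous f.continuous (hup n) (hB n))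
    (fun x hx => preimage_iUnion ▸ hf x hx)
    (Monotone.directed_le fun _ _ h => preimage_mono (hmono h))
  exact mem_iUnion.2 ⟨n, hn⟩

end impSet

/-! ### Compactly generated principal filters -/

/-- The empty set or the upper closure of a compact element. These are the sets denoted by the
formulae of `L^∧`. -/
def IsCompactCone {α : Type*} [PartialOrder α] (S : Set α) : Prop :=
  S = ∅ ∨ ∃ d, IsCompactElement d ∧ S = Ici d

namespace IsCompactCone

section PartialOrder

variable {α β : Type*} [PartialOrder α] [PartialOrder β] {S T : Set α}

theorem empty : IsCompactCone (∅ : Set α) := Or.inl rfl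

theorem Ici {d : α} (hd : IsCompactElement d) : IsCompactCone (Ici d) := Or.inr ⟨d, hd, rfl⟩

theorem isUpperSet (hS : IsCompactCone S) : IsUpperSet S := by
  obtain rfl | ⟨d, -, rfl⟩ := hS
  exacts [isUpperSet_empty, isUpperSet_Ici d]

theorem preimage {l : α → β} {u : β → α} (hlu : GaloisConnection l u) (hu : ScottContinuous u)
    (hS : IsCompactCone S) : IsCompactCone (u ⁻¹' S) := by
  obtain rfl | ⟨d, hd, rfl⟩ := hS
  · exact .empty
  · have hpre : u ⁻¹' Set.Ici d = Set.Ici (l d) := ext fun y => (hlu d y).symm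
    exact hpre ▸ .Ici (isCompactElement_of_galoisConnection hlu hu hd)

theorem image {α β : Type} [PartialOrder α] [PartialOrder β] {S : Set α} {i : α → β}
    (hi : IsSummand i) (hS : IsCompactCone S) : IsCompactCone (i '' S) := by
  obtain rfl | ⟨d, hd, rfl⟩ := hS
  · exact image_empty i ▸ .empty
  · exact hi.image_Ici d ▸ .Ici (hi.isCompactElement hd)

variable [IsScottDomain α]

theorem univ : IsCompactCone (univ : Set α) := by
  cases isEmpty_or_nonempty α with
  | inl _ => exact Or.inl (Subsingleton.elim _ _)
  | inr hα =>
    obtain ⟨b, hb⟩ := exists_isBot hα.some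
    exact Or.inr ⟨b, isCompactElement_of_isBot hb, (eq_univ_of_forall hb).symm⟩

theorem inter (hS : IsCompactCone S) (hT : IsCompactCone T) : IsCompactCone (S ∩ T) := by
  obtain rfl | ⟨d, hd, rfl⟩ := hS
  · exact (empty_inter T).symm ▸ .empty
  obtain rfl | ⟨e, he, rfl⟩ := hT
  · exact (inter_empty _).symm ▸ .empty
  have hinter : Set.Ici d ∩ Set.Ici e = upperBounds {d, e} := by
    simp only [upperBounds_insert, upperBounds_singleton]
  rw [hinter]
  obtain hne | hbdd := (upperBounds {d, e}).eq_empty_or_nonempty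
  · exact Or.inl hne
  obtain ⟨c, hc⟩ := exists_isLUB_of_bddAbove {d, e} hbdd
  exact Or.inr ⟨c, isCompactElement_of_isLUB_pair hd he hc, hc.upperBounds_eq⟩

end PartialOrder

variable {X Y : Cpo} {A : Set X} {B B' : Set Y}

theorem impSet [IsScottDomain X] [IsScottDomain Y] (hA : IsCompactCone A) (hB : IsCompactCone B) :
    IsCompactCone (impSet A B) := by
  obtain rfl | ⟨d, hd, rfl⟩ := hA
  · exact (eq_univ_of_forall fun f x hx => hx.elim : RefLogic.impSet ∅ B = _) ▸ .univ
  · rw [impSet_Ici d hB.isUpperSet]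
    obtain ⟨step, hstep⟩ := exists_galoisConnection_apply (Y := Y) hd
    exact hB.preimage (β := X.fn Y) hstep (scottContinuous_apply d)

theorem impSet_union_subset (hA : IsCompactCone A) (hB : IsUpperSet B) (hB' : IsUpperSet B') :
    RefLogic.impSet A (B ∪ B') ⊆ RefLogic.impSet A B ∪ RefLogic.impSet A B' := by
  obtain rfl | ⟨d, -, rfl⟩ := hA
  · exact fun f _ => Or.inl fun x hx => hx.elim
  · exact impSet_Ici_union_subset d hB hB'

theorem nonempty_iInter_impSet [IsScottDomain Y] {ι : Type*} {A : ι → Set X} {B : ι → Set Y}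
    (hA : ∀ i, IsCompactCone (A i)) (hAne : ∀ i, (A i).Nonempty) (hB : ∀ i, IsCompactCone (B i))
    (hBne : ∀ x, (⋂ i ∈ {i | x ∈ A i}, B i).Nonempty) :
    (⋂ i, RefLogic.impSet (A i) (B i)).Nonempty := by
  choose d hd hAd using fun i => (hA i).resolve_left (hAne i).ne_empty
  have hBi (i : ι) : (B i).Nonempty :=
    (hBne (hAne i).some).mono (biInter_subset_of_mem (hAne i).some_mem)
  choose e _ hBe using fun i => (hB i).resolve_left (hBi i).ne_empty
  have hbdd (x : X) : BddAbove (e '' {i | d i ≤ x}) := by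
    obtain ⟨y, hy⟩ := hBne x
    refine ⟨y, forall_mem_image.2 fun i hi => ?_⟩
    simpa only [hBe, mem_Ici] using mem_iInter₂.1 hy i (hAd i ▸ hi : x ∈ A i)
  obtain ⟨f, hf⟩ := exists_forall_le_iff_of_bddAbove hd hbdd
  refine ⟨f, mem_iInter.2 fun i => ?_⟩
  rw [hAd, hBe, impSet_Ici _ (isUpperSet_Ici _)]
  exact (hf f).1 le_rfl i

end IsCompactCone

/-! ### Semantic modalities -/

namespace Modality

theorem sem_eq_preimage_or_image : ∀ {σ τ : Ty 0} (m : Modality σ τ),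
    (∃ (l : σ.dom → τ.dom) (u : τ.dom → σ.dom),
      GaloisConnection l u ∧ ScottContinuous u ∧ m.sem = preimage u) ∨
    (¬ m.NotInj ∧ ∃ i : σ.dom → τ.dom, IsSummand i ∧ m.sem = image i)
  | _, _, pi1 (σ := σ) (τ := τ) =>
    have ⟨_, hb⟩ := τ.dom.exists_bot
    .inl ⟨_, _, galoisConnection_prodMk_fst (α := σ.dom) hb,
      fun _ _ _ _ h => (isLUB_prod.1 h).1, rfl⟩
  | _, _, pi2 (σ := σ) (τ := τ) =>
    have ⟨_, hb⟩ := σ.dom.exists_bot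
    .inl ⟨_, _, galoisConnection_prodMk_snd (β := τ.dom) hb,
      fun _ _ _ _ h => (isLUB_prod.1 h).2, rfl⟩
  | _, _, inj1 => .inr ⟨id, _, isSummand_inl, rfl⟩
  | _, _, inj2 => .inr ⟨id, _, isSummand_inr, rfl⟩
  | _, _, fold (τ := τ) =>
    have ⟨i, hi⟩ := τ.exists_orderIso_eq_unfold
    .inl ⟨_, _, hi ▸ i.symm.to_galoisConnection, τ.unfold.continuous, rfl⟩

variable {σ τ : Ty 0} (m : Modality σ τ) {ι : Type*}

theorem sem_mono : Monotone m.sem := by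
  obtain ⟨l, u, -, -, h⟩ | ⟨-, i, -, h⟩ := m.sem_eq_preimage_or_image <;> rw [h]
  exacts [monotone_preimage, monotone_image]

theorem sem_univ (hm : m.NotInj) : m.sem univ = univ := by
  obtain ⟨l, u, -, -, h⟩ | ⟨hm', -⟩ := m.sem_eq_preimage_or_image
  exacts [h ▸ preimage_univ, absurd hm hm']

theorem sem_empty : m.sem ∅ = ∅ := by
  obtain ⟨l, u, -, -, h⟩ | ⟨-, i, -, h⟩ := m.sem_eq_preimage_or_image <;> rw [h]
  exacts [preimage_empty, image_empty i]

theorem sem_inter (S T : Set σ.dom) : m.sem (S ∩ T) = m.sem S ∩ m.sem T := by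
  obtain ⟨l, u, -, -, h⟩ | ⟨-, i, hi, h⟩ := m.sem_eq_preimage_or_image <;> rw [h]
  exacts [preimage_inter, image_inter hi.injective]

theorem sem_union (S T : Set σ.dom) : m.sem (S ∪ T) = m.sem S ∪ m.sem T := by
  obtain ⟨l, u, -, -, h⟩ | ⟨-, i, -, h⟩ := m.sem_eq_preimage_or_image <;> rw [h]
  exacts [preimage_union, image_union i S T]

theorem sem_iUnion (S : ι → Set σ.dom) : m.sem (⋃ n, S n) = ⋃ n, m.sem (S n) := by
  obtain ⟨l, u, -, -, h⟩ | ⟨-, i, -, h⟩ := m.sem_eq_preimage_or_image <;> rw [h]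
  exacts [preimage_iUnion, image_iUnion]

theorem sem_iInter [Nonempty ι] (S : ι → Set σ.dom) : m.sem (⋂ n, S n) = ⋂ n, m.sem (S n) := by
  obtain ⟨l, u, -, -, h⟩ | ⟨-, i, hi, h⟩ := m.sem_eq_preimage_or_image <;> rw [h]
  exacts [preimage_iInter, hi.injective.injOn.image_iInter_eq]

variable {S : Set σ.dom}

theorem isUpperSet_sem (hS : IsUpperSet S) : IsUpperSet (m.sem S) := by
  obtain ⟨l, u, -, hu, h⟩ | ⟨-, i, hi, h⟩ := m.sem_eq_preimage_or_image <;> rw [h]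
  exacts [hS.preimage hu.monotone, hi.isUpperSet_image hS]

theorem isOpen_sem (hup : IsUpperSet S) (hS : IsOpen S) : IsOpen (m.sem S) := by
  obtain ⟨l, u, -, hu, h⟩ | ⟨-, i, hi, h⟩ := m.sem_eq_preimage_or_image <;> rw [h]
  exacts [isOpen_preimage_of_scottContinuous hu hup hS, hi.isOpen_image hup hS]

theorem isClosed_sem (hS : IsClosed S) : IsClosed (m.sem S) := by
  obtain ⟨l, u, hlu, hu, h⟩ | ⟨-, i, hi, h⟩ := m.sem_eq_preimage_or_image <;> rw [h]
  exacts [hS.preimage (continuous_of_galoisConnection hlu hu), hi.isClosed_image hS]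

theorem isCompactCone_sem (hS : IsCompactCone S) : IsCompactCone (m.sem S) := by
  obtain ⟨l, u, hlu, hu, h⟩ | ⟨-, i, hi, h⟩ := m.sem_eq_preimage_or_image <;> rw [h]
  exacts [hS.preimage hlu hu, hS.image hi]

end Modality

/-! ### Substitution lemmas -/

namespace ITerm

theorem eval_subst (s : ℕ → ITerm) (ν : ℕ → ℕ) :
    ∀ t : ITerm, (t.subst s).eval ν = t.eval fun k => (s k).eval ν
  | var _ => rfl
  | zero => rfl
  | succ t => congrArg (· + 1) (eval_subst s ν t)

theorem eval_shift (t : ITerm) (n : ℕ) (ν : ℕ → ℕ) : t.shift.eval (iCons n ν) = t.eval ν :=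
  eval_subst _ _ t

theorem eval_lift (s : ℕ → ITerm) (n : ℕ) (ν : ℕ → ℕ) :
    (fun k => (lift s k).eval (iCons n ν)) = iCons n fun k => (s k).eval ν := by
  funext k
  cases k with
  | zero => rfl
  | succ k => exact eval_shift _ _ _

theorem eval_inst (t : ITerm) (ν : ℕ → ℕ) :
    (fun k => (t.inst k).eval ν) = iCons (t.eval ν) ν := by
  funext k
  cases k <;> rfl

theorem eval_mono : ∀ t : ITerm, Monotone t.eval
  | var k => fun _ _ h => h k
  | zero => monotone_const
  | succ t => fun _ _ h => Nat.succ_le_succ (t.eval_mono h)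

theorem eval_update {k : ℕ} : ∀ {t : ITerm}, ¬ t.Free k → ∀ (ν : ℕ → ℕ) (n : ℕ),
    t.eval (Function.update ν k n) = t.eval ν
  | var _, hk, _, _ => Function.update_of_ne (Ne.symm hk) _ _
  | zero, _, _, _ => rfl
  | succ t, hk, ν, n => congrArg (· + 1) (eval_update (t := t) hk ν n)

end ITerm

theorem iCons_update (ν : ℕ → ℕ) (k m n : ℕ) :
    iCons n (Function.update ν k m) = Function.update (iCons n ν) (k + 1) m := by
  funext l
  cases l with
  | zero => rfl
  | succ l => simp only [iCons, Function.update_apply, Nat.add_right_cancel_iff]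

theorem update_iCons_zero (ν : ℕ → ℕ) (m n : ℕ) :
    Function.update (iCons m ν) 0 n = iCons n ν := by
  funext l
  cases l <;> rfl

namespace FVal

variable {Γ Δ : Ctx} {σ : Ty 0}

theorem cons_liftRen (r : ∀ τ, Var Γ τ → Var Δ τ) (S : Set σ.dom) (ρ : FVal Δ) :
    (fun τ x => cons S ρ τ (Form.liftRen r σ τ x)) = cons S fun τ x => ρ τ (r τ x) := by
  funext τ x
  cases x <;> rfl

theorem cons_mono {S T : Set σ.dom} {ρ ρ' : FVal Γ} (hS : S ⊆ T) (hρ : ρ ≤ ρ') :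
    cons S ρ ≤ cons T ρ'
  | _, Var.here => hS
  | _, Var.there x => hρ _ x

theorem cons_iSup (S : ℕ → Set σ.dom) (ρ : ℕ → FVal Γ) :
    cons (⋃ n, S n) (⨆ n, ρ n) = ⨆ n, cons (S n) (ρ n) := by
  funext τ x
  cases x <;> simp only [cons, iSup_apply, iSup_eq_iUnion]

theorem cons_iInf (S : ℕ → Set σ.dom) (ρ : ℕ → FVal Γ) :
    cons (⋂ n, S n) (⨅ n, ρ n) = ⨅ n, cons (S n) (ρ n) := by
  funext τ x
  cases x <;> simp only [cons, iInf_apply, iInf_eq_iInter]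

end FVal

namespace Form

variable {Γ Δ : Ctx} {σ τ : Ty 0}

theorem sem_isubst (φ : Form Γ τ) (s : ℕ → ITerm) (ρ : FVal Γ) (ν : ℕ → ℕ) :
    (φ.isubst s).sem ρ ν = φ.sem ρ fun k => (s k).eval ν := by
  induction φ generalizing s ν with
  | unit => rfl
  | _ => simp only [isubst, sem, ITerm.eval_subst, ITerm.eval_lift, *]

theorem sem_shift (φ : Form Γ τ) (ρ : FVal Γ) (n : ℕ) (ν : ℕ → ℕ) :
    φ.shift.sem ρ (iCons n ν) = φ.sem ρ ν :=
  sem_isubst _ _ _ _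

theorem sem_inst (φ : Form Γ τ) (t : ITerm) (ρ : FVal Γ) (ν : ℕ → ℕ) :
    (φ.inst t).sem ρ ν = φ.sem ρ (iCons (t.eval ν) ν) := by
  rw [inst, sem_isubst, ITerm.eval_inst]

theorem sem_frename (φ : Form Γ τ) (r : ∀ σ, Var Γ σ → Var Δ σ) (ρ : FVal Δ) (ν : ℕ → ℕ) :
    (φ.frename r).sem ρ ν = φ.sem (fun σ x => ρ σ (r σ x)) ν := by
  induction φ generalizing Δ ν with
  | unit => rfl
  | _ => simp only [frename, sem, FVal.cons_liftRen, *]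

theorem sem_liftSub (s : ∀ τ, Var Γ τ → Form Δ τ) (S : Set σ.dom) (ρ : FVal Δ) (ν : ℕ → ℕ) :
    (fun τ x => (liftSub s σ τ x).sem (FVal.cons S ρ) ν) =
      FVal.cons S fun τ x => (s τ x).sem ρ ν := by
  funext τ x
  cases x with
  | here => rfl
  | there x => exact sem_frename _ _ _ _

theorem sem_fsubst (φ : Form Γ τ) (s : ∀ σ, Var Γ σ → Form Δ σ) (ρ : FVal Δ) (ν : ℕ → ℕ) :
    (φ.fsubst s).sem ρ ν = φ.sem (fun σ x => (s σ x).sem ρ ν) ν := by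
  induction φ generalizing Δ ν with
  | unit => rfl
  | _ => simp only [fsubst, sem, sem_liftSub, sem_shift, *]

theorem sem_finst (φ : Form (σ :: Γ) τ) (ψ : Form Γ σ) (ρ : FVal Γ) (ν : ℕ → ℕ) :
    (φ.finst ψ).sem ρ ν = φ.sem (FVal.cons (ψ.sem ρ ν) ρ) ν := by
  rw [finst, sem_fsubst]
  congr 1
  funext τ x
  cases x <;> rfl

theorem sem_update {k : ℕ} {φ : Form Γ τ} (hk : ¬ φ.Free k) (ρ : FVal Γ) (ν : ℕ → ℕ) (n : ℕ) :
    φ.sem ρ (Function.update ν k n) = φ.sem ρ ν := by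
  induction φ generalizing k ν with
  | unit => rfl
  | _ => simp_all only [Free, not_or, sem, ITerm.eval_update, iCons_update, not_false_eq_true]

/-! ### Monotonicity -/

theorem sem_mono (φ : Form Γ τ) (ν : ℕ → ℕ) : Monotone fun ρ => φ.sem ρ ν := by
  intro ρ ρ' h
  induction φ generalizing ν with
  | tru | fls | unit | imp => exact subset_rfl
  | and _ _ h₁ h₂ => exact inter_subset_inter (h₁ ν h) (h₂ ν h)
  | or _ _ h₁ h₂ => exact union_subset_union (h₁ ν h) (h₂ ν h)
  | mod m _ ih => exact m.sem_mono (ih ν h)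
  | var x => exact h _ x
  | mu t _ ih | nu t _ ih =>
    exact Monotone.iterate_le_of_le (fun _ _ hS => ih ν (FVal.cons_mono hS le_rfl))
      (fun _ => ih ν (FVal.cons_mono subset_rfl h)) _ _
  | ex _ ih => exact iUnion_mono fun n => ih _ h
  | all _ ih => exact iInter_mono fun n => ih _ h

/-- The map `S ↦ ⟦φ⟧ρ[S/X]` whose iterates interpret `mu` and `nu`. -/
def step (φ : Form (τ :: Γ) τ) (ρ : FVal Γ) (ν : ℕ → ℕ) : Set τ.dom → Set τ.dom :=
  fun S => φ.sem (FVal.cons S ρ) ν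

theorem step_mono (φ : Form (τ :: Γ) τ) (ρ : FVal Γ) (ν : ℕ → ℕ) : Monotone (φ.step ρ ν) :=
  fun _ _ h => φ.sem_mono ν (FVal.cons_mono h le_rfl)

theorem sem_mu (t : ITerm) (φ : Form (τ :: Γ) τ) (ρ : FVal Γ) (ν : ℕ → ℕ) :
    (mu t φ).sem ρ ν = (φ.step ρ ν)^[t.eval ν] ∅ := rfl

theorem sem_nu (t : ITerm) (φ : Form (τ :: Γ) τ) (ρ : FVal Γ) (ν : ℕ → ℕ) :
    (nu t φ).sem ρ ν = (φ.step ρ ν)^[t.eval ν] univ := rfl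

theorem sem_mu_succ (t : ITerm) (φ : Form (τ :: Γ) τ) (ρ : FVal Γ) (ν : ℕ → ℕ) :
    (mu t.succ φ).sem ρ ν = φ.step ρ ν ((mu t φ).sem ρ ν) :=
  Function.iterate_succ_apply' _ _ _

theorem sem_nu_succ (t : ITerm) (φ : Form (τ :: Γ) τ) (ρ : FVal Γ) (ν : ℕ → ℕ) :
    (nu t.succ φ).sem ρ ν = φ.step ρ ν ((nu t φ).sem ρ ν) :=
  Function.iterate_succ_apply' _ _ _

theorem monotone_iterate_step_empty (φ : Form (τ :: Γ) τ) (ρ : FVal Γ) (ν : ℕ → ℕ) :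
    Monotone fun n => (φ.step ρ ν)^[n] ∅ :=
  (φ.step_mono ρ ν).monotone_iterate_of_le_map (empty_subset _)

theorem antitone_iterate_step_univ (φ : Form (τ :: Γ) τ) (ρ : FVal Γ) (ν : ℕ → ℕ) :
    Antitone fun n => (φ.step ρ ν)^[n] univ :=
  (φ.step_mono ρ ν).antitone_iterate_of_map_le (subset_univ _)

end Form

mutual

theorem Pos.monotone_sem_update : ∀ {Γ : Ctx} {τ : Ty 0} {k : ℕ} {φ : Form Γ τ}, Pos k φ →
    ∀ (ρ : FVal Γ) (ν : ℕ → ℕ), Monotone fun n => φ.sem ρ (Function.update ν k n)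
  | _, _, _, _, .notFree hφ, ρ, ν => by simpa only [Form.sem_update hφ] using monotone_const
  | _, _, _, _, .and h₁ h₂, ρ, ν => (h₁.monotone_sem_update ρ ν).inf (h₂.monotone_sem_update ρ ν)
  | _, _, _, _, .or h₁ h₂, ρ, ν => (h₁.monotone_sem_update ρ ν).sup (h₂.monotone_sem_update ρ ν)
  | _, _, _, _, .mod (m := m) h, ρ, ν => m.sem_mono.comp (h.monotone_sem_update ρ ν)
  | _, _, _, _, .imp h₁ h₂, _, ν => fun _ _ hn =>
    impSet_mono (h₁.antitone_sem_update _ ν hn) (h₂.monotone_sem_update _ ν hn)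
  | _, _, _, _, .ex h, ρ, ν => fun _ _ hn => iUnion_mono fun l => by
    simpa only [iCons_update] using h.monotone_sem_update ρ (iCons l ν) hn
  | _, _, _, _, .mu (t := t) (φ := φ) h, ρ, ν => fun _ _ hn =>
    (φ.monotone_iterate_step_empty ρ _ (t.eval_mono (Function.update_mono hn))).trans
      (Monotone.iterate_le_of_le (φ.step_mono ρ _) (fun _ => h.monotone_sem_update _ ν hn) _ _)
  | _, _, _, _, .nu (φ := φ) h ht, ρ, ν => fun _ _ hn => by
    simp only [Form.sem_nu, ITerm.eval_update ht]
    exact Monotone.iterate_le_of_le (φ.step_mono ρ _) (fun _ => h.monotone_sem_update _ ν hn) _ _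

theorem Neg.antitone_sem_update : ∀ {Γ : Ctx} {τ : Ty 0} {k : ℕ} {φ : Form Γ τ}, Neg k φ →
    ∀ (ρ : FVal Γ) (ν : ℕ → ℕ), Antitone fun n => φ.sem ρ (Function.update ν k n)
  | _, _, _, _, .notFree hφ, ρ, ν => by simpa only [Form.sem_update hφ] using antitone_const
  | _, _, _, _, .and h₁ h₂, ρ, ν => (h₁.antitone_sem_update ρ ν).inf (h₂.antitone_sem_update ρ ν)
  | _, _, _, _, .or h₁ h₂, ρ, ν => (h₁.antitone_sem_update ρ ν).sup (h₂.antitone_sem_update ρ ν)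
  | _, _, _, _, .mod (m := m) h, ρ, ν => m.sem_mono.comp_antitone (h.antitone_sem_update ρ ν)
  | _, _, _, _, .imp h₁ h₂, _, ν => fun _ _ hn =>
    impSet_mono (h₁.monotone_sem_update _ ν hn) (h₂.antitone_sem_update _ ν hn)
  | _, _, _, _, .all h, ρ, ν => fun _ _ hn => iInter_mono fun l => by
    simpa only [iCons_update] using h.antitone_sem_update ρ (iCons l ν) hn
  | _, _, _, _, .nu (t := t) (φ := φ) h, ρ, ν => fun _ _ hn =>
    (φ.antitone_iterate_step_univ ρ _ (t.eval_mono (Function.update_mono hn))).trans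
      (Monotone.iterate_le_of_le (φ.step_mono ρ _) (fun _ => h.antitone_sem_update _ ν hn) _ _)
  | _, _, _, _, .mu (φ := φ) h ht, ρ, ν => fun _ _ hn => by
    simp only [Form.sem_mu, ITerm.eval_update ht]
    exact Monotone.iterate_le_of_le (φ.step_mono ρ _) (fun _ => h.antitone_sem_update _ ν hn) _ _

end

section iCons

variable {Γ : Ctx} {τ : Ty 0} {φ : Form Γ τ}

theorem Pos.monotone_sem_iCons (h : Pos 0 φ) (ρ : FVal Γ) (ν : ℕ → ℕ) :
    Monotone fun n => φ.sem ρ (iCons n ν) := by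
  simpa only [update_iCons_zero] using h.monotone_sem_update ρ (iCons 0 ν)

theorem Neg.antitone_sem_iCons (h : Neg 0 φ) (ρ : FVal Γ) (ν : ℕ → ℕ) :
    Antitone fun n => φ.sem ρ (iCons n ν) := by
  simpa only [update_iCons_zero] using h.antitone_sem_update ρ (iCons 0 ν)

theorem Pos.monotone_sem_iCons_iCons (h : Pos 1 φ) (ρ : FVal Γ) (n : ℕ) (ν : ℕ → ℕ) :
    Monotone fun m => φ.sem ρ (iCons n (iCons m ν)) := by
  simpa only [← iCons_update, update_iCons_zero] using
    h.monotone_sem_update ρ (iCons n (iCons 0 ν))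

theorem Neg.antitone_sem_iCons_iCons (h : Neg 1 φ) (ρ : FVal Γ) (n : ℕ) (ν : ℕ → ℕ) :
    Antitone fun m => φ.sem ρ (iCons n (iCons m ν)) := by
  simpa only [← iCons_update, update_iCons_zero] using
    h.antitone_sem_update ρ (iCons n (iCons 0 ν))

end iCons

/-! ### Topological type of the denotations -/

theorem IsCompactCone.isClopen {α : Type*} [PartialOrder α] [TopologicalSpace α] [IsLawson α]
    {S : Set α} (hS : IsCompactCone S) : IsClopen S := by
  obtain rfl | ⟨d, hd, rfl⟩ := hS
  exacts [isClopen_empty, isClopen_Ici_of_isCompactElement hd]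

theorem isCompactCone_singleton_true : IsCompactCone ({true} : Set Bool) := by
  have hcompact : WellFoundedGT Bool ↔ ∀ b : Bool, IsCompactElement b :=
    (CompleteLattice.wellFoundedGT_characterisations Bool).out 0 3
  have htop : ({true} : Set Bool) = Ici true := Ici_top.symm
  exact htop ▸ .Ici (hcompact.1 inferInstance true)

theorem LangAnd.isCompactCone_sem {τ : Ty 0} {δ : Form [] τ} (hδ : LangAnd δ) (ν : ℕ → ℕ) :
    IsCompactCone (δ.sem FVal.nil ν) := by
  induction hδ with
  | tru => exact .univ
  | fls => exact .empty
  | and _ _ ihφ ihψ => exact ihφ.inter ihψ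
  | unit => exact isCompactCone_singleton_true
  | mod _ ih => exact Modality.isCompactCone_sem _ ih
  | imp _ _ ihψ ihφ => exact ihψ.impSet ihφ

namespace Sign

theorem opp_ne_pos {s : Sign} (hs : s ≠ neg) : s.opp ≠ pos := by
  cases s <;> simp_all [opp]

theorem opp_ne_neg {s : Sign} (hs : s ≠ pos) : s.opp ≠ neg := by
  cases s <;> simp_all [opp]

/-- The sets that formulae of polarity `s` may denote: upper sets that are Lawson open unless `s` is
negative and Lawson closed unless `s` is positive. For upper sets, Lawson open means Scott open and
Lawson closed means Scott compact. -/
structure Admissible (s : Sign) {X : Cpo} (S : Set X) : Prop where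
  isUpperSet : IsUpperSet S
  isOpen : s ≠ neg → IsOpen S
  isClosed : s ≠ pos → IsClosed S

namespace Admissible

variable {s : Sign} {X Y : Cpo} {S T : Set X}

theorem of_isCompactCone (hS : IsCompactCone S) : s.Admissible S where
  isUpperSet := hS.isUpperSet
  isOpen _ := hS.isClopen.isOpen
  isClosed _ := hS.isClopen.isClosed

theorem inter (hS : s.Admissible S) (hT : s.Admissible T) : s.Admissible (S ∩ T) where
  isUpperSet := hS.isUpperSet.inter hT.isUpperSet
  isOpen hs := (hS.isOpen hs).inter (hT.isOpen hs)
  isClosed hs := (hS.isClosed hs).inter (hT.isClosed hs)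

theorem union (hS : s.Admissible S) (hT : s.Admissible T) : s.Admissible (S ∪ T) where
  isUpperSet := hS.isUpperSet.union hT.isUpperSet
  isOpen hs := (hS.isOpen hs).union (hT.isOpen hs)
  isClosed hs := (hS.isClosed hs).union (hT.isClosed hs)

theorem iUnion {ι : Type*} {S : ι → Set X} (hS : ∀ i, pos.Admissible (S i)) :
    pos.Admissible (⋃ i, S i) where
  isUpperSet := isUpperSet_iUnion fun i => (hS i).isUpperSet
  isOpen hs := isOpen_iUnion fun i => (hS i).isOpen hs
  isClosed hs := absurd rfl hs

theorem iInter {ι : Type*} {S : ι → Set X} (hS : ∀ i, neg.Admissible (S i)) :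
    neg.Admissible (⋂ i, S i) where
  isUpperSet := isUpperSet_iInter fun i => (hS i).isUpperSet
  isOpen hs := absurd rfl hs
  isClosed hs := isClosed_iInter fun i => (hS i).isClosed hs

theorem modality {σ τ : Ty 0} (m : Modality σ τ) {S : Set σ.dom} (hS : s.Admissible S) :
    s.Admissible (m.sem S) where
  isUpperSet := m.isUpperSet_sem hS.isUpperSet
  isOpen hs := m.isOpen_sem hS.isUpperSet (hS.isOpen hs)
  isClosed hs := m.isClosed_sem (hS.isClosed hs)

theorem impSet [IsScottDomain X] [IsScottDomain Y] {B : Set Y} (hS : s.opp.Admissible S)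
    (hB : s.Admissible B) : s.Admissible (impSet S B) where
  isUpperSet := isUpperSet_impSet hB.isUpperSet
  isOpen hs := isOpen_impSet (hS.isClosed (opp_ne_pos hs)) hB.isUpperSet (hB.isOpen hs)
  isClosed hs := isClosed_impSet hS.isUpperSet (hS.isOpen (opp_ne_neg hs)) hB.isUpperSet
    (hB.isClosed hs)

end Admissible

end Sign

namespace Lang

theorem admissible_sem {s : Sign} {Γ : Ctx} {τ : Ty 0} {φ : Form Γ τ} (h : Lang s φ) {ρ : FVal Γ}
    (hρ : ∀ σ x, s.Admissible (ρ σ x)) (ν : ℕ → ℕ) : s.Admissible (φ.sem ρ ν) := by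
  induction h generalizing ν with
  | tru => exact .of_isCompactCone .univ
  | fls => exact .of_isCompactCone .empty
  | and _ _ ihφ ihψ => exact (ihφ hρ ν).inter (ihψ hρ ν)
  | or _ _ ihφ ihψ => exact (ihφ hρ ν).union (ihψ hρ ν)
  | unit => exact .of_isCompactCone isCompactCone_singleton_true
  | mod _ ih => exact (ih hρ ν).modality _
  | var => exact hρ _ _
  | @mu _ _ s _ _ _ ih =>
    exact Function.Iterate.rec s.Admissible (.of_isCompactCone .empty)
      (fun S hS => ih (by rintro _ (_ | x); exacts [hS, hρ _ x]) ν) _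
  | @nu _ _ s _ _ _ ih =>
    exact Function.Iterate.rec s.Admissible (.of_isCompactCone .univ)
      (fun S hS => ih (by rintro _ (_ | x); exacts [hS, hρ _ x]) ν) _
  | ex _ _ ih => exact .iUnion fun n => ih hρ _
  | all _ _ ih => exact .iInter fun n => ih hρ _
  | imp _ _ ihψ ihφ => exact (ihψ (fun _ x => nomatch x) ν).impSet (ihφ (fun _ x => nomatch x) ν)

theorem admissible_sem_nil {s : Sign} {τ : Ty 0} {φ : Form [] τ} (h : Lang s φ) (ν : ℕ → ℕ) :
    s.Admissible (φ.sem FVal.nil ν) :=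
  h.admissible_sem (fun _ x => nomatch x) ν

end Lang

/-! ### Continuity in the fixpoint variables -/

section Iterate

variable {α ι : Type*} [CompleteLattice α]

theorem iSup_iSup_le_iSup_diag [SemilatticeSup ι] {f : ι → ι → α} (hf : Monotone f)
    (hf' : ∀ i, Monotone (f i)) : ⨆ i, ⨆ j, f i j ≤ ⨆ i, f i i :=
  iSup₂_le fun i j => le_iSup_of_le (i ⊔ j) ((hf le_sup_left j).trans (hf' _ le_sup_right))

theorem iInf_diag_le_iInf_iInf [SemilatticeSup ι] {f : ι → ι → α} (hf : Antitone f)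
    (hf' : ∀ i, Antitone (f i)) : ⨅ i, f i i ≤ ⨅ i, ⨅ j, f i j :=
  le_iInf₂ fun i j => iInf_le_of_le (i ⊔ j) ((hf' _ le_sup_right).trans (hf le_sup_left j))

variable [Preorder ι] [Nonempty ι] {F : ι → α → α} {G : α → α}

theorem iterate_le_iSup_iterate (hF : Monotone F) (hF' : ∀ i, Monotone (F i)) (hG : Monotone G)
    (hGF : ∀ A : ι → α, Monotone A → G (⨆ i, A i) ≤ ⨆ i, F i (A i)) (a : α) (n : ℕ) :
    G^[n] a ≤ ⨆ i, (F i)^[n] a := by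
  induction n with
  | zero => exact iSup_const.ge
  | succ n ih =>
    have hmono : Monotone fun i => (F i)^[n] a := fun i j hij =>
      (hF' i).iterate_le_of_le (hF hij) n a
    simp only [Function.iterate_succ_apply']
    exact (hG ih).trans (hGF _ hmono)

theorem iInf_iterate_le_iterate (hF : Antitone F) (hF' : ∀ i, Monotone (F i)) (hG : Monotone G)
    (hFG : ∀ A : ι → α, Antitone A → ⨅ i, F i (A i) ≤ G (⨅ i, A i)) (a : α) (n : ℕ) :
    ⨅ i, (F i)^[n] a ≤ G^[n] a :=
  iterate_le_iSup_iterate (α := αᵒᵈ) hF (fun i => (hF' i).dual) hG.dual hFG a n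

end Iterate

namespace Form

variable {Γ : Ctx} {τ : Ty 0} {φ : Form (τ :: Γ) τ} {ρ : ℕ → FVal Γ} {ν : ℕ → ℕ}

theorem iterate_step_iSup_subset (hρ : Monotone ρ)
    (hφ : ∀ ρ' : ℕ → FVal (τ :: Γ), Monotone ρ' → φ.sem (⨆ n, ρ' n) ν ⊆ ⋃ n, φ.sem (ρ' n) ν)
    (S : Set τ.dom) (m : ℕ) :
    (φ.step (⨆ n, ρ n) ν)^[m] S ⊆ ⋃ n, (φ.step (ρ n) ν)^[m] S :=
  iterate_le_iSup_iterate (F := fun n => φ.step (ρ n) ν) (G := φ.step (⨆ n, ρ n) ν)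
    (fun _ _ hn _ => φ.sem_mono ν (FVal.cons_mono subset_rfl (hρ hn)))
    (fun n => φ.step_mono (ρ n) ν) (φ.step_mono _ ν) (fun A hA => by
      simp only [step, iSup_eq_iUnion, FVal.cons_iSup]
      exact hφ _ fun _ _ hn => FVal.cons_mono (hA hn) (hρ hn)) S m

theorem iInter_subset_iterate_step_iInf (hρ : Antitone ρ)
    (hφ : ∀ ρ' : ℕ → FVal (τ :: Γ), Antitone ρ' → ⋂ n, φ.sem (ρ' n) ν ⊆ φ.sem (⨅ n, ρ' n) ν)
    (S : Set τ.dom) (m : ℕ) :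
    ⋂ n, (φ.step (ρ n) ν)^[m] S ⊆ (φ.step (⨅ n, ρ n) ν)^[m] S :=
  iInf_iterate_le_iterate (F := fun n => φ.step (ρ n) ν) (G := φ.step (⨅ n, ρ n) ν)
    (fun _ _ hn _ => φ.sem_mono ν (FVal.cons_mono subset_rfl (hρ hn)))
    (fun n => φ.step_mono (ρ n) ν) (φ.step_mono _ ν) (fun A hA => by
      simp only [step, iInf_eq_iInter, FVal.cons_iInf]
      exact hφ _ fun _ _ hn => FVal.cons_mono (hA hn) (hρ hn)) S m

end Form

namespace Lang

variable {s : Sign} {Γ : Ctx} {τ : Ty 0}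

theorem sem_iSup_subset {φ : Form Γ τ} (h : Lang s φ) (hs : s ≠ .neg) {ρ : ℕ → FVal Γ}
    (hρ : Monotone ρ) (ν : ℕ → ℕ) : φ.sem (⨆ n, ρ n) ν ⊆ ⋃ n, φ.sem (ρ n) ν := by
  induction h generalizing ν with
  | tru | fls | unit | imp => exact (iUnion_const _).ge
  | @and _ _ _ φ ψ _ _ ihφ ihψ =>
    exact (inter_subset_inter (ihφ hs hρ ν) (ihψ hs hρ ν)).trans
      (iUnion_inter_of_monotone ((φ.sem_mono ν).comp hρ) ((ψ.sem_mono ν).comp hρ)).ge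
  | or _ _ ihφ ihψ =>
    exact (union_subset_union (ihφ hs hρ ν) (ihψ hs hρ ν)).trans (iUnion_union_distrib _ _).ge
  | @mod _ _ _ _ m _ _ ih => exact (m.sem_mono (ih hs hρ ν)).trans (m.sem_iUnion _).le
  | var => simp only [Form.sem, iSup_apply, iSup_eq_iUnion, subset_rfl]
  | mu _ ih | nu _ ih => exact Form.iterate_step_iSup_subset hρ (fun _ hρ' => ih hs hρ' ν) _ _
  | ex _ _ ih => exact (iUnion_mono fun n => ih hs hρ _).trans (iUnion_comm _).le
  | all => exact absurd rfl hs

theorem iInter_sem_subset_sem_iInf {φ : Form Γ τ} (h : Lang s φ) (hs : s ≠ .pos)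
    {ρ : ℕ → FVal Γ} (hρ : Antitone ρ) (ν : ℕ → ℕ) :
    ⋂ n, φ.sem (ρ n) ν ⊆ φ.sem (⨅ n, ρ n) ν := by
  induction h generalizing ν with
  | tru | fls | unit | imp => exact (iInter_const _).le
  | and _ _ ihφ ihψ =>
    exact (iInter_inter_distrib _ _).le.trans (inter_subset_inter (ihφ hs hρ ν) (ihψ hs hρ ν))
  | @or _ _ _ φ ψ _ _ ihφ ihψ =>
    exact (iInter_union_of_antitone ((φ.sem_mono ν).comp_antitone hρ)
      ((ψ.sem_mono ν).comp_antitone hρ)).le.trans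
        (union_subset_union (ihφ hs hρ ν) (ihψ hs hρ ν))
  | @mod _ _ _ _ m _ _ ih => exact (m.sem_iInter _).ge.trans (m.sem_mono (ih hs hρ ν))
  | var => simp only [Form.sem, iInf_apply, iInf_eq_iInter, subset_rfl]
  | mu _ ih | nu _ ih =>
    exact Form.iInter_subset_iterate_step_iInf hρ (fun _ hρ' => ih hs hρ' ν) _ _
  | ex => exact absurd rfl hs
  | all _ _ ih => exact (iInter_comm _).le.trans (iInter_mono fun n => ih hs hρ _)

variable {φ : Form (τ :: Γ) τ} {A : ℕ → Set τ.dom}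

theorem step_iUnion_subset (h : Lang s φ) (hs : s ≠ .neg) (hA : Monotone A) (ρ : FVal Γ)
    (ν : ℕ → ℕ) : φ.step ρ ν (⋃ n, A n) ⊆ ⋃ n, φ.step ρ ν (A n) := by
  have hcons := FVal.cons_iSup A fun _ => ρ
  rw [iSup_const] at hcons
  rw [Form.step, hcons]
  exact h.sem_iSup_subset hs (fun _ _ hn => FVal.cons_mono (hA hn) le_rfl) ν

theorem iInter_step_subset (h : Lang s φ) (hs : s ≠ .pos) (hA : Antitone A) (ρ : FVal Γ)
    (ν : ℕ → ℕ) : ⋂ n, φ.step ρ ν (A n) ⊆ φ.step ρ ν (⋂ n, A n) := by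
  have hcons := FVal.cons_iInf A fun _ => ρ
  rw [iInf_const] at hcons
  rw [Form.step, hcons]
  exact h.iInter_sem_subset_sem_iInf hs (fun _ _ hn => FVal.cons_mono (hA hn) le_rfl) ν

theorem iterate_step_ex_subset (h : Lang .pos φ) (hpos : Pos 0 φ) (ρ : FVal Γ) (ν : ℕ → ℕ)
    (S : Set τ.dom) (m : ℕ) :
    (φ.ex.step ρ ν)^[m] S ⊆ ⋃ n, (φ.step ρ (iCons n ν))^[m] S := by
  have hstep : Monotone fun n => φ.step ρ (iCons n ν) :=
    fun _ _ hn _ => hpos.monotone_sem_iCons _ ν hn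
  refine iterate_le_iSup_iterate hstep (fun n => φ.step_mono ρ _) (φ.ex.step_mono ρ ν)
    (fun A hA => ?_) S m
  calc φ.ex.step ρ ν (⋃ n, A n)
      ⊆ ⋃ k, ⋃ n, φ.step ρ (iCons k ν) (A n) :=
        iUnion_mono fun k => h.step_iUnion_subset nofun hA ρ _
    _ ⊆ ⋃ n, φ.step ρ (iCons n ν) (A n) :=
        iSup_iSup_le_iSup_diag (fun _ _ hk n => hstep hk (A n))
          fun k => (φ.step_mono ρ (iCons k ν)).comp hA

theorem iInter_subset_iterate_step_all (h : Lang .neg φ) (hneg : Neg 0 φ) (ρ : FVal Γ)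
    (ν : ℕ → ℕ) (S : Set τ.dom) (m : ℕ) :
    ⋂ n, (φ.step ρ (iCons n ν))^[m] S ⊆ (φ.all.step ρ ν)^[m] S := by
  have hstep : Antitone fun n => φ.step ρ (iCons n ν) :=
    fun _ _ hn _ => hneg.antitone_sem_iCons _ ν hn
  refine iInf_iterate_le_iterate hstep (fun n => φ.step_mono ρ _) (φ.all.step_mono ρ ν)
    (fun A hA => ?_) S m
  calc ⋂ n, φ.step ρ (iCons n ν) (A n)
      ⊆ ⋂ k, ⋂ n, φ.step ρ (iCons k ν) (A n) :=
        iInf_diag_le_iInf_iInf (fun _ _ hk n => hstep hk (A n))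
          fun k => (φ.step_mono ρ (iCons k ν)).comp_antitone hA
    _ ⊆ φ.all.step ρ ν (⋂ n, A n) :=
        iInter_mono fun k => h.iInter_step_subset nofun hA ρ _

end Lang

/-! ### Soundness -/

theorem Form.mem_sem_bigAnd {Γ : Ctx} {τ : Ty 0} {ρ : FVal Γ} {ν : ℕ → ℕ} {x : τ.dom}
    {l : List (Form Γ τ)} : x ∈ (bigAnd l).sem ρ ν ↔ ∀ φ ∈ l, x ∈ φ.sem ρ ν := by
  induction l with
  | nil => simp [bigAnd, sem]
  | cons φ l ih => simp [bigAnd, sem, ih]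

theorem LangAnd.bigAnd {τ : Ty 0} {l : List (Form [] τ)} (h : ∀ φ ∈ l, LangAnd φ) :
    LangAnd (Form.bigAnd l) := by
  induction l with
  | nil => exact .tru
  | cons φ l ih =>
    rw [List.forall_mem_cons] at h
    exact .and h.1 (ih h.2)

theorem Cons.langAnd {τ : Ty 0} {δ : Form [] τ} (h : Cons δ) : LangAnd δ := by
  induction h using Cons.rec (motive_1 := fun _ _ _ => True) with
  | unit => exact .unit
  | tru => exact .tru
  | fold _ ih | inj1 _ ih | inj2 _ ih => exact .mod ih
  | pair _ _ ih₁ ih₂ => exact .and (.mod ih₁) (.mod ih₂)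
  | up _ _ hφ => exact hφ
  | imp _ _ _ _ _ _ ih₁ ih₂ =>
    exact .bigAnd (List.forall_mem_map.2 fun p hp => .imp (ih₁ p hp) (ih₂ p hp))
  | _ => trivial

theorem Pos.of_ex {Γ : Ctx} {τ : Ty 0} {k : ℕ} {φ : Form Γ τ} (h : Pos k φ.ex) :
    Pos (k + 1) φ := by
  cases h with
  | notFree h => exact .notFree h
  | ex h => exact h

theorem Neg.of_all {Γ : Ctx} {τ : Ty 0} {k : ℕ} {φ : Form Γ τ} (h : Neg k φ.all) :
    Neg (k + 1) φ := by
  cases h with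
  | notFree h => exact .notFree h
  | all h => exact h

section Rules

variable {Γ : Ctx} {σ τ : Ty 0} (ρ : FVal Γ) (ν : ℕ → ℕ)

theorem sem_ex_ex_subset {φ : Form Γ τ} (h₀ : Pos 0 φ) (h₁ : Pos 1 φ) :
    φ.ex.ex.sem ρ ν ⊆ (φ.inst (.var 0)).ex.sem ρ ν :=
  (iSup_iSup_le_iSup_diag (fun _ _ hm n => h₁.monotone_sem_iCons_iCons ρ n ν hm)
    fun m => h₀.monotone_sem_iCons ρ (iCons m ν)).trans
    (iUnion_mono fun n => (φ.sem_inst (.var 0) ρ (iCons n ν)).ge)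

theorem sem_all_inst_subset {φ : Form Γ τ} (h₀ : Neg 0 φ) (h₁ : Neg 1 φ) :
    (φ.inst (.var 0)).all.sem ρ ν ⊆ φ.all.all.sem ρ ν :=
  (iInter_mono fun n => (φ.sem_inst (.var 0) ρ (iCons n ν)).le).trans
    (iInf_diag_le_iInf_iInf (fun _ _ hm n => h₁.antitone_sem_iCons_iCons ρ n ν hm)
      fun m => h₀.antitone_sem_iCons ρ (iCons m ν))

theorem sem_all_imp_subset {ψ : Form [] σ} {φ : Form [] τ} (hψ : Lang .neg ψ) (hneg : Neg 0 ψ)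
    (hφ : Lang .pos φ) :
    (Form.imp (Γ := Γ) ψ.all φ).sem ρ ν ⊆ (Form.imp (Γ := Γ) ψ φ.shift).ex.sem ρ ν := by
  have hadm := hφ.admissible_sem_nil ν
  exact (impSet_iInter_subset (hneg.antitone_sem_iCons FVal.nil ν)
    (fun _ => (hψ.admissible_sem_nil _).isClosed nofun) hadm.isUpperSet (hadm.isOpen nofun)).trans
    (iUnion_mono fun n => impSet_mono subset_rfl (φ.sem_shift FVal.nil n ν).ge)

theorem sem_imp_ex_subset {ψ : Form [] σ} {φ : Form [] τ} (hψ : Lang .neutral ψ)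
    (hφ : Lang .pos φ) (hpos : Pos 0 φ) :
    (Form.imp (Γ := Γ) ψ φ.ex).sem ρ ν ⊆ (Form.imp (Γ := Γ) ψ.shift φ).ex.sem ρ ν :=
  (impSet_iUnion_subset ((hψ.admissible_sem_nil ν).isClosed nofun)
    (hpos.monotone_sem_iCons FVal.nil ν) (fun _ => (hφ.admissible_sem_nil _).isUpperSet)
    (fun _ => (hφ.admissible_sem_nil _).isOpen nofun)).trans
    (iUnion_mono fun n => impSet_mono (ψ.sem_shift FVal.nil n ν).le subset_rfl)

theorem sem_imp_or_subset {δ : Form [] σ} {φ₁ φ₂ : Form [] τ} (hδ : LangAnd δ) {s : Sign}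
    (h₁ : Lang s φ₁) (h₂ : Lang s φ₂) :
    (Form.imp (Γ := Γ) δ (φ₁.or φ₂)).sem ρ ν ⊆
      ((Form.imp (Γ := Γ) δ φ₁).or (Form.imp δ φ₂)).sem ρ ν :=
  (hδ.isCompactCone_sem ν).impSet_union_subset (h₁.admissible_sem_nil ν).isUpperSet
    (h₂.admissible_sem_nil ν).isUpperSet

theorem nonempty_sem_bigAnd_imp {l : List (Form [] σ × Form [] τ)}
    (h₁ : ∀ p ∈ l, LangAnd p.1) (hne : ∀ p ∈ l, (p.1.sem FVal.nil ν).Nonempty)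
    (h₂ : ∀ p ∈ l, LangAnd p.2)
    (h : ∀ l', List.Sublist l' l → ((Form.bigAnd (l'.map Prod.fst)).sem FVal.nil ν).Nonempty →
      ((Form.bigAnd (l'.map Prod.snd)).sem FVal.nil ν).Nonempty) :
    ((Form.bigAnd (l.map fun p => Form.imp p.1 p.2)).sem FVal.nil ν).Nonempty := by
  classical
  have hglue : (⋂ p : {p // p ∈ l},
      impSet (p.1.1.sem FVal.nil ν) (p.1.2.sem FVal.nil ν)).Nonempty := by
    refine IsCompactCone.nonempty_iInter_impSet (fun p => (h₁ p p.2).isCompactCone_sem ν)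
      (fun p => hne p p.2) (fun p => (h₂ p p.2).isCompactCone_sem ν) fun x => ?_
    obtain ⟨y, hy⟩ := h (l.filter fun p => x ∈ p.1.sem FVal.nil ν) List.filter_sublist
      ⟨x, Form.mem_sem_bigAnd.2 (List.forall_mem_map.2 fun p hp =>
        of_decide_eq_true (List.mem_filter.1 hp).2)⟩
    rw [Form.mem_sem_bigAnd, List.forall_mem_map] at hy
    exact ⟨y, mem_iInter₂.2 fun p hp =>
      hy p (List.mem_filter.2 ⟨p.2, decide_eq_true hp⟩)⟩
  obtain ⟨f, hf⟩ := hglue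
  exact ⟨f, Form.mem_sem_bigAnd.2 (List.forall_mem_map.2 fun p hp => mem_iInter.1 hf ⟨p, hp⟩)⟩

end Rules

mutual

theorem Ded.sound : ∀ {Γ : Ctx} {τ : Ty 0} {ψ φ : Form Γ τ}, Ded ψ φ →
    ∀ (ρ : FVal Γ) (ν : ℕ → ℕ), ψ.sem ρ ν ⊆ φ.sem ρ ν
  | _, _, _, _, .refl _, _, _ => subset_rfl
  | _, _, _, _, .cut _ h₁ h₂, ρ, ν => (h₁.sound ρ ν).trans (h₂.sound ρ ν)
  | _, _, _, _, .distr _, _, _ => (inter_union_distrib_left _ _ _).subset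
  | _, _, _, _, .andR _ h₁ h₂, ρ, ν => subset_inter (h₁.sound ρ ν) (h₂.sound ρ ν)
  | _, _, _, _, .andL₁ _ h, ρ, ν => inter_subset_left.trans (h.sound ρ ν)
  | _, _, _, _, .andL₂ _ h, ρ, ν => inter_subset_right.trans (h.sound ρ ν)
  | _, _, _, _, .truR _, _, _ => subset_univ _
  | _, _, _, _, .orR₁ _ h, ρ, ν => (h.sound ρ ν).trans subset_union_left
  | _, _, _, _, .orR₂ _ h, ρ, ν => (h.sound ρ ν).trans subset_union_right
  | _, _, _, _, .orL _ h₁ h₂, ρ, ν => union_subset (h₁.sound ρ ν) (h₂.sound ρ ν)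
  | _, _, _, _, .flsL _, _, _ => empty_subset _
  | _, _, _, _, .injDisj _, _, _ => by rintro _ ⟨⟨x, _, rfl⟩, y, _, ⟨⟩⟩
  | _, _, _, _, .modMono (m := m) _ h, ρ, ν => m.sem_mono (h.sound ρ ν)
  | _, _, _, _, .impMono _ h₁ h₂, _, ν => impSet_mono (h₁.sound _ ν) (h₂.sound _ ν)
  | _, _, _, _, .modAnd (m := m) _, _, _ => (m.sem_inter _ _).symm.subset
  | _, _, _, _, .modTru (m := m) hm _, _, _ => (m.sem_univ hm).symm.subset
  | _, _, _, _, .modAll (m := m) _, _, _ => (m.sem_iInter _).symm.subset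
  | _, _, _, _, .modOr (m := m) _, _, _ => (m.sem_union _ _).subset
  | _, _, _, _, .modFls (m := m) _, _, _ => m.sem_empty.subset
  | _, _, _, _, .modEx (m := m) _, _, _ => (m.sem_iUnion _).subset
  | _, _, _, _, .exR (φ := φ) (t := t) _ h, ρ, ν =>
    (h.sound ρ ν).trans <| (φ.sem_inst t ρ ν).le.trans <|
      subset_iUnion (fun n => φ.sem ρ (iCons n ν)) _
  | _, _, _, _, .exL (θ := θ) (ψ := ψ) _ h, ρ, ν => by
    rintro x ⟨hθ, hφ⟩
    obtain ⟨n, hn⟩ := mem_iUnion.1 hφ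
    rw [← ψ.sem_shift ρ n ν]
    rw [← θ.sem_shift ρ n ν] at hθ
    exact h.sound ρ (iCons n ν) ⟨hθ, hn⟩
  | _, _, _, _, .exM ⟨_, .ex (.ex _ h₀) h₁, _⟩, ρ, ν => sem_ex_ex_subset ρ ν h₀ h₁.of_ex
  | _, _, _, _, .allL (φ := φ) (t := t) _ h, ρ, ν =>
    (iInter_subset (fun n => φ.sem ρ (iCons n ν)) _).trans <|
      (φ.sem_inst t ρ ν).ge.trans (h.sound ρ ν)
  | _, _, _, _, .allR (ψ := ψ) (θ := θ) _ h, ρ, ν => by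
    refine fun x hx => or_iff_not_imp_right.2 fun hθ => mem_iInter.2 fun n => ?_
    rw [← ψ.sem_shift ρ n ν] at hx
    rw [← θ.sem_shift ρ n ν] at hθ
    exact (h.sound ρ (iCons n ν) hx).resolve_right hθ
  | _, _, _, _, .allM ⟨_, _, .all (.all _ h₀) h₁⟩, ρ, ν => sem_all_inst_subset ρ ν h₀ h₁.of_all
  | _, _, _, _, .muEx ⟨_, .mu (.ex h hpos), _⟩, ρ, ν => by
    refine (h.iterate_step_ex_subset hpos ρ ν _ _).trans (iUnion_mono fun n => ?_)
    rw [Form.sem_mu, ITerm.eval_shift]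
  | _, _, _, _, .nuEx ⟨_, .nu (.ex h hpos), _⟩, ρ, ν => by
    refine (h.iterate_step_ex_subset hpos ρ ν _ _).trans (iUnion_mono fun n => ?_)
    rw [Form.sem_nu, ITerm.eval_shift]
  | _, _, _, _, .allMu ⟨_, _, .mu (.all h hneg)⟩, ρ, ν => by
    refine (iInter_mono fun n => ?_).trans (h.iInter_subset_iterate_step_all hneg ρ ν _ _)
    rw [Form.sem_mu, ITerm.eval_shift]
  | _, _, _, _, .allNu ⟨_, _, .nu (.all h hneg)⟩, ρ, ν => by
    refine (iInter_mono fun n => ?_).trans (h.iInter_subset_iterate_step_all hneg ρ ν _ _)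
    rw [Form.sem_nu, ITerm.eval_shift]
  | _, _, _, _, .muZero _, _, _ => subset_rfl
  | _, _, _, _, .muSuccL (φ := φ) _ h, ρ, ν => by
    rw [Form.sem_finst, Form.sem_mu_succ]
    exact φ.step_mono ρ ν (h.sound ρ ν)
  | _, _, _, _, .muSuccR _, ρ, ν => by
    rw [Form.sem_finst, Form.sem_mu_succ, Form.step]
  | _, _, _, _, .muMono (ψ := ψ) _ h, ρ, ν =>
    (ψ.step_mono ρ ν).iterate_le_of_le (fun _ => h.sound _ ν) _ _
  | _, _, _, _, .nuZero _, _, _ => subset_rfl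
  | _, _, _, _, .nuSuccR (φ := φ) _ h, ρ, ν => by
    rw [Form.sem_finst, Form.sem_nu_succ]
    exact φ.step_mono ρ ν (h.sound ρ ν)
  | _, _, _, _, .nuSuccL _, ρ, ν => by
    rw [Form.sem_finst, Form.sem_nu_succ, Form.step]
  | _, _, _, _, .nuMono (ψ := ψ) _ h, ρ, ν =>
    (ψ.step_mono ρ ν).iterate_le_of_le (fun _ => h.sound _ ν) _ _
  | _, _, _, _, .wf ⟨_, .imp hψ hφ, .ex _ _⟩, ρ, ν =>
    match hψ with
    | .all hψ hneg => sem_all_imp_subset ρ ν hψ hneg hφ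
  | _, _, _, _, .cc hψ ⟨_, .imp _ (.ex hφ hpos), _⟩, ρ, ν => sem_imp_ex_subset ρ ν hψ hφ hpos
  | _, _, _, _, .exImp (φ := φ) _, _, ν => fun f hf x hx => by
    obtain ⟨n, hn⟩ := mem_iUnion.1 hx
    rw [← φ.sem_shift _ n ν]
    exact mem_iInter.1 hf n x hn
  | _, _, _, _, .impAll (ψ := ψ) _, _, ν => fun f hf x hx => mem_iInter.2 fun n =>
    mem_iInter.1 hf n x (by rwa [ψ.sem_shift])
  | _, _, _, _, .impAnd _, _, _ => fun _ hf x hx => ⟨hf.1 x hx, hf.2 x hx⟩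
  | _, _, _, _, .impTru _, _, _ => fun _ _ _ _ => trivial
  | _, _, _, _, .orImp _, _, _ => fun _ hf x hx => hx.elim (hf.1 x) (hf.2 x)
  | _, _, _, _, .flsImp _, _, _ => fun _ _ _ hx => hx.elim
  | _, _, _, _, .impOr hδ ⟨_, .imp _ (.or h₁ h₂), _⟩, ρ, ν => sem_imp_or_subset ρ ν hδ h₁ h₂
  | _, _, _, _, .impFls hδ _ _, _, ν => fun f hf =>
    let ⟨x, hx⟩ := hδ.sound ν
    hf x hx

theorem Cons.sound : ∀ {τ : Ty 0} {δ : Form [] τ}, Cons δ →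
    ∀ ν : ℕ → ℕ, (δ.sem FVal.nil ν).Nonempty
  | _, _, .unit, _ => ⟨true, rfl⟩
  | _, _, .fold (τ := τ) h, ν => by
    obtain ⟨i, hi⟩ := Ty.exists_orderIso_eq_unfold τ
    exact (h.sound ν).preimage (hi ▸ i.surjective)
  | _, _, .pair h₁ h₂, ν =>
    let ⟨x, hx⟩ := h₁.sound ν
    let ⟨y, hy⟩ := h₂.sound ν
    ⟨(x, y), hx, hy⟩
  | _, _, .inj1 h, ν => (h.sound ν).image _
  | _, _, .inj2 h, ν => (h.sound ν).image _
  | τ, _, .tru, _ => τ.dom.exists_bot.imp fun _ _ => trivial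
  | _, _, .up h hd _, ν => (h.sound ν).mono (hd.sound _ ν)
  | _, _, .imp _ _ h₁ h₂ h₃ h₄, ν =>
    nonempty_sem_bigAnd_imp ν (fun p hp => (h₁ p hp).langAnd) (fun p hp => (h₁ p hp).sound ν)
      (fun p hp => (h₂ p hp).langAnd) fun l' hl ⟨x, hx⟩ =>
        (h₄ l' hl fun hA => (h₃ l' hl hA).sound _ ν hx).sound ν

end

end RefLogic

theorem mainTheorem4 :
    (∀ (τ : RefLogic.Ty 0) (δ : RefLogic.Form [] τ), RefLogic.LangAnd δ → RefLogic.Cons δ →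
      ∀ ν : ℕ → ℕ, (δ.sem RefLogic.FVal.nil ν).Nonempty) ∧
    (∀ (s : RefLogic.Sign) (Γ : RefLogic.Ctx) (τ : RefLogic.Ty 0) (ψ φ : RefLogic.Form Γ τ),
      RefLogic.Lang s ψ → RefLogic.Lang s φ → RefLogic.Ded ψ φ →
      ∀ (ρ : RefLogic.FVal Γ) (ν : ℕ → ℕ), ψ.sem ρ ν ⊆ φ.sem ρ ν) :=
  ⟨fun _ _ _ h => h.sound, fun _ _ _ _ _ _ _ h => h.sound⟩
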